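/- **Conventions.** Let $\Bbbk$ be a commutative ring. An $A_\infty$-category $\mathcal C$ has a set of objects, $\mathbb Z$-graded $\Bbbk$-modules $s\mathcal C(X,Y)=\mathcal C(X,Y)[1]$, and $\Bbbk$-linear maps $b_n:s\mathcal C(X_0,X_1)\otimes\dots\otimes s\mathcal C(X_{n-1},X_n)\to s\mathcal C(X_0,X_n)$, $n\ge1$, of degree $1$ with $\sum_{\alpha+p+\beta=n}(1^{\otimes\alpha}\otimes b_p\otimes1^{\otimes\beta})b_{\alpha+1+\beta}=0$. Maps are written on the right, composed from left to right, with $(x\otimes y)(f\otimes g)=(-1)^{|y||f|}xf\otimes yg$. The category $\mathcal C$ is *unital* if for every object $X$ there is a cycle ${}_X\mathbf i_0\in s\mathcal C(X,X)$ of degree $-1$ (a *unit element*) such that for all $X,Y$ the maps $(1\otimes\mathbf i_0)b_2$ and $-(\mathbf i_0\otimes1)b_2$ from $s\mathcal C(X,Y)$ to itself are homotopic to the identity: there are $\Bbbk$-linear maps $h,h'$ of degree $-1$ with $1-(1\otimes\mathbf i_0)b_2=b_1h+hb_1$ and $1+(\mathbf i_0\otimes1)b_2=b_1h'+h'b_1$.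 **The quotient.** Let $\mathcal B\subset\mathcal C$ be a full subcategory. Consider plane rooted trees $t$ with $n\ge1$ leaves, whose internal vertices have arity $\ge1$ and in which no two unary vertices are joined by an edge, labeled by objects $X_0,\dots,X_n$ of $\mathcal C$. An edge goes from $X_{i-1}$ to $X_k$ if the leaves above it are those with numbers $i,\dots,k$. The tree is *admissible* if every edge adjacent to a unary vertex has its source or its target in $\mathcal B$. Let $\mathcal E$ have the objects of $\mathcal C$ and $$s\mathcal E(X,Y)=\bigoplus_{t:\,X_0=X,\,X_n=Y}s\mathcal E(t),\qquad s\mathcal E(t)=s\mathcal C(X_0,X_1)\otimes\dots\otimes s\mathcal C(X_{n-1},X_n)\bigl[|t|_1-|t|_>\bigr],$$ where $t$ runs over the admissible trees, and $|t|_1$ and $|t|_>$ are the numbers of unary internal vertices and of internal vertices of arity $>1$. For $k>1$ the operation $b_k$ of $\mathcal E$ is grafting to a $k$-ary corolla (of degree $1$). If the lowest internal vertex of $t$ is not unary (or $t$ is trivial) and $X_0\in\mathcal B$ or $X_n\in\mathcal B$, then $H:s\mathcal E(t)\to s\mathcal E(X_0,X_n)$ is grafting to a unary corolla (of degree $-1$).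 The differential $b_1$ of $\mathcal E$ extends that of $s\mathcal C$ (the summand of trivial trees), with $$b_kb_1=-\sum_{\alpha+p+\beta=k,\ \alpha+\beta>0}(1^{\otimes\alpha}\otimes b_p\otimes1^{\otimes\beta})b_{\alpha+1+\beta}\quad(k>1),\qquad Hb_1=1-b_1H .$$ Let $(R_{\mathcal C})_+\subset s\mathcal E$ be the ideal generated, by application of $1^{\otimes\alpha}\otimes H\otimes1^{\otimes\beta}$ and $1^{\otimes\alpha}\otimes b_p\otimes1^{\otimes\beta}$, $p\ge2$, by the images of the differences, for $n\ge2$, of the maps $(s\mathcal C)^{\otimes n}\hookrightarrow(s\mathcal E)^{\otimes n}\xrightarrow{b_n^{\mathcal E}}s\mathcal E$ and $(s\mathcal C)^{\otimes n}\xrightarrow{b_n^{\mathcal C}}s\mathcal C\hookrightarrow s\mathcal E$. It is stable under all operations of $\mathcal E$, and the quotient $A_\infty$-category is denoted $\mathcal D=\mathsf Q(\mathcal C|\mathcal B)=\mathcal E/s^{-1}(R_{\mathcal C})_+$. **Theorem.** Assume that $\mathcal C$ is a unital $A_\infty$-category with unit elements $\mathbf i_0$ satisfying $$(1\otimes\mathbf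 i_0)b_2=1,\qquad(\mathbf i_0\otimes1)b_2=-1,\qquad(1^{\otimes n}\otimes\mathbf i_0)b_{n+1}=0=(\mathbf i_0\otimes1^{\otimes n})b_{n+1}\quad\text{for }n>1 .$$ Then for every full subcategory $\mathcal B\subset\mathcal C$ the $A_\infty$-category $\mathcal D=\mathsf Q(\mathcal C|\mathcal B)$ is unital, and the images of the unit elements ${}_X\mathbf i_0$ of $\mathcal C$ under $s\mathcal C\hookrightarrow s\mathcal E\to s\mathcal D$ are unit elements of $\mathcal D$. -/

import Mathlib

/- An `A∞`-category `C` over `k` is stored through its shifted morphism modules `sC(X,Y) = C(X,Y)[1]`: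
`Hom X Y` is `sC(X,Y)`, graded by submodules `deg X Y n`, and the operations `b_n` have degree `1`.
Operators act on the right in the sign rule: in `(x₁ ⊗ ⋯ ⊗ xₙ)(1^α ⊗ b_p ⊗ 1^β)` the operation `b_p`,
of degree `1`, passes the last `β` arguments, so each of these is replaced by its image under
`parity : x ↦ (-1)^{|x|} x`. -/
open scoped TensorProduct DirectSum

universe u v w

namespace AInf

/-- Composable strings `x₁, …, xₙ` (`n ≥ 0`) with `xᵢ ∈ H (Xᵢ₋₁) (Xᵢ)`. -/
inductive Chain {Ob : Type v} (H : Ob → Ob → Type w) : Ob → Ob → Type (max v w)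
  | nil (X : Ob) : Chain H X X
  | cons {X Y Z : Ob} (x : H X Y) (p : Chain H Y Z) : Chain H X Z

namespace Chain

variable {Ob : Type v} {H : Ob → Ob → Type w}

/-- The string consisting of one morphism. -/
def single {X Y : Ob} (x : H X Y) : Chain H X Y := cons x (nil Y)

/-- Concatenation. -/
def append : ∀ {X Y Z : Ob}, Chain H X Y → Chain H Y Z → Chain H X Z
  | _, _, _, nil _, q => q
  | _, _, _, cons x p, q => cons x (append p q)

/-- The number of morphisms in a string. -/
def length : ∀ {X Y : Ob}, Chain H X Y → ℕ
  | _, _, nil _ => 0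
  | _, _, cons _ p => length p + 1

/-- Apply a map to every morphism in a string. -/
def map {H' : Ob → Ob → Type*} (φ : ∀ {X Y : Ob}, H X Y → H' X Y) :
    ∀ {X Y : Ob}, Chain H X Y → Chain H' X Y
  | _, _, nil X => nil X
  | _, _, cons x p => cons (φ x) (map φ p)

/-- A factorization of a string from `X` to `Z` into two consecutive strings. -/
structure Cut (H : Ob → Ob → Type w) (X Z : Ob) where
  mid : Ob
  left : Chain H X mid
  right : Chain H mid Z

/-- The list of all `n + 1` factorizations `w = left · right` of a string `w` of length `n`. -/
def cuts : ∀ {X Z : Ob}, Chain H X Z → List (Cut H X Z)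
  | _, _, nil X => [⟨X, nil X, nil X⟩]
  | X, _, cons x p =>
      ⟨X, nil X, cons x p⟩ :: (cuts p).map (fun c => ⟨c.mid, cons x c.left, c.right⟩)

end Chain

/-- A graded `k`-quiver with set of objects `Ob`: each `Hom X Y` is a `ℤ`-graded `k`-module, the direct
sum of its submodules `deg X Y n` of homogeneous elements of degree `n`. -/
structure GrQuiver (k : Type u) [CommRing k] (Ob : Type v) where
  Hom : Ob → Ob → Type w
  [addCommGroup : ∀ X Y, AddCommGroup (Hom X Y)]
  [module : ∀ X Y, Module k (Hom X Y)]
  deg : ∀ X Y, ℤ → Submodule k (Hom X Y)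
  isInternal : ∀ X Y, DirectSum.IsInternal (deg X Y)

attribute [instance] GrQuiver.addCommGroup GrQuiver.module

variable {k : Type u} [CommRing k] {Ob : Type v}

namespace GrQuiver

/-- The decomposition of a morphism into homogeneous components. -/
noncomputable def decomp (Q : GrQuiver.{u, v, w} k Ob) (X Y : Ob) :
    Q.Hom X Y ≃ₗ[k] ⨁ n, Q.deg X Y n :=
  (LinearEquiv.ofBijective (DirectSum.coeLinearMap (Q.deg X Y)) (Q.isInternal X Y)).symm

/-- The map `x ↦ (-1)^n x` for `x` of degree `n`. -/
noncomputable def parity (Q : GrQuiver.{u, v, w} k Ob) {X Y : Ob} : Q.Hom X Y →ₗ[k] Q.Hom X Y :=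
  (DirectSum.toModule k ℤ (Q.Hom X Y) fun n => (n.negOnePow : ℤ) • (Q.deg X Y n).subtype) ∘ₗ
    (Q.decomp X Y).toLinearMap

theorem isInternal_of_proj {N : Type*} [AddCommGroup N] [Module k N] (A : ℤ → Submodule k N)
    (π : ℤ → N →ₗ[k] N) (h₁ : ∀ n x, x ∈ A n → π n x = x)
    (h₂ : ∀ m n x, m ≠ n → x ∈ A m → π n x = 0) (h₃ : ∀ x, x ∈ ⨆ n, A n) :
    DirectSum.IsInternal A := by
  refine DirectSum.isInternal_submodule_of_iSupIndep_of_iSup_eq_top ?_ (eq_top_iff.2 fun x _ => h₃ x)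
  intro i
  rw [Submodule.disjoint_def]
  intro x hx hx'
  have : (⨆ j, ⨆ (_ : j ≠ i), A j) ≤ LinearMap.ker (π i) :=
    iSup_le fun j => iSup_le fun hj y hy => h₂ j i y hj hy
  rw [← h₁ i x hx]
  exact this hx'

section
variable (Q : GrQuiver.{u, v, w} k Ob) {X Y : Ob}

theorem mem_iSup (x : Q.Hom X Y) : x ∈ ⨆ n, Q.deg X Y n :=
  (Q.isInternal X Y).submodule_iSup_eq_top ▸ Submodule.mem_top

theorem homog_induction {p : Q.Hom X Y → Prop} (h0 : p 0) (hadd : ∀ x y, p x → p y → p (x + y))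
    (h : ∀ n, ∀ x ∈ Q.deg X Y n, p x) (x : Q.Hom X Y) : p x :=
  Submodule.iSup_induction _ (motive := p) (Q.mem_iSup x) h h0 hadd

theorem hom_ext {N : Type*} [AddCommGroup N] [Module k N] {f g : Q.Hom X Y →ₗ[k] N}
    (h : ∀ n, ∀ x ∈ Q.deg X Y n, f x = g x) (x : Q.Hom X Y) : f x = g x :=
  Q.homog_induction (p := fun x => f x = g x) (by simp) (fun x y hx hy => by simp [hx, hy]) h x

theorem decomp_of_mem {n : ℤ} {x : Q.Hom X Y} (hx : x ∈ Q.deg X Y n) :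
    Q.decomp X Y x = DirectSum.lof k ℤ (fun n => Q.deg X Y n) n ⟨x, hx⟩ := by
  rw [decomp, LinearEquiv.symm_apply_eq]
  exact (DirectSum.coeLinearMap_lof (Q.deg X Y) n ⟨x, hx⟩).symm

theorem parity_of_mem {n : ℤ} {x : Q.Hom X Y} (hx : x ∈ Q.deg X Y n) :
    Q.parity x = (n.negOnePow : ℤ) • x := by
  simp [parity, decomp_of_mem Q hx]

/-- The projection to the homogeneous component of degree `n`. -/
noncomputable def proj (n : ℤ) : Q.Hom X Y →ₗ[k] Q.Hom X Y :=
  (Q.deg X Y n).subtype ∘ₗ DirectSum.component k ℤ (fun n => Q.deg X Y n) n ∘ₗ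
    (Q.decomp X Y).toLinearMap

theorem proj_of_mem {m : ℤ} (n : ℤ) {x : Q.Hom X Y} (hx : x ∈ Q.deg X Y m) :
    Q.proj n x = if m = n then x else 0 := by
  simp only [proj, LinearMap.comp_apply, LinearEquiv.coe_coe, decomp_of_mem Q hx, DirectSum.component.of]
  split_ifs with h
  · subst h; rfl
  · rfl

theorem proj_mem (n : ℤ) (x : Q.Hom X Y) : Q.proj n x ∈ Q.deg X Y n := by
  simp [proj]

end

/-- The string consists of homogeneous morphisms whose degrees add up to `n`. -/
def IsHomog (Q : GrQuiver.{u, v, w} k Ob) : ∀ {X Y : Ob}, Chain Q.Hom X Y → ℤ → Prop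
  | _, _, .nil _, n => n = 0
  | X, _, .cons (Y := Y) x p, n => ∃ d e : ℤ, x ∈ Q.deg X Y d ∧ Q.IsHomog p e ∧ d + e = n

end GrQuiver

/-- A (possibly non-unital) `A∞`-category `C` with set of objects `Ob`. The underlying graded quiver
is `sC`. On strings of length `n` the map `b` is the operation `b_n`: it is multilinear (`b_add`,
`b_smul`), of degree `1` (`b_deg`), and satisfies
`∑_{α+p+β=n} (1^α ⊗ b_p ⊗ 1^β) b_{α+1+β} = 0` (`b_rel`; the summands with `p = 0` vanish, as
`b₀ = 0`). -/
structure Cat (k : Type u) [CommRing k] (Ob : Type v) extends GrQuiver.{u, v, w} k Ob where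
  b : ∀ {X Y : Ob}, Chain Hom X Y → Hom X Y
  b_nil : ∀ X : Ob, b (.nil X) = 0
  b_add : ∀ {W X Y Z : Ob} (p : Chain Hom W X) (x y : Hom X Y) (q : Chain Hom Y Z),
    b (p.append (.cons (x + y) q)) = b (p.append (.cons x q)) + b (p.append (.cons y q))
  b_smul : ∀ {W X Y Z : Ob} (p : Chain Hom W X) (c : k) (x : Hom X Y) (q : Chain Hom Y Z),
    b (p.append (.cons (c • x) q)) = c • b (p.append (.cons x q))
  b_deg : ∀ {X Y : Ob} (p : Chain Hom X Y) (n : ℤ), toGrQuiver.IsHomog p n → b p ∈ deg X Y (n + 1)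
  b_rel : ∀ {X Y : Ob} (p : Chain Hom X Y),
    (p.cuts.map fun c => (c.right.cuts.map fun c' =>
      b (c.left.append (.cons (b c'.left) (c'.right.map toGrQuiver.parity)))).sum).sum = 0

namespace Cat

/-- The differential `b₁` of `sC(X,Y)`. -/
noncomputable def b₁ (C : Cat.{u, v, w} k Ob) {X Y : Ob} : C.Hom X Y →ₗ[k] C.Hom X Y where
  toFun x := C.b (.single x)
  map_add' x y := C.b_add (.nil X) x y (.nil Y)
  map_smul' c x := C.b_smul (.nil X) c x (.nil Y)

/-- The differential as a map between homogeneous components. -/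
noncomputable def b₁deg (C : Cat.{u, v, w} k Ob) (X Y : Ob) (n : ℤ) :
    C.deg X Y n →ₗ[k] C.deg X Y (n + 1) :=
  C.b₁.restrict fun x hx => C.b_deg (.single x) n ⟨n, 0, hx, rfl, add_zero n⟩

end Cat

/-- The kinds of trees in the definition of `Tree`: trees whose lowest internal vertex is not unary
(`plain`), all trees (`tree`), non-empty sequences of trees (`forest`). -/
inductive Kind
  | plain | tree | forest

/-- Admissible trees for the full subcategory on the set of objects `B`. A `plain` tree is either
the trivial tree with one leaf from `X` to `Y`, or it has a lowest vertex of arity `≥ 2`, given by the first subtree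
and the forest of all the others. A `tree` is a plain one, or has a unary lowest vertex above which
there is a plain tree: so unary vertices are not joined by an edge. For a unary vertex the source or
the target of the edges adjacent to it has to lie in `B`. Leaves carry in addition a degree `n`,
which picks out the homogeneous component of degree `n` of `sC(X,Y)`; so the summand of an admissible tree in the usual
sense is the direct sum of the summands of all labelings of its leaves by degrees. -/
inductive Tree {Ob : Type v} (B : Set Ob) : Kind → Ob → Ob → Type v
  | leaf (X Y : Ob) (n : ℤ) : Tree B .plain X Y
  | node {X Y Z : Ob} (t : Tree B .tree X Y) (f : Tree B .forest Y Z) : Tree B .plain X Z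
  | ofPlain {X Y : Ob} (p : Tree B .plain X Y) : Tree B .tree X Y
  | unary {X Y : Ob} (h : X ∈ B ∨ Y ∈ B) (p : Tree B .plain X Y) : Tree B .tree X Y
  | one {X Y : Ob} (t : Tree B .tree X Y) : Tree B .forest X Y
  | cons {X Y Z : Ob} (t : Tree B .tree X Y) (f : Tree B .forest Y Z) : Tree B .forest X Z

namespace Tree
variable {B : Set Ob}

/-- The degree: vertices of arity `> 1` have degree `1`, unary ones have degree `-1`. -/
def degree : ∀ {κ : Kind} {X Y : Ob}, Tree B κ X Y → ℤ
  | _, _, _, leaf _ _ n => n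
  | _, _, _, node t f => degree t + degree f + 1
  | _, _, _, ofPlain p => degree p
  | _, _, _, unary _ p => degree p - 1
  | _, _, _, one t => degree t
  | _, _, _, cons t f => degree t + degree f

/-- The tensor product over the leaves of the tree of the components `sC(X,Y)ₙ`. -/
noncomputable def mod (C : GrQuiver.{u, v, w} k Ob) :
    ∀ {κ : Kind} {X Y : Ob}, Tree B κ X Y → ModuleCat.{w} k
  | _, _, _, leaf X Y n => ModuleCat.of k (C.deg X Y n)
  | _, _, _, node t f => ModuleCat.of k (mod C t ⊗[k] mod C f)
  | _, _, _, ofPlain p => mod C p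
  | _, _, _, unary _ p => mod C p
  | _, _, _, one t => mod C t
  | _, _, _, cons t f => ModuleCat.of k (mod C t ⊗[k] mod C f)

end Tree

/-- The direct sum over all trees (or forests) from `X` to `Y`. For the kind `tree` this is
`sE(X,Y)`; for the kind `plain` it is the summand of the trees whose lowest vertex is not unary; for the kind `forest`
it is the direct sum of all `sE(X,X₁) ⊗ ⋯ ⊗ sE(Xₙ₋₁,Y)`, `n ≥ 1`. -/
abbrev M (C : GrQuiver.{u, v, w} k Ob) (B : Set Ob) (κ : Kind) (X Y : Ob) : Type (max v w) :=
  ⨁ t : Tree B κ X Y, (t.mod C)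

noncomputable instance (C : GrQuiver.{u, v, w} k Ob) (B : Set Ob) (κ : Kind) (X Y : Ob) :
    AddCommMonoid (M C B κ X Y) := DirectSum.instAddCommMonoid _ _

noncomputable instance (C : GrQuiver.{u, v, w} k Ob) (B : Set Ob) (κ : Kind) (X Y : Ob) :
    Module k (M C B κ X Y) := DirectSum.instModule

section
variable (C : GrQuiver.{u, v, w} k Ob) {B : Set Ob}
open Classical in
/-- The inclusion of a direct summand. -/
noncomputable def inj {κ : Kind} {X Y : Ob} (t : Tree B κ X Y) : t.mod C →ₗ[k] M C B κ X Y :=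
  DirectSum.lof k _ (fun t : Tree B κ X Y => (t.mod C)) t

open Classical in
/-- The map given on every summand. -/
noncomputable def elim {κ : Kind} {X Y : Ob} {N : Type*} [AddCommMonoid N] [Module k N]
    (φ : ∀ t : Tree B κ X Y, t.mod C →ₗ[k] N) : M C B κ X Y →ₗ[k] N :=
  DirectSum.toModule k _ N φ

/-- The summand of a one-leaf tree. -/
noncomputable def iLeaf (X Y : Ob) (n : ℤ) : C.deg X Y n →ₗ[k] M C B .plain X Y :=
  inj C (.leaf X Y n : Tree B .plain X Y)

/-- The summand of a tree with lowest vertex of arity at least two. -/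
noncomputable def iNode {X Y Z : Ob} (t : Tree B .tree X Y) (f : Tree B .forest Y Z) :
    t.mod C ⊗[k] f.mod C →ₗ[k] M C B .plain X Z := inj C (.node t f)

/-- The summand of a tree with non-unary lowest vertex. -/
noncomputable def iPlain {X Y : Ob} (p : Tree B .plain X Y) : p.mod C →ₗ[k] M C B .tree X Y :=
  inj C (.ofPlain p)

/-- The summand of a tree with unary lowest vertex. -/
noncomputable def iUnary {X Y : Ob} (h : X ∈ B ∨ Y ∈ B) (p : Tree B .plain X Y) :
    p.mod C →ₗ[k] M C B .tree X Y := inj C (.unary h p)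

/-- The summand of a sequence of one tree. -/
noncomputable def iOne {X Y : Ob} (t : Tree B .tree X Y) : t.mod C →ₗ[k] M C B .forest X Y :=
  inj C (.one t)

/-- The summand of a sequence of at least two trees. -/
noncomputable def iCons {X Y Z : Ob} (t : Tree B .tree X Y) (f : Tree B .forest Y Z) :
    t.mod C ⊗[k] f.mod C →ₗ[k] M C B .forest X Z := inj C (.cons t f)

/-- The operation `(t₁, (t₂, …, tₖ)) ↦ (t₁ ⊗ ⋯ ⊗ tₖ)bₖ`, `k ≥ 2`, given by grafting. -/
noncomputable def nodeL {X Y Z : Ob} :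
    M C B .tree X Y →ₗ[k] M C B .forest Y Z →ₗ[k] M C B .plain X Z :=
  elim C fun t => LinearMap.flip (elim C fun f =>
    LinearMap.flip ((TensorProduct.mk k (t.mod C) (f.mod C)).compr₂ (iNode C t f)))

/-- Adding a tree to a sequence of trees: `x₁ , x₂ ⊗ ⋯ ⊗ xₖ ↦ x₁ ⊗ x₂ ⊗ ⋯ ⊗ xₖ`. -/
noncomputable def consL {X Y Z : Ob} :
    M C B .tree X Y →ₗ[k] M C B .forest Y Z →ₗ[k] M C B .forest X Z :=
  elim C fun t => LinearMap.flip (elim C fun f =>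
    LinearMap.flip ((TensorProduct.mk k (t.mod C) (f.mod C)).compr₂ (iCons C t f)))

/-- The inclusion of the trees with non-unary lowest vertex. -/
noncomputable def plainL {X Y : Ob} : M C B .plain X Y →ₗ[k] M C B .tree X Y := elim C (iPlain C)

/-- The operator `H` of degree `-1`, which puts a unary vertex at the bottom of a tree whose lowest vertex is
not unary. -/
noncomputable def unaryL {X Y : Ob} (h : X ∈ B ∨ Y ∈ B) :
    M C B .plain X Y →ₗ[k] M C B .tree X Y := elim C (iUnary C h)

/-- A tree as a sequence of one tree. -/
noncomputable def oneL {X Y : Ob} : M C B .tree X Y →ₗ[k] M C B .forest X Y := elim C (iOne C)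

/-- The map `x ↦ (-1)^n x` for `x` of degree `n`. -/
noncomputable def sgn {κ : Kind} {X Y : Ob} : M C B κ X Y →ₗ[k] M C B κ X Y :=
  elim C fun t => (t.degree.negOnePow : ℤ) • inj C t

/-- Pairs of consecutive sequences of trees. -/
abbrev MM (C : GrQuiver.{u, v, w} k Ob) (B : Set Ob) (X Z : Ob) : Type (max v w) :=
  ⨁ Y : Ob, (M C B .forest X Y ⊗[k] M C B .forest Y Z)

open Classical in
/-- The element `x ⊗ y`. -/
noncomputable def injMM {X Y Z : Ob} :
   M C B .forest X Y →ₗ[k] M C B .forest Y Z →ₗ[k] MM C B X Z :=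
  (TensorProduct.mk k _ _).compr₂ (DirectSum.lof k _ (fun Y : Ob => (M C B .forest X Y ⊗[k] M C B .forest Y Z)) Y)

open Classical in
/-- The map given by bilinear maps. -/
noncomputable def elimMM {X Z : Ob} {N : Type*} [AddCommMonoid N] [Module k N]
    (φ : ∀ Y : Ob, M C B .forest X Y →ₗ[k] M C B .forest Y Z →ₗ[k] N) : MM C B X Z →ₗ[k] N :=
  DirectSum.toModule k _ N (fun Y => TensorProduct.lift (φ Y))

theorem elim_inj {κ : Kind} {X Y : Ob} {N : Type*} [AddCommMonoid N] [Module k N]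
    (φ : ∀ t : Tree B κ X Y, t.mod C →ₗ[k] N) (t : Tree B κ X Y) (x : t.mod C) :
    elim C φ (inj C t x) = φ t x := by
  classical exact DirectSum.toModule_lof _ _ _

theorem M_induction {κ : Kind} {X Y : Ob} {p : M C B κ X Y → Prop} (h0 : p 0)
    (hadd : ∀ x y, p x → p y → p (x + y)) (h : ∀ t x, p (inj C t x)) (x : M C B κ X Y) : p x := by
  classical
  induction x using DirectSum.induction_on with
  | zero => exact h0
  | of i x => exact h i x
  | add x y hx hy => exact hadd x y hx hy

theorem elim_iLeaf {X Y : Ob} {N : Type*} [AddCommMonoid N] [Module k N]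
    (φ : ∀ t : Tree B .plain X Y, t.mod C →ₗ[k] N) (n : ℤ)
    (ψ : C.deg X Y n →ₗ[k] N) (h : φ (.leaf X Y n) = ψ) (z : C.deg X Y n) :
    elim C φ (iLeaf C X Y n z) = ψ z := h ▸ elim_inj ..

theorem elim_iNode {X Y Z : Ob} {N : Type*} [AddCommMonoid N] [Module k N]
    (φ : ∀ t : Tree B .plain X Z, t.mod C →ₗ[k] N) (t : Tree B .tree X Y) (f : Tree B .forest Y Z)
    (ψ : t.mod C ⊗[k] f.mod C →ₗ[k] N) (h : φ (.node t f) = ψ) (z : t.mod C ⊗[k] f.mod C) :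
    elim C φ (iNode C t f z) = ψ z := h ▸ elim_inj ..

theorem elim_iCons {X Y Z : Ob} {N : Type*} [AddCommMonoid N] [Module k N]
    (φ : ∀ t : Tree B .forest X Z, t.mod C →ₗ[k] N) (t : Tree B .tree X Y) (f : Tree B .forest Y Z)
    (ψ : t.mod C ⊗[k] f.mod C →ₗ[k] N) (h : φ (.cons t f) = ψ) (z : t.mod C ⊗[k] f.mod C) :
    elim C φ (iCons C t f z) = ψ z := h ▸ elim_inj ..

theorem elim_iPlain {X Y : Ob} {N : Type*} [AddCommMonoid N] [Module k N]
    (φ : ∀ t : Tree B .tree X Y, t.mod C →ₗ[k] N) (t : Tree B .plain X Y)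
    (ψ : t.mod C →ₗ[k] N) (h : φ (.ofPlain t) = ψ) (z : t.mod C) :
    elim C φ (iPlain C t z) = ψ z := h ▸ elim_inj ..

theorem elim_iUnary {X Y : Ob} {N : Type*} [AddCommMonoid N] [Module k N]
    (φ : ∀ t : Tree B .tree X Y, t.mod C →ₗ[k] N) (hB : X ∈ B ∨ Y ∈ B) (t : Tree B .plain X Y)
    (ψ : t.mod C →ₗ[k] N) (h : φ (.unary hB t) = ψ) (z : t.mod C) :
    elim C φ (iUnary C hB t z) = ψ z := h ▸ elim_inj ..

theorem elim_iOne {X Y : Ob} {N : Type*} [AddCommMonoid N] [Module k N]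
    (φ : ∀ t : Tree B .forest X Y, t.mod C →ₗ[k] N) (t : Tree B .tree X Y)
    (ψ : t.mod C →ₗ[k] N) (h : φ (.one t) = ψ) (z : t.mod C) :
    elim C φ (iOne C t z) = ψ z := h ▸ elim_inj ..

theorem nodeL_inj {X Y Z : Ob} (t : Tree B .tree X Y) (f : Tree B .forest Y Z) (x : t.mod C)
    (y : f.mod C) : nodeL C (inj C t x) (inj C f y) = iNode C t f (x ⊗ₜ[k] y) := by
  simp [nodeL, elim_inj]

theorem consL_inj {X Y Z : Ob} (t : Tree B .tree X Y) (f : Tree B .forest Y Z) (x : t.mod C)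
    (y : f.mod C) : consL C (inj C t x) (inj C f y) = iCons C t f (x ⊗ₜ[k] y) := by
  simp [consL, elim_inj]

theorem elimMM_inj {X Y Z : Ob} {N : Type*} [AddCommMonoid N] [Module k N]
    (φ : ∀ Y : Ob, M C B .forest X Y →ₗ[k] M C B .forest Y Z →ₗ[k] N)
    (x : M C B .forest X Y) (y : M C B .forest Y Z) :
    elimMM C φ (injMM C x y) = φ Y x y := by
  classical
  simp [elimMM, injMM, DirectSum.toModule_lof]

theorem MM_induction {X Z : Ob} {p : MM C B X Z → Prop} (h0 : p 0)
    (hadd : ∀ x y, p x → p y → p (x + y))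
    (h : ∀ (Y : Ob) (x : M C B .forest X Y) (y : M C B .forest Y Z), p (injMM C x y))
    (x : MM C B X Z) : p x := by
  classical
  induction x using DirectSum.induction_on with
  | zero => exact h0
  | of i x =>
    induction x using TensorProduct.induction_on with
    | zero => simpa using h0
    | tmul x y => exact h i x y
    | add x y hx hy => rw [map_add]; exact hadd _ _ hx hy
  | add x y hx hy => exact hadd x y hx hy

/-- `x , u ⊗ v ↦ (x ⊗ u) ⊗ v`. -/
noncomputable def consMM {X Y Z : Ob} :
    M C B .tree X Y →ₗ[k] MM C B Y Z →ₗ[k] MM C B X Z :=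
  LinearMap.flip (elimMM C fun W =>
    LinearMap.lflip.comp (LinearMap.flip ((consL C).compr₂ (injMM C (X := X) (Y := W) (Z := Z)))))

theorem consMM_inj {X Y Z W : Ob} (x : M C B .tree X Y) (u : M C B .forest Y W)
    (v : M C B .forest W Z) : consMM C x (injMM C u v) = injMM C (consL C x u) v := by
  simp [consMM, elimMM_inj]

/-- Reduced deconcatenation on a summand. -/
noncomputable def cutT : ∀ {κ : Kind} {X Z : Ob} (f : Tree B κ X Z), f.mod C →ₗ[k] MM C B X Z
  | _, _, _, .cons t f => TensorProduct.lift
      ((injMM C).compl₁₂ (oneL C ∘ₗ inj C t) (inj C f) +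
        (consMM C).compl₁₂ (inj C t) (cutT f))
  | _, _, _, .leaf _ _ _ => 0
  | _, _, _, .node _ _ => 0
  | _, _, _, .ofPlain _ => 0
  | _, _, _, .unary _ _ => 0
  | _, _, _, .one _ => 0

/-- Reduced deconcatenation `x₁ ⊗ ⋯ ⊗ xₖ ↦ ∑_{0<i<k} (x₁ ⊗ ⋯ ⊗ xᵢ) ⊗ (xᵢ₊₁ ⊗ ⋯ ⊗ xₖ)`. -/
noncomputable def cut {κ : Kind} {X Z : Ob} : M C B κ X Z →ₗ[k] MM C B X Z := elim C (cutT C)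

/-- The sum of the operations `bₖ`, `k ≥ 2`, of `E`. -/
noncomputable def bGe {X Z : Ob} : M C B .forest X Z →ₗ[k] M C B .plain X Z :=
  elim C fun
    | .one _ => 0
    | .cons t f => iNode C t f

/-- `u ⊗ v ↦ (u)g ⊗ sgn v`. -/
noncomputable def theta {X Z : Ob} (g : ∀ Y, M C B .forest X Y →ₗ[k] M C B .tree X Y) :
    MM C B X Z →ₗ[k] M C B .forest X Z :=
  elimMM C fun Y => ((consL C).comp (g Y)).compl₂ (sgn C)

/-- The differential `∑ 1^α ⊗ b_p ⊗ 1^β` of sequences of trees, on a summand of sequences of length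
`≥ 2`, for given values of the differential on the first tree `t` and on the sequence `f` of the other ones. The
summands are those with `α > 0`; with `α = 0`, `p = 1`; with `α = 0`, `p ≥ 2`, `β > 0`; and with
`α = β = 0`. -/
noncomputable def dCons {X Y Z : Ob} (t : Tree B .tree X Y) (f : Tree B .forest Y Z)
    (dt : t.mod C →ₗ[k] M C B .tree X Y) (df : f.mod C →ₗ[k] M C B .forest Y Z) :
    t.mod C ⊗[k] f.mod C →ₗ[k] M C B .forest X Z :=
  TensorProduct.lift ((consL C).compl₁₂ (inj C t) df +
      (consL C).compl₁₂ dt (sgn C ∘ₗ inj C f) +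
      ((consL C).compl₁₂ (inj C t) (inj C f)).compr₂
        (theta C (fun _ => plainL C ∘ₗ bGe C) ∘ₗ cut C + oneL C ∘ₗ plainL C ∘ₗ bGe C))

end
section
variable (C : Cat.{u, v, w} k Ob) {B : Set Ob}

/-- The differential on a one-leaf tree is `b₁` of `C`. -/
noncomputable def dLeaf (X Y : Ob) (n : ℤ) :
    C.deg X Y n →ₗ[k] M C.toGrQuiver B .plain X Y :=
  iLeaf C.toGrQuiver X Y (n + 1) ∘ₗ C.b₁deg X Y n

/-- The differential `b₁` of `E` on a summand, defined by recursion: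
`bₖb₁ = - ∑_{α+p+β=k, α+β>0} (1^α ⊗ b_p ⊗ 1^β) b_{α+1+β}` for `k > 1` and `Hb₁ = 1 - b₁H`.
(In the first formula the sum over `α+β>0` is enforced as `bGe` vanishes on sequences of one tree.)
On sequences of trees it is `∑ 1^α ⊗ b_p ⊗ 1^β`. -/
noncomputable def dT : ∀ {κ : Kind} {X Z : Ob} (t : Tree B κ X Z),
    t.mod C.toGrQuiver →ₗ[k] M C.toGrQuiver B κ X Z
  | _, _, _, .leaf X Y n => dLeaf C X Y n
  | _, _, _, .node t f => -(bGe _ ∘ₗ dCons _ t f (dT t) (dT f))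
  | _, _, _, .ofPlain p => plainL _ ∘ₗ dT p
  | _, _, _, .unary h p => iPlain _ p - unaryL _ h ∘ₗ dT p
  | _, _, _, .one t => oneL _ ∘ₗ dT t
  | _, _, _, .cons t f => dCons _ t f (dT t) (dT f)

/-- The differential `b₁` of `E` (for the kind `tree`), and its extension to sequences of trees. -/
noncomputable def d {κ : Kind} {X Z : Ob} :
    M C.toGrQuiver B κ X Z →ₗ[k] M C.toGrQuiver B κ X Z := elim _ (dT C)

end

section
variable (C : GrQuiver.{u, v, w} k Ob) {B : Set Ob} {X Y Z W : Ob}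

theorem plainL_inj (t : Tree B .plain X Y) (x : t.mod C) :
    plainL C (inj C t x) = iPlain C t x := elim_inj ..
theorem unaryL_inj (h : X ∈ B ∨ Y ∈ B) (t : Tree B .plain X Y) (x : t.mod C) :
    unaryL C h (inj C t x) = iUnary C h t x := elim_inj ..
theorem oneL_inj (t : Tree B .tree X Y) (x : t.mod C) :
    oneL C (inj C t x) = iOne C t x := elim_inj ..
theorem sgn_inj {κ : Kind} (t : Tree B κ X Y) (x : t.mod C) :
    sgn C (inj C t x) = (t.degree.negOnePow : ℤ) • inj C t x := by
  simp [sgn, elim_inj]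

theorem consL_add_ind {p : M C B .tree X Y → M C B .forest Y Z → Prop}
    (h0 : ∀ y, p 0 y) (h0' : ∀ x, p x 0) (ha : ∀ x x' y, p x y → p x' y → p (x + x') y)
    (ha' : ∀ x y y', p x y → p x y' → p x (y + y'))
    (h : ∀ t f x y, p (inj C t x) (inj C f y)) (x : M C B .tree X Y) (y : M C B .forest Y Z) :
    p x y := by
  induction x using M_induction with
  | h0 => exact h0 y
  | hadd x x' hx hx' => exact ha _ _ _ hx hx'
  | h t x =>
    induction y using M_induction with
    | h0 => exact h0' _
    | hadd x x' hx hx' => exact ha' _ _ _ hx hx'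
    | h f y => exact h t f x y

theorem bGe_oneL (x : M C B .tree X Y) : bGe C (oneL C x) = 0 := by
  induction x using M_induction with
  | h0 => simp
  | hadd x x' hx hx' => simp [hx, hx']
  | h t x => rw [oneL_inj]; exact elim_iOne C _ t 0 rfl x

theorem bGe_consL (x : M C B .tree X Y) (y : M C B .forest Y Z) :
    bGe C (consL C x y) = nodeL C x y := by
  induction x, y using consL_add_ind with
  | h0 => simp
  | h0' => simp
  | ha x x' y h h' => simp [h, h']
  | ha' x y y' h h' => simp [h, h']
  | h t f x y => rw [consL_inj, nodeL_inj]; exact elim_iCons C _ t f (iNode C t f) rfl _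

theorem cut_oneL (x : M C B .tree X Y) : cut C (oneL C x) = 0 := by
  induction x using M_induction with
  | h0 => simp
  | hadd x x' hx hx' => simp [hx, hx']
  | h t x => rw [oneL_inj]; exact elim_iOne C _ t 0 rfl x

theorem cut_consL (x : M C B .tree X Y) (y : M C B .forest Y Z) :
    cut C (consL C x y) = injMM C (oneL C x) y + consMM C x (cut C y) := by
  induction x, y using consL_add_ind with
  | h0 => simp
  | h0' => simp
  | ha x x' y h h' => simp only [map_add, LinearMap.add_apply, h, h']; abel
  | ha' x y y' h h' => simp only [map_add, LinearMap.add_apply, h, h']; abel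
  | h t f x y => 
    rw [consL_inj, cut, elim_iCons C _ t f (TensorProduct.lift
      ((injMM C).compl₁₂ (oneL C ∘ₗ inj C t) (inj C f) +
        (consMM C).compl₁₂ (inj C t) (cutT C f))) rfl]
    have : cut C (inj C f y) = cutT C f y := elim_inj ..
    rw [this]
    rfl

theorem sgn_oneL (x : M C B .tree X Y) : sgn C (oneL C x) = oneL C (sgn C x) := by
  induction x using M_induction with
  | h0 => simp
  | hadd x x' hx hx' => simp [hx, hx']
  | h t x => 
    rw [oneL_inj, sgn_inj, map_zsmul, oneL_inj, sgn]
    exact elim_iOne C _ t ((t.degree.negOnePow : ℤ) • iOne C t) rfl x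

theorem sgn_consL (x : M C B .tree X Y) (y : M C B .forest Y Z) :
    sgn C (consL C x y) = consL C (sgn C x) (sgn C y) := by
  induction x, y using consL_add_ind with
  | h0 => simp
  | h0' => simp
  | ha x x' y h h' => simp [h, h']
  | ha' x y y' h h' => simp [h, h']
  | h t f x y =>
    simp only [consL_inj, sgn_inj, map_zsmul, LinearMap.smul_apply, smul_smul]
    rw [sgn, elim_iCons C _ t f (((t.degree + f.degree).negOnePow : ℤ) • iCons C t f) rfl,
      Int.negOnePow_add, mul_comm]
    rfl

theorem sgn_sgn {κ : Kind} (x : M C B κ X Y) : sgn C (sgn C x) = x := by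
  induction x using M_induction with
  | h0 => simp
  | hadd x x' hx hx' => simp [hx, hx']
  | h t x =>
    rw [sgn_inj, map_zsmul, sgn_inj, smul_smul, ← Units.val_mul]
    simp

theorem forest_key {p : ∀ {X Z : Ob}, M C B .forest X Z → Prop}
    (h0 : ∀ X Z, p (0 : M C B .forest X Z))
    (hadd : ∀ {X Z} (x y : M C B .forest X Z), p x → p y → p (x + y))
    (h1 : ∀ {X Z} (x : M C B .tree X Z), p (oneL C x))
    (hc : ∀ {X Y Z} (x : M C B .tree X Y) (y : M C B .forest Y Z), p y → p (consL C x y)) :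
    ∀ {κ : Kind} {X Z : Ob} (f : Tree B κ X Z), match κ, f with
      | .forest, f => ∀ x : f.mod C, p (inj C f x)
      | _, _ => True
  | _, _, _, .leaf _ _ _ => trivial
  | _, _, _, .node _ _ => trivial
  | _, _, _, .ofPlain _ => trivial
  | _, _, _, .unary _ _ => trivial
  | _, _, _, .one t => fun x => (oneL_inj C t x) ▸ h1 _
  | _, _, _, .cons t f => by
    have ih := forest_key h0 hadd h1 hc f
    have : ∀ z, p (iCons C t f z) := by
      intro z
      induction z using TensorProduct.induction_on with
      | zero => rw [map_zero]; exact h0 _ _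
      | tmul x y => rw [← consL_inj]; exact hc _ _ (ih y)
      | add x y hx hy => rw [map_add]; exact hadd _ _ hx hy
    exact this

/-- Every element of the forest module is a sum of strings. -/
theorem forest_induction {p : ∀ {X Z : Ob}, M C B .forest X Z → Prop}
    (h0 : ∀ X Z, p (0 : M C B .forest X Z))
    (hadd : ∀ {X Z} (x y : M C B .forest X Z), p x → p y → p (x + y))
    (h1 : ∀ {X Z} (x : M C B .tree X Z), p (oneL C x))
    (hc : ∀ {X Y Z} (x : M C B .tree X Y) (y : M C B .forest Y Z), p y → p (consL C x y))
    (x : M C B .forest X Z) : p x := by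
  have key := fun f : Tree B .forest X Z => forest_key C h0 hadd h1 hc f
  exact M_induction C (h0 _ _) hadd key x

theorem theta_inj (g : ∀ Y, M C B .forest X Y →ₗ[k] M C B .tree X Y)
    (u : M C B .forest X Y) (v : M C B .forest Y Z) :
    theta C g (injMM C u v) = consL C (g Y u) (sgn C v) := by
  simp [theta, elimMM_inj]

/-- `u ⊗ v ↦ sgn u ⊗ sgn v`. -/
noncomputable def sgnMM : MM C B X Z →ₗ[k] MM C B X Z :=
  elimMM C fun _ => (injMM C).compl₁₂ (sgn C) (sgn C)

theorem sgnMM_inj (u : M C B .forest X Y) (v : M C B .forest Y Z) :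
    sgnMM C (injMM C u v) = injMM C (sgn C u) (sgn C v) := by
  simp [sgnMM, elimMM_inj]

theorem sgnMM_consMM (x : M C B .tree X Y) (y : MM C B Y Z) :
    sgnMM C (consMM C x y) = consMM C (sgn C x) (sgnMM C y) := by
  induction y using MM_induction with
  | h0 => simp
  | hadd x x' hx hx' => simp [hx, hx']
  | h W x y => simp [consMM_inj, sgnMM_inj, sgn_consL]

theorem cut_sgn (w : M C B .forest X Z) : cut C (sgn C w) = sgnMM C (cut C w) := by
  induction w using forest_induction with
  | h0 => simp
  | hadd x x' hx hx' => simp [hx, hx']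
  | h1 x => simp [sgn_oneL, cut_oneL]
  | hc x y hy => simp [sgn_consL, cut_consL, hy, sgnMM_inj, sgnMM_consMM, sgn_oneL]

end

section
variable (C : Cat.{u, v, w} k Ob) {B : Set Ob} {X Y Z : Ob}

theorem d_inj {κ : Kind} (t : Tree B κ X Y) (x : t.mod C.toGrQuiver) :
    d C (inj _ t x) = dT C t x := elim_inj ..

theorem d_plainL (x : M C.toGrQuiver B .plain X Y) : d C (plainL _ x) = plainL _ (d C x) := by
  induction x using M_induction with
  | h0 => simp
  | hadd x x' hx hx' => simp [hx, hx']
  | h t x => rw [plainL_inj, d_inj]; exact elim_iPlain _ _ t (plainL _ ∘ₗ dT C t) rfl x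

theorem d_oneL (x : M C.toGrQuiver B .tree X Y) : d C (oneL _ x) = oneL _ (d C x) := by
  induction x using M_induction with
  | h0 => simp
  | hadd x x' hx hx' => simp [hx, hx']
  | h t x => rw [oneL_inj, d_inj]; exact elim_iOne _ _ t (oneL _ ∘ₗ dT C t) rfl x

theorem d_unaryL (h : X ∈ B ∨ Y ∈ B) (x : M C.toGrQuiver B .plain X Y) :
    d C (unaryL _ h x) = plainL _ x - unaryL _ h (d C x) := by
  induction x using M_induction with
  | h0 => simp
  | hadd x x' hx hx' => simp only [map_add, hx, hx']; abel
  | h t x => rw [unaryL_inj, d_inj, plainL_inj]; exact elim_iUnary _ (dT C) h t (iPlain _ t - unaryL _ h ∘ₗ dT C t) rfl x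

theorem d_consL₀ (x : M C.toGrQuiver B .tree X Y) (y : M C.toGrQuiver B .forest Y Z) :
    d C (consL _ x y) = consL _ x (d C y) + consL _ (d C x) (sgn _ y) +
      (theta _ (fun _ => plainL _ ∘ₗ bGe _) (cut _ (consL _ x y)) +
        oneL _ (plainL _ (nodeL _ x y))) := by
  induction x, y using consL_add_ind with
  | h0 => simp
  | h0' => simp
  | ha x x' y h h' => simp only [map_add, LinearMap.add_apply, h, h']; abel
  | ha' x y y' h h' => simp only [map_add, LinearMap.add_apply, h, h']; abel
  | h t f x y =>
    rw [← bGe_consL, d_inj, d_inj, consL_inj, d,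
      elim_iCons _ _ t f (dCons _ t f (dT C t) (dT C f)) rfl, ← consL_inj]
    rfl

theorem d_nodeL (x : M C.toGrQuiver B .tree X Y) (y : M C.toGrQuiver B .forest Y Z) :
    d C (nodeL _ x y) = - bGe _ (d C (consL _ x y)) := by
  induction x, y using consL_add_ind with
  | h0 => simp
  | h0' => simp
  | ha x x' y h h' => simp only [map_add, LinearMap.add_apply, h, h']; abel
  | ha' x y y' h h' => simp only [map_add, LinearMap.add_apply, h, h']; abel
  | h t f x y =>
    rw [nodeL_inj, consL_inj, d, d, elim_iCons _ _ t f (dCons _ t f (dT C t) (dT C f)) rfl,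
      elim_iNode _ _ t f (-(bGe _ ∘ₗ dCons _ t f (dT C t) (dT C f))) rfl]
    rfl

end

section
variable (C : Cat.{u, v, w} k Ob) {B : Set Ob} {X Y Z : Ob}

/-- The homogeneous component of degree `n`. -/
noncomputable def degM (C : GrQuiver.{u, v, w} k Ob) (B : Set Ob) (κ : Kind) (X Y : Ob) (n : ℤ) :
    Submodule k (M C B κ X Y) :=
  ⨆ t : {t : Tree B κ X Y // t.degree = n}, LinearMap.range (inj C t.1)

section
variable (C : GrQuiver.{u, v, w} k Ob)

theorem inj_mem {κ : Kind} (t : Tree B κ X Y) (x : t.mod C) : inj C t x ∈ degM C B κ X Y t.degree :=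
  Submodule.mem_iSup_of_mem (p := fun t : {s : Tree B κ X Y // s.degree = t.degree} =>
    LinearMap.range (inj C t.1)) ⟨t, rfl⟩ ⟨x, rfl⟩

theorem iLeaf_mem (n : ℤ) (x : C.deg X Y n) : iLeaf C X Y n x ∈ degM C B .plain X Y n :=
  inj_mem C (.leaf X Y n : Tree B .plain X Y) x

theorem iNode_mem (t : Tree B .tree X Y) (f : Tree B .forest Y Z) (x : t.mod C ⊗[k] f.mod C) :
    iNode C t f x ∈ degM C B .plain X Z (t.degree + f.degree + 1) := inj_mem C (.node t f) x

theorem iCons_mem (t : Tree B .tree X Y) (f : Tree B .forest Y Z) (x : t.mod C ⊗[k] f.mod C) :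
    iCons C t f x ∈ degM C B .forest X Z (t.degree + f.degree) := inj_mem C (.cons t f) x

theorem iPlain_mem (t : Tree B .plain X Y) (x : t.mod C) :
    iPlain C t x ∈ degM C B .tree X Y t.degree := inj_mem C (.ofPlain t) x

theorem iUnary_mem (h : X ∈ B ∨ Y ∈ B) (t : Tree B .plain X Y) (x : t.mod C) :
    iUnary C h t x ∈ degM C B .tree X Y (t.degree - 1) := inj_mem C (.unary h t) x

theorem iOne_mem (t : Tree B .tree X Y) (x : t.mod C) :
    iOne C t x ∈ degM C B .forest X Y t.degree := inj_mem C (.one t) x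

theorem degM_le {κ : Kind} {n : ℤ} {S : Submodule k (M C B κ X Y)}
    (h : ∀ (t : Tree B κ X Y), t.degree = n → ∀ x, inj C t x ∈ S) : degM C B κ X Y n ≤ S := by
  refine iSup_le fun t => ?_
  rintro _ ⟨x, rfl⟩
  exact h t.1 t.2 x

/-- The projection to the homogeneous component of degree `n`. -/
noncomputable def projM {κ : Kind} (n : ℤ) : M C B κ X Y →ₗ[k] M C B κ X Y :=
  elim C fun t => if t.degree = n then inj C t else 0

theorem isInternal_degM (κ : Kind) : DirectSum.IsInternal (degM C B κ X Y) := by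
  refine GrQuiver.isInternal_of_proj _ (fun n => projM C n) ?_ ?_ ?_
  · intro n
    exact degM_le C (S := LinearMap.eqLocus (projM C n) LinearMap.id) fun t ht x => by
      simp [projM, elim_inj, ht]
  · intro m n x hmn hx
    exact degM_le C (S := LinearMap.ker (projM C n)) (fun t ht x => by
      simp [projM, elim_inj, ht, hmn]) hx
  · intro x
    induction x using M_induction with
    | h0 => exact zero_mem _
    | hadd x x' hx hx' => exact add_mem hx hx'
    | h t x => exact Submodule.mem_iSup_of_mem _ (inj_mem C t x)

theorem plainL_mem {n : ℤ} {x : M C B .plain X Y} (hx : x ∈ degM C B _ X Y n) :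
    plainL C x ∈ degM C B _ X Y n :=
  degM_le C (S := (degM C B .tree X Y n).comap (plainL C)) (fun t ht x => by
    subst ht; rw [Submodule.mem_comap, plainL_inj]; exact inj_mem C (.ofPlain t) x) hx

theorem oneL_mem {n : ℤ} {x : M C B .tree X Y} (hx : x ∈ degM C B _ X Y n) :
    oneL C x ∈ degM C B _ X Y n :=
  degM_le C (S := (degM C B .forest X Y n).comap (oneL C)) (fun t ht x => by
    subst ht; rw [Submodule.mem_comap, oneL_inj]; exact inj_mem C (.one t) x) hx

theorem unaryL_mem (h : X ∈ B ∨ Y ∈ B) {n : ℤ} {x : M C B .plain X Y}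
    (hx : x ∈ degM C B _ X Y n) : unaryL C h x ∈ degM C B _ X Y (n - 1) :=
  degM_le C (S := (degM C B .tree X Y (n - 1)).comap (unaryL C h)) (fun t ht x => by
    subst ht; rw [Submodule.mem_comap, unaryL_inj]; exact inj_mem C (.unary h t) x) hx

theorem consL_mem {m n : ℤ} {x : M C B .tree X Y} {y : M C B .forest Y Z}
    (hx : x ∈ degM C B _ X Y m) (hy : y ∈ degM C B _ Y Z n) :
    consL C x y ∈ degM C B _ X Z (m + n) := by
  refine degM_le C (S := (degM C B .forest X Z (m + n)).comap ((consL C).flip y)) (fun t ht x => ?_) hx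
  refine degM_le C (S := (degM C B .forest X Z (m + n)).comap (consL C (inj C t x)))
    (fun f hf y => ?_) hy
  subst ht hf
  rw [Submodule.mem_comap, consL_inj]
  exact inj_mem C (.cons t f) _

theorem nodeL_mem {m n : ℤ} {x : M C B .tree X Y} {y : M C B .forest Y Z}
    (hx : x ∈ degM C B _ X Y m) (hy : y ∈ degM C B _ Y Z n) :
    nodeL C x y ∈ degM C B _ X Z (m + n + 1) := by
  refine degM_le C (S := (degM C B .plain X Z (m + n + 1)).comap ((nodeL C).flip y))
    (fun t ht x => ?_) hx
  refine degM_le C (S := (degM C B .plain X Z (m + n + 1)).comap (nodeL C (inj C t x)))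
    (fun f hf y => ?_) hy
  subst ht hf
  rw [Submodule.mem_comap, nodeL_inj]
  exact inj_mem C (.node t f) _

theorem sgn_of_mem {κ : Kind} {n : ℤ} {x : M C B κ X Y} (hx : x ∈ degM C B _ X Y n) :
    sgn C x = (n.negOnePow : ℤ) • x := by
  have := degM_le C (S := LinearMap.ker (sgn C - (n.negOnePow : ℤ) • LinearMap.id))
    (fun t ht x => by
      rw [LinearMap.mem_ker, LinearMap.sub_apply, LinearMap.smul_apply, sgn_inj, ht]
      exact sub_self _) hx
  exact sub_eq_zero.1 this

theorem sgn_mem {κ : Kind} {n : ℤ} {x : M C B κ X Y} (hx : x ∈ degM C B _ X Y n) :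
    sgn C x ∈ degM C B _ X Y n := by
  rw [sgn_of_mem C hx]; exact zsmul_mem hx _

/-- A homogeneous element of the forest module is a sum of homogeneous strings. -/
theorem degM_forest_le {n : ℤ} {S : Submodule k (M C B .forest X Z)}
    (h1 : ∀ x ∈ degM C B .tree X Z n, oneL C x ∈ S)
    (hc : ∀ (Y : Ob) (p q : ℤ), p + q = n → ∀ x ∈ degM C B .tree X Y p,
      ∀ y ∈ degM C B .forest Y Z q, consL C x y ∈ S) : degM C B .forest X Z n ≤ S := by
  refine degM_le C fun t ht => ?_
  match t, ht with
  | .one t, ht => 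
    intro x
    exact (oneL_inj C t x) ▸ h1 _ (by subst ht; exact inj_mem C t x)
  | .cons t f, ht => 
    have : ∀ z, iCons C t f z ∈ S := by
      intro z
      induction z using TensorProduct.induction_on with
      | zero => rw [map_zero]; exact zero_mem _
      | tmul x y => rw [← consL_inj]; exact hc _ _ _ ht _ (inj_mem C t x) _ (inj_mem C f y)
      | add x y hx hy => rw [map_add]; exact add_mem hx hy
    exact this

theorem bGe_mem {n : ℤ} {z : M C B .forest X Z} (hz : z ∈ degM C B _ X Z n) :
    bGe C z ∈ degM C B _ X Z (n + 1) := by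
  exact degM_forest_le C (S := (degM C B .plain X Z (n + 1)).comap (bGe C))
    (fun x _ => by rw [Submodule.mem_comap, bGe_oneL]; exact zero_mem _)
    (fun Y p q h x hx y hy => by
      subst h; rw [Submodule.mem_comap, bGe_consL]; exact nodeL_mem C hx hy) hz

/-- The homogeneous component of degree `n` of `MM`. -/
noncomputable def degMM (C : GrQuiver.{u, v, w} k Ob) (B : Set Ob) (X Z : Ob) (n : ℤ) :
    Submodule k (MM C B X Z) :=
  Submodule.span k {z | ∃ (Y : Ob) (p q : ℤ), p + q = n ∧ ∃ x ∈ degM C B .forest X Y p,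
    ∃ y ∈ degM C B .forest Y Z q, z = injMM C x y}

theorem injMM_mem {p q n : ℤ} {x : M C B .forest X Y} {y : M C B .forest Y Z}
    (hx : x ∈ degM C B _ X Y p) (hy : y ∈ degM C B _ Y Z q) (h : p + q = n) :
    injMM C x y ∈ degMM C B X Z n := Submodule.subset_span ⟨Y, p, q, h, x, hx, y, hy, rfl⟩

theorem consMM_mem {p q n : ℤ} {x : M C B .tree X Y} {y : MM C B Y Z}
    (hx : x ∈ degM C B _ X Y p) (hy : y ∈ degMM C B Y Z q) (h : p + q = n) :
    consMM C x y ∈ degMM C B X Z n := by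
  have : degMM C B Y Z q ≤ (degMM C B X Z n).comap (consMM C x) := by
    refine Submodule.span_le.2 ?_
    rintro _ ⟨W, a, b, hab, u, hu, v, hv, rfl⟩
    rw [SetLike.mem_coe, Submodule.mem_comap, consMM_inj]
    exact injMM_mem C (consL_mem C hx hu) hv (by lia)
  exact this hy

theorem cut_key : ∀ {κ : Kind} {X Z : Ob} (f : Tree B κ X Z), match κ, f with
      | .forest, f => ∀ x : f.mod C, cut C (inj C f x) ∈ degMM C B X Z f.degree
      | _, _ => True
  | _, _, _, .leaf _ _ _ => trivial
  | _, _, _, .node _ _ => trivial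
  | _, _, _, .ofPlain _ => trivial
  | _, _, _, .unary _ _ => trivial
  | _, _, _, .one t => by
    have : ∀ x, cut C (iOne C t x) ∈ degMM C B _ _ t.degree := by
      intro x
      rw [← oneL_inj, cut_oneL]
      exact zero_mem _
    exact this
  | _, _, _, .cons t f => by
    have ih := cut_key f
    have : ∀ z, cut C (iCons C t f z) ∈ degMM C B _ _ (t.degree + f.degree) := by
      intro z
      induction z using TensorProduct.induction_on with
      | zero => rw [map_zero, map_zero]; exact zero_mem _
      | tmul x y =>
        rw [← consL_inj, cut_consL]
        exact add_mem (injMM_mem C (oneL_mem C (inj_mem C t x)) (inj_mem C f y) rfl)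
          (consMM_mem C (inj_mem C t x) (ih y) rfl)
      | add x y hx hy => rw [map_add, map_add]; exact add_mem hx hy
    exact this

theorem cut_mem {n : ℤ} {z : M C B .forest X Z} (hz : z ∈ degM C B _ X Z n) :
    cut C z ∈ degMM C B X Z n :=
  degM_le C (S := (degMM C B X Z n).comap (cut C)) (fun t ht x => by
    subst ht; exact cut_key C t x) hz

theorem theta_mem {n : ℤ} {z : MM C B X Z} (hz : z ∈ degMM C B X Z n)
    (g : ∀ Y, M C B .forest X Y →ₗ[k] M C B .tree X Y)
    (hg : ∀ Y m x, x ∈ degM C B _ X Y m → g Y x ∈ degM C B _ X Y (m + 1)) :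
    theta C g z ∈ degM C B _ X Z (n + 1) := by
  have : degMM C B X Z n ≤ (degM C B _ X Z (n + 1)).comap (theta C g) := by
    refine Submodule.span_le.2 ?_
    rintro _ ⟨W, a, b, hab, u, hu, v, hv, rfl⟩
    rw [SetLike.mem_coe, Submodule.mem_comap, theta_inj]
    have := consL_mem C (hg _ _ _ hu) (sgn_mem C hv)
    rwa [show a + 1 + b = n + 1 by lia] at this
  exact this hz

end

theorem d_consL_mem {m n : ℤ} (x : M C.toGrQuiver B .tree X Y) (y : M C.toGrQuiver B .forest Y Z)
    (hx : x ∈ degM _ B _ X Y m) (hy : y ∈ degM _ B _ Y Z n)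
    (hx' : d C x ∈ degM _ B _ X Y (m + 1)) (hy' : d C y ∈ degM _ B _ Y Z (n + 1)) :
    d C (consL _ x y) ∈ degM _ B _ X Z (m + n + 1) := by
  rw [d_consL₀]
  refine add_mem (add_mem ?_ ?_) (add_mem ?_ ?_)
  · rw [add_assoc]; exact consL_mem _ hx hy'
  · rw [show m + n + 1 = m + 1 + n by lia]; exact consL_mem _ hx' (sgn_mem _ hy)
  · exact theta_mem _ (cut_mem _ (consL_mem _ hx hy)) _
      (fun Y m x hx => plainL_mem _ (bGe_mem _ hx))
  · exact oneL_mem _ (plainL_mem _ (nodeL_mem _ hx hy))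

theorem d_key : ∀ {κ : Kind} {X Z : Ob} (t : Tree B κ X Z) (x : t.mod C.toGrQuiver),
    d C (inj _ t x) ∈ degM C.toGrQuiver B κ X Z (t.degree + 1)
  | _, _, _, .leaf X Y n => by
    have : ∀ x, d C (iLeaf _ X Y n x) ∈ degM C.toGrQuiver B _ _ _ (n + 1) := by
      intro x
      rw [d, elim_iLeaf _ (dT C) n (dLeaf C X Y n) rfl]
      exact iLeaf_mem _ _ _
    exact this
  | _, _, _, .node t f => by
    have ht := d_key t
    have hf := d_key f
    have : ∀ z, d C (iNode _ t f z) ∈ degM C.toGrQuiver B _ _ _ (t.degree + f.degree + 1 + 1) := by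
      intro z
      induction z using TensorProduct.induction_on with
      | zero => rw [map_zero, map_zero]; exact zero_mem _
      | tmul x y =>
        rw [← nodeL_inj, d_nodeL]
        exact neg_mem (bGe_mem _ (d_consL_mem C _ _ (inj_mem _ _ _) (inj_mem _ _ _) (ht x) (hf y)))
      | add x y hx hy => rw [map_add, map_add]; exact add_mem hx hy
    exact this
  | _, _, _, .ofPlain p => by
    have hp := d_key p
    have : ∀ x, d C (iPlain _ p x) ∈ degM C.toGrQuiver B _ _ _ (p.degree + 1) := by
      intro x
      rw [← plainL_inj, d_plainL]
      exact plainL_mem _ (hp x)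
    exact this
  | _, _, _, .unary h p => by
    have hp := d_key p
    have : ∀ x, d C (iUnary _ h p x) ∈ degM C.toGrQuiver B _ _ _ (p.degree - 1 + 1) := by
      intro x
      rw [← unaryL_inj, d_unaryL]
      refine sub_mem ?_ ?_
      · rw [show p.degree - 1 + 1 = p.degree by lia]
        exact plainL_mem _ (inj_mem _ p x)
      · rw [show p.degree - 1 + 1 = p.degree + 1 - 1 by lia]
        exact unaryL_mem _ h (hp x)
    exact this
  | _, _, _, .one t => by
    have ht := d_key t
    have : ∀ x, d C (iOne _ t x) ∈ degM C.toGrQuiver B _ _ _ (t.degree + 1) := by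
      intro x
      rw [← oneL_inj, d_oneL]
      exact oneL_mem _ (ht x)
    exact this
  | _, _, _, .cons t f => by
    have ht := d_key t
    have hf := d_key f
    have : ∀ z, d C (iCons _ t f z) ∈ degM C.toGrQuiver B _ _ _ (t.degree + f.degree + 1) := by
      intro z
      induction z using TensorProduct.induction_on with
      | zero => rw [map_zero, map_zero]; exact zero_mem _
      | tmul x y =>
        rw [← consL_inj]
        exact d_consL_mem C _ _ (inj_mem _ _ _) (inj_mem _ _ _) (ht x) (hf y)
      | add x y hx hy => rw [map_add, map_add]; exact add_mem hx hy
    exact this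

theorem d_mem {κ : Kind} {n : ℤ} {z : M C.toGrQuiver B κ X Z} (hz : z ∈ degM _ B _ X Z n) :
    d C z ∈ degM _ B _ X Z (n + 1) :=
  degM_le _ (S := (degM _ B _ X Z (n + 1)).comap (d C)) (fun t ht x => by
    subst ht; exact d_key C t x) hz

theorem degM_hom_ext {κ : Kind} {N : Type*} [AddCommGroup N] [Module k N]
    {f g : M C.toGrQuiver B κ X Y →ₗ[k] N}
    (h : ∀ n, ∀ x ∈ degM C.toGrQuiver B κ X Y n, f x = g x) (x : M C.toGrQuiver B κ X Y) :
    f x = g x := by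
  induction x using M_induction with
  | h0 => simp
  | hadd x x' hx hx' => simp [hx, hx']
  | h t x => exact h _ _ (inj_mem _ t x)

theorem sgn_d {κ : Kind} (z : M C.toGrQuiver B κ X Z) : sgn _ (d C z) = - d C (sgn _ z) := by
  have := degM_hom_ext C (f := sgn _ ∘ₗ d C) (g := - (d C ∘ₗ sgn _)) (fun n x hx => by
    simp only [LinearMap.comp_apply, LinearMap.neg_apply]
    rw [sgn_of_mem _ hx, sgn_of_mem _ (d_mem C hx), Int.negOnePow_succ, map_zsmul]
    simp) z
  exact this

end

section
variable (C : Cat.{u, v, w} k Ob) {B : Set Ob} {X Y Z : Ob}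

/-- The sum of all operations `bₖ`, `k ≥ 1`, of `E`. -/
noncomputable def bAll : M C.toGrQuiver B .forest X Z →ₗ[k] M C.toGrQuiver B .tree X Z :=
  plainL _ ∘ₗ bGe _ + elim _ (fun
    | .one t => d C ∘ₗ inj _ t
    | .cons _ _ => 0)

theorem bAll_oneL (x : M C.toGrQuiver B .tree X Z) : bAll C (oneL _ x) = d C x := by
  rw [bAll, LinearMap.add_apply, LinearMap.comp_apply, bGe_oneL, map_zero, zero_add]
  induction x using M_induction with
  | h0 => simp
  | hadd x x' hx hx' => rw [map_add, map_add, map_add, hx, hx']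
  | h t x =>
    rw [oneL_inj]
    exact elim_iOne _ _ t (d C ∘ₗ inj _ t) rfl x

theorem bAll_consL (x : M C.toGrQuiver B .tree X Y) (y : M C.toGrQuiver B .forest Y Z) :
    bAll C (consL _ x y) = plainL _ (nodeL _ x y) := by
  rw [bAll, LinearMap.add_apply, LinearMap.comp_apply, bGe_consL, add_eq_left]
  induction x, y using consL_add_ind with
  | h0 => simp
  | h0' => simp
  | ha x x' y h h' => rw [map_add, LinearMap.add_apply, map_add, h, h', add_zero]
  | ha' x y y' h h' => rw [map_add, map_add, h, h', add_zero]
  | h t f x y =>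
    rw [consL_inj]
    exact elim_iCons _ _ t f 0 rfl _

/-- The sum of the terms `b_p ⊗ 1^β` of the differential of a sequence of trees. -/
noncomputable def headC : M C.toGrQuiver B .forest X Z →ₗ[k] M C.toGrQuiver B .forest X Z :=
  theta _ (fun _ => bAll C) ∘ₗ cut _ + oneL _ ∘ₗ bAll C

theorem headC_apply (z : M C.toGrQuiver B .forest X Z) :
    headC C z = theta _ (fun _ => bAll C) (cut _ z) + oneL _ (bAll C z) := rfl

theorem theta_consMM (g : ∀ Z, M C.toGrQuiver B .forest X Z →ₗ[k] M C.toGrQuiver B .tree X Z)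
    (x : M C.toGrQuiver B .tree X Y) (m : MM C.toGrQuiver B Y Z) :
    theta _ g (consMM _ x m) = elimMM _ (fun W =>
      ((consL _).comp ((g W).comp (consL _ x))).compl₂ (sgn _)) m := by
  induction m using MM_induction with
  | h0 => simp
  | hadd x x' hx hx' => rw [map_add, map_add, map_add, hx, hx']
  | h W u v => rw [consMM_inj, theta_inj, elimMM_inj]; rfl

theorem theta_congr (x : M C.toGrQuiver B .tree X Y) (m : MM C.toGrQuiver B Y Z) :
    theta _ (fun _ => bAll C) (consMM _ x m) =
      theta _ (fun _ => plainL _ ∘ₗ bGe _) (consMM _ x m) := by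
  induction m using MM_induction with
  | h0 => simp
  | hadd x x' hx hx' => rw [map_add, map_add, map_add, hx, hx']
  | h W u v => rw [consMM_inj, theta_inj, theta_inj, bAll_consL, ← bGe_consL]; rfl

theorem d_consL (x : M C.toGrQuiver B .tree X Y) (y : M C.toGrQuiver B .forest Y Z) :
    d C (consL _ x y) = consL _ x (d C y) + headC C (consL _ x y) := by
  rw [d_consL₀, headC_apply, bAll_consL, cut_consL, map_add, map_add, theta_congr, theta_inj,
    theta_inj, bAll_oneL, LinearMap.comp_apply, bGe_oneL, map_zero]
  simp only [map_zero, LinearMap.zero_apply, zero_add]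
  abel

theorem d_oneL' (x : M C.toGrQuiver B .tree X Y) : d C (oneL _ x) = headC C (oneL _ x) := by
  rw [d_oneL, headC_apply, cut_oneL, map_zero, bAll_oneL, zero_add]

/-- `b ∘ d`, version for multiplications of arity at least two. -/
theorem d_bGe (z : M C.toGrQuiver B .forest X Z) : d C (bGe _ z) = - bGe _ (d C z) := by
  induction z using forest_induction with
  | h0 => simp
  | hadd x x' hx hx' => rw [map_add, map_add, map_add, map_add, hx, hx', neg_add]
  | h1 x => rw [bGe_oneL, d_oneL, bGe_oneL, map_zero, neg_zero]
  | hc x y _ => rw [bGe_consL, d_nodeL]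

/-- The operation `b₁`, extended by zero to longer sequences. -/
noncomputable def dOnly : M C.toGrQuiver B .forest X Z →ₗ[k] M C.toGrQuiver B .tree X Z :=
  bAll C - plainL _ ∘ₗ bGe _

theorem dOnly_oneL (x : M C.toGrQuiver B .tree X Z) : dOnly C (oneL _ x) = d C x := by
  rw [dOnly, LinearMap.sub_apply, bAll_oneL, LinearMap.comp_apply, bGe_oneL, map_zero, sub_zero]

theorem dOnly_consL (x : M C.toGrQuiver B .tree X Y) (y : M C.toGrQuiver B .forest Y Z) :
    dOnly C (consL _ x y) = 0 := by
  rw [dOnly, LinearMap.sub_apply, bAll_consL, LinearMap.comp_apply, bGe_consL, sub_self]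

theorem dOnly_theta (g : ∀ Z, M C.toGrQuiver B .forest X Z →ₗ[k] M C.toGrQuiver B .tree X Z)
    (m : MM C.toGrQuiver B X Z) : dOnly C (theta _ g m) = 0 := by
  induction m using MM_induction with
  | h0 => simp
  | hadd x x' hx hx' => rw [map_add, map_add, hx, hx', add_zero]
  | h W u v => rw [theta_inj, dOnly_consL]

theorem bAll_apply (z : M C.toGrQuiver B .forest X Z) :
    bAll C z = plainL _ (bGe _ z) + dOnly C z := by
  rw [dOnly, LinearMap.sub_apply, LinearMap.comp_apply]; abel

theorem bAll_d_consL (x : M C.toGrQuiver B .tree X Y) (y : M C.toGrQuiver B .forest Y Z) :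
    bAll C (d C (consL _ x y)) = 0 := by
  have h1 : dOnly C (d C (consL _ x y)) = d C (plainL _ (bGe _ (consL _ x y))) := by
    rw [d_consL, headC_apply, map_add, map_add, dOnly_consL, dOnly_theta, dOnly_oneL, bAll_consL,
      bGe_consL, zero_add, zero_add]
  rw [bAll_apply, h1, d_plainL, d_bGe, map_neg, add_neg_cancel]

/-- `u ⊗ v ↦ (u)f ⊗ (v)g`. -/
noncomputable def mapMM {X' : Ob} (f : ∀ W, M C.toGrQuiver B .forest X W →ₗ[k] M C.toGrQuiver B .forest X' W)
    (g : ∀ W, M C.toGrQuiver B .forest W Z →ₗ[k] M C.toGrQuiver B .forest W Z) :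
    MM C.toGrQuiver B X Z →ₗ[k] MM C.toGrQuiver B X' Z :=
  elimMM _ fun W => (injMM _).compl₁₂ (f W) (g W)

end

section
variable (C : Cat.{u, v, w} k Ob) {B : Set Ob} {X Y Z : Ob}

theorem mapMM_inj {X' : Ob}
    (f : ∀ W, M C.toGrQuiver B .forest X W →ₗ[k] M C.toGrQuiver B .forest X' W)
    (g : ∀ W, M C.toGrQuiver B .forest W Z →ₗ[k] M C.toGrQuiver B .forest W Z)
    (x : M C.toGrQuiver B .forest X Y) (y : M C.toGrQuiver B .forest Y Z) :
    mapMM C f g (injMM _ x y) = injMM _ (f Y x) (g Y y) := by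
  rw [mapMM, elimMM_inj]; rfl

/-- Coassociativity of deconcatenation. -/
theorem cut_coassoc {X' : Ob} (g : ∀ W, M C.toGrQuiver B .forest X W →ₗ[k] M C.toGrQuiver B .tree X' W)
    (z : M C.toGrQuiver B .forest X Z) :
    elimMM _ (fun W => (consMM _).compl₁₂ (g W) (cut _ ∘ₗ sgn _)) (cut _ z) =
      elimMM _ (fun W => (injMM _).compl₁₂
        (elimMM _ (fun V => ((consL _).comp (g V)).compl₂ (sgn _)) ∘ₗ cut _) (sgn _)) (cut _ z) := by
  induction z using forest_induction with
  | h0 => simp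
  | hadd x x' hx hx' => rw [map_add, map_add, map_add, hx, hx']
  | h1 x => rw [cut_oneL, map_zero, map_zero]
  | @hc X Y Z x y hy =>
    have key : ∀ m : MM C.toGrQuiver B Y Z,
        elimMM _ (fun W => (consMM _).compl₁₂ (g W) (cut _ ∘ₗ sgn _)) (consMM _ x m) =
        elimMM _ (fun W => (consMM _).compl₁₂ (g W ∘ₗ consL _ x) (cut _ ∘ₗ sgn _)) m := by
      intro m
      induction m using MM_induction with
      | h0 => simp
      | hadd x x' hx hx' => rw [map_add, map_add, map_add, hx, hx']
      | h W u v => rw [consMM_inj, elimMM_inj, elimMM_inj]; rfl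
    have key' : ∀ m : MM C.toGrQuiver B Y Z,
        elimMM _ (fun W => (injMM _).compl₁₂
          (elimMM _ (fun V => ((consL _).comp (g V)).compl₂ (sgn _)) ∘ₗ cut _) (sgn _))
          (consMM _ x m) =
        consMM _ (g Y (oneL _ x)) (sgnMM _ m) +
        elimMM _ (fun W => (injMM _).compl₁₂
          (elimMM _ (fun V => ((consL _).comp (g V ∘ₗ consL _ x)).compl₂ (sgn _)) ∘ₗ cut _)
            (sgn _)) m := by
      intro m
      induction m using MM_induction with
      | h0 => simp
      | hadd x x' hx hx' => simp only [map_add, hx, hx']; abel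
      | h W u v =>
        rw [consMM_inj, elimMM_inj, elimMM_inj, sgnMM_inj, consMM_inj]
        simp only [LinearMap.compl₁₂_apply, LinearMap.comp_apply, cut_consL, map_add,
          elimMM_inj, LinearMap.compl₂_apply, LinearMap.add_apply]
        congr 1
        have : ∀ m : MM C.toGrQuiver B Y W,
            elimMM _ (fun V => ((consL _).comp (g V)).compl₂ (sgn _)) (consMM _ x m) =
            elimMM _ (fun V => ((consL _).comp (g V ∘ₗ consL _ x)).compl₂ (sgn _)) m := by
          intro m
          induction m using MM_induction with
          | h0 => simp
          | hadd x x' hx hx' => rw [map_add, map_add, map_add, hx, hx']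
          | h W u v => rw [consMM_inj, elimMM_inj, elimMM_inj]; rfl
        rw [this]
    rw [cut_consL, map_add, map_add, elimMM_inj, elimMM_inj, key, key', hy]
    simp only [LinearMap.compl₁₂_apply, LinearMap.comp_apply, cut_oneL, cut_sgn, map_zero,
      LinearMap.zero_apply, zero_add]

theorem cut_headC (z : M C.toGrQuiver B .forest X Z) :
    cut _ (headC C z) = mapMM C (fun _ => headC C) (fun _ => sgn _) (cut _ z) := by
  have h1 : ∀ m : MM C.toGrQuiver B X Z, cut _ (theta _ (fun _ => bAll C) m) =
      elimMM _ (fun W => (injMM _).compl₁₂ (oneL _ ∘ₗ bAll C) (sgn _)) m +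
      elimMM _ (fun W => (consMM _).compl₁₂ (bAll C) (cut _ ∘ₗ sgn _)) m := by
    intro m
    induction m using MM_induction with
    | h0 => simp
    | hadd x x' hx hx' => simp only [map_add, hx, hx']; abel
    | h W u v => rw [theta_inj, cut_consL, elimMM_inj, elimMM_inj]; rfl
  have h2 : ∀ m : MM C.toGrQuiver B X Z,
      mapMM C (fun _ => headC C) (fun _ => sgn _) m =
      elimMM _ (fun W => (injMM _).compl₁₂ (oneL _ ∘ₗ bAll C) (sgn _)) m +
      elimMM _ (fun W => (injMM _).compl₁₂
        (elimMM _ (fun V => ((consL _).comp (bAll C)).compl₂ (sgn _)) ∘ₗ cut _) (sgn _)) m := by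
    intro m
    induction m using MM_induction with
    | h0 => simp
    | hadd x x' hx hx' => simp only [map_add, hx, hx']; abel
    | h W u v =>
      rw [mapMM_inj, elimMM_inj, elimMM_inj, headC_apply, map_add, LinearMap.add_apply, add_comm]
      rfl
  rw [headC_apply, map_add, cut_oneL, add_zero, h1, h2, cut_coassoc]

theorem cut_d (z : M C.toGrQuiver B .forest X Z) :
    cut _ (d C z) = mapMM C (fun _ => d C) (fun _ => sgn _) (cut _ z) +
      mapMM C (fun _ => LinearMap.id) (fun _ => d C) (cut _ z) := by
  induction z using forest_induction with
  | h0 => simp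
  | hadd x x' hx hx' => simp only [map_add, hx, hx']; abel
  | h1 x => rw [d_oneL, cut_oneL, cut_oneL, map_zero, map_zero, add_zero]
  | @hc X Y Z x y hy =>
    have h1 : ∀ m : MM C.toGrQuiver B Y Z,
        mapMM C (fun _ => d C) (fun _ => sgn _) (consMM _ x m) +
          mapMM C (fun _ => LinearMap.id) (fun _ => d C) (consMM _ x m) =
        consMM _ x (mapMM C (fun _ => d C) (fun _ => sgn _) m +
          mapMM C (fun _ => LinearMap.id) (fun _ => d C) m) +
        mapMM C (fun _ => headC C) (fun _ => sgn _) (consMM _ x m) := by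
      intro m
      induction m using MM_induction with
      | h0 => simp
      | hadd x x' hx hx' =>
        simp only [map_add] at hx hx' ⊢
        rw [add_add_add_comm, hx, hx']; abel
      | h W u v =>
        simp only [consMM_inj, mapMM_inj, d_consL, map_add, LinearMap.add_apply, LinearMap.id_apply]
        abel
    rw [d_consL, map_add, cut_headC, cut_consL, cut_consL, hy]
    rw [map_add (mapMM C (fun _ => d C) (fun _ => sgn _)),
      map_add (mapMM C (fun _ => LinearMap.id) (fun _ => d C)), add_add_add_comm, h1]
    simp only [mapMM_inj, map_add, LinearMap.id_apply, d_oneL' C x]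
    abel

theorem d_d_consL (x : M C.toGrQuiver B .tree X Y) (y : M C.toGrQuiver B .forest Y Z) :
    d C (d C (consL _ x y)) = consL _ x (d C (d C y)) + consL _ (d C (d C x)) y := by
  have h1 : ∀ m : MM C.toGrQuiver B X Z, d C (theta _ (fun _ => bAll C) m) =
      - elimMM _ (fun W => (consL _).compl₁₂ (bAll C) (sgn _ ∘ₗ d C)) m +
        headC C (theta _ (fun _ => bAll C) m) := by
    intro m
    induction m using MM_induction with
    | h0 => simp
    | hadd x x' hx hx' => simp only [map_add, hx, hx']; abel
    | h W u v =>
      rw [theta_inj, d_consL, elimMM_inj]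
      simp only [LinearMap.compl₁₂_apply, LinearMap.comp_apply, sgn_d, map_neg, neg_neg]
  have h2 : ∀ m : MM C.toGrQuiver B X Z, theta _ (fun _ => bAll C)
      (mapMM C (fun _ => d C) (fun _ => sgn _) m +
        mapMM C (fun _ => LinearMap.id) (fun _ => d C) m) =
      elimMM _ (fun W => (consL _).comp (bAll C ∘ₗ d C)) m +
      elimMM _ (fun W => (consL _).compl₁₂ (bAll C) (sgn _ ∘ₗ d C)) m := by
    intro m
    induction m using MM_induction with
    | h0 => simp
    | hadd x x' hx hx' =>
      simp only [map_add] at hx hx' ⊢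
      rw [add_add_add_comm, hx, hx']; abel
    | h W u v =>
      simp only [mapMM_inj, map_add, theta_inj, elimMM_inj, sgn_sgn]
      rfl
  have h3 : ∀ m : MM C.toGrQuiver B Y Z,
      elimMM _ (fun W => (consL _).comp (bAll C ∘ₗ d C)) (consMM _ x m) = 0 := by
    intro m
    induction m using MM_induction with
    | h0 => simp
    | hadd x x' hx hx' => rw [map_add, map_add, hx, hx', add_zero]
    | h W u v =>
      rw [consMM_inj, elimMM_inj, LinearMap.comp_apply, LinearMap.comp_apply, bAll_d_consL,
        map_zero, LinearMap.zero_apply]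
  have h4 : headC C (d C (consL _ x y)) =
      headC C (consL _ x (d C y)) + (headC C (theta _ (fun _ => bAll C) (cut _ (consL _ x y))) +
        d C (oneL _ (bAll C (consL _ x y)))) := by
    rw [d_oneL', d_consL, headC_apply C (consL _ x y), map_add, map_add]
  have h5 : headC C (d C (consL _ x y)) =
      consL _ (d C (d C x)) y +
      elimMM _ (fun W => (consL _).compl₁₂ (bAll C) (sgn _ ∘ₗ d C)) (cut _ (consL _ x y)) := by
    rw [headC_apply, bAll_d_consL, map_zero, add_zero, cut_d, h2]
    congr 1
    rw [cut_consL, map_add, h3, add_zero, elimMM_inj, LinearMap.comp_apply, LinearMap.comp_apply,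
      d_oneL, bAll_oneL]
  rw [d_consL, map_add, d_consL, headC_apply C (consL _ x y), map_add, h1]
  have h6 := h4.symm.trans h5
  rw [add_assoc, add_assoc]
  congr 1
  rw [← eq_sub_iff_add_eq] at h6
  rw [h6]
  abel

theorem d_d_key (hC : ∀ {X Y : Ob} (x : C.Hom X Y), C.b₁ (C.b₁ x) = 0) :
    ∀ {κ : Kind} {X Z : Ob} (t : Tree B κ X Z) (x : t.mod C.toGrQuiver),
    d C (d C (inj _ t x)) = 0
  | _, _, _, .leaf X Y n => by
    have : ∀ x, d C (d C (iLeaf C.toGrQuiver (B := B) X Y n x)) = 0 := by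
      intro x
      rw [d, elim_iLeaf _ (dT C) n (dLeaf C X Y n) rfl, dLeaf, LinearMap.comp_apply,
        elim_iLeaf _ (dT C) (n + 1) (dLeaf C X Y (n + 1)) rfl, dLeaf, LinearMap.comp_apply]
      rw [show C.b₁deg X Y (n + 1) (C.b₁deg X Y n x) = 0 from Subtype.ext (hC _), map_zero]
    exact this
  | _, _, _, .node t f => by
    have ht := d_d_key hC t
    have hf := d_d_key hC f
    have : ∀ z, d C (d C (iNode _ t f z)) = 0 := by
      intro z
      induction z using TensorProduct.induction_on with
      | zero => rw [map_zero, map_zero, map_zero]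
      | tmul x y =>
        rw [← nodeL_inj, ← bGe_consL, d_bGe, map_neg, d_bGe, neg_neg, d_d_consL, ht, hf]
        simp
      | add x y hx hy => rw [map_add, map_add, map_add, hx, hy, add_zero]
    exact this
  | _, _, _, .ofPlain p => by
    have hp := d_d_key hC p
    have : ∀ x, d C (d C (iPlain _ p x)) = 0 := by
      intro x
      rw [← plainL_inj, d_plainL, d_plainL, hp, map_zero]
    exact this
  | _, _, _, .unary h p => by
    have hp := d_d_key hC p
    have : ∀ x, d C (d C (iUnary _ h p x)) = 0 := by
      intro x
      rw [← unaryL_inj, d_unaryL, map_sub, d_plainL, d_unaryL, hp, map_zero, sub_zero, sub_self]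
    exact this
  | _, _, _, .one t => by
    have ht := d_d_key hC t
    have : ∀ x, d C (d C (iOne _ t x)) = 0 := by
      intro x
      rw [← oneL_inj, d_oneL, d_oneL, ht, map_zero]
    exact this
  | _, _, _, .cons t f => by
    have ht := d_d_key hC t
    have hf := d_d_key hC f
    have : ∀ z, d C (d C (iCons _ t f z)) = 0 := by
      intro z
      induction z using TensorProduct.induction_on with
      | zero => rw [map_zero, map_zero, map_zero]
      | tmul x y =>
        rw [← consL_inj, d_d_consL, ht, hf]
        simp
      | add x y hx hy => rw [map_add, map_add, map_add, hx, hy, add_zero]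
    exact this

theorem b_zero {W : Ob} (p : Chain C.Hom W X) (q : Chain C.Hom Y Z) :
    C.b (p.append (.cons (0 : C.Hom X Y) q)) = 0 := by
  simpa using C.b_smul p 0 (0 : C.Hom X Y) q

theorem b₁_b₁ (x : C.Hom X Y) : C.b₁ (C.b₁ x) = 0 := by
  have := C.b_rel (.single x)
  have h1 := b_zero C (.nil X) (.single (C.parity x))
  have h2 := b_zero C (.single x) (.nil Y)
  simp only [Chain.single, Chain.append] at h1 h2
  simpa [Chain.single, Chain.cuts, Chain.append, Chain.map, C.b_nil, Cat.b₁, h1, h2] using this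

theorem d_d {κ : Kind} (z : M C.toGrQuiver B κ X Z) : d C (d C z) = 0 := by
  induction z using M_induction with
  | h0 => simp
  | hadd x x' hx hx' => rw [map_add, map_add, hx, hx', add_zero]
  | h t x => exact d_d_key C (b₁_b₁ C) t x

theorem bAll_d (z : M C.toGrQuiver B .forest X Z) : bAll C (d C z) = 0 := by
  induction z using forest_induction with
  | h0 => simp
  | hadd x x' hx hx' => rw [map_add, map_add, hx, hx', add_zero]
  | h1 x => rw [d_oneL, bAll_oneL, d_d]
  | hc x y _ => exact bAll_d_consL C x y

end

section
variable (C : Cat.{u, v, w} k Ob) (B : Set Ob)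

/-- The sequence of one tree, if the rest of the string is empty, and zero otherwise. -/
noncomputable def nilT : ∀ {X Y Z : Ob}, M C.toGrQuiver B .tree X Y → Chain (M C.toGrQuiver B .tree) Y Z →
    M C.toGrQuiver B .forest X Z
  | _, _, _, x, .nil _ => oneL _ x
  | _, _, _, _, .cons _ _ => 0

/-- The string as an element of the forest module; the empty string is sent to zero. -/
noncomputable def Fo : ∀ {X Y : Ob}, Chain (M C.toGrQuiver B .tree) X Y → M C.toGrQuiver B .forest X Y
  | _, _, .nil _ => 0
  | _, _, .cons x p => consL _ x (Fo p) + nilT C B x p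

variable {W X Y Z : Ob}

theorem nilT_append (z : M C.toGrQuiver B .tree W X) {V : Ob}
    (p : Chain (M C.toGrQuiver B .tree) X Y) (x : M C.toGrQuiver B .tree Y Z)
    (q : Chain (M C.toGrQuiver B .tree) Z V) : nilT C B z (p.append (.cons x q)) = 0 := by
  cases p <;> rfl

theorem nilT_add (x y : M C.toGrQuiver B .tree X Y) (q : Chain (M C.toGrQuiver B .tree) Y Z) :
    nilT C B (x + y) q = nilT C B x q + nilT C B y q := by
  cases q
  · exact map_add _ _ _
  · exact (add_zero _).symm

theorem nilT_smul (c : k) (x : M C.toGrQuiver B .tree X Y)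
    (q : Chain (M C.toGrQuiver B .tree) Y Z) : nilT C B (c • x) q = c • nilT C B x q := by
  cases q
  · exact map_smul _ _ _
  · exact (smul_zero _).symm

theorem Fo_add (p : Chain (M C.toGrQuiver B .tree) W X) (x y : M C.toGrQuiver B .tree X Y)
    (q : Chain (M C.toGrQuiver B .tree) Y Z) :
    Fo C B (p.append (.cons (x + y) q)) =
      Fo C B (p.append (.cons x q)) + Fo C B (p.append (.cons y q)) := by
  induction p with
  | nil => 
    simp only [Chain.append, Fo, map_add, LinearMap.add_apply, nilT_add]; abel
  | cons z p ih => simp only [Chain.append, Fo, ih, map_add, nilT_append, add_zero]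

theorem Fo_smul (p : Chain (M C.toGrQuiver B .tree) W X) (c : k) (x : M C.toGrQuiver B .tree X Y)
    (q : Chain (M C.toGrQuiver B .tree) Y Z) :
    Fo C B (p.append (.cons (c • x) q)) = c • Fo C B (p.append (.cons x q)) := by
  induction p with
  | nil => simp only [Chain.append, Fo, map_smul, LinearMap.smul_apply, nilT_smul, smul_add]
  | cons z p ih => simp only [Chain.append, Fo, ih, map_smul, nilT_append, add_zero]

theorem cut_nilT (x : M C.toGrQuiver B .tree X Y) (q : Chain (M C.toGrQuiver B .tree) Y Z) :
    cut _ (nilT C B x q) = 0 := by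
  cases q
  · exact cut_oneL _ _
  · exact map_zero _

theorem append_of_mem_cuts {H : Ob → Ob → Type*} (w : Chain H X Z) (c : Chain.Cut H X Z)
    (hc : c ∈ w.cuts) : c.left.append c.right = w := by
  induction w with
  | nil X =>
    obtain rfl := List.mem_singleton.1 hc
    rfl
  | cons x p ih =>
    rcases List.mem_cons.1 hc with rfl | hc
    · rfl
    · obtain ⟨c', hc', rfl⟩ := List.mem_map.1 hc
      exact congrArg (Chain.cons x) (ih c' hc')

theorem sum_cuts_left {N : Type*} [AddCommMonoid N] {H : Ob → Ob → Type*}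
    (φ : ∀ W : Ob, Chain H X W → Chain H W Z → N)
    (w : Chain H X Z)
    (h : ∀ (V W : Ob) (x : H X V) p q, (Chain.cons x p).append q = w → φ W (.cons x p) q = 0) :
    (w.cuts.map fun c => φ c.mid c.left c.right).sum = φ X (.nil X) w := by
  cases w with
  | nil => simp [Chain.cuts]
  | cons x p =>
    simp only [Chain.cuts, List.map_cons, List.map_map, List.sum_cons]
    rw [List.sum_eq_zero, add_zero]
    intro n hn
    obtain ⟨c, hc, rfl⟩ := List.mem_map.1 hn
    exact h _ _ _ _ _ (congrArg (Chain.cons x) (append_of_mem_cuts _ c hc))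

theorem sum_cuts_right {N : Type*} [AddCommMonoid N] {H : Ob → Ob → Type*} (w : Chain H X Z)
    (φ : ∀ W : Ob, Chain H X W → Chain H W Z → N)
    (h : ∀ (V W : Ob) (x : H W V) p q, q.append (.cons x p) = w → φ W q (.cons x p) = 0) :
    (w.cuts.map fun c => φ c.mid c.left c.right).sum = φ Z w (.nil Z) := by
  induction w with
  | nil => simp [Chain.cuts]
  | cons x p ih =>
    simp only [Chain.cuts, List.map_cons, List.map_map, List.sum_cons]
    rw [h _ _ _ _ _ rfl, zero_add]
    exact ih (fun W u v => φ W (.cons x u) v)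
      (fun V W y p q e => h _ _ _ _ _ (congrArg (Chain.cons x) e))

theorem sum_map_add' {α N : Type*} [AddCommMonoid N] (l : List α) (f g : α → N) :
    (l.map fun a => f a + g a).sum = (l.map f).sum + (l.map g).sum := List.sum_map_add

theorem map_list_sum' {α N N' : Type*} [AddCommMonoid N] [AddCommMonoid N'] [Module k N]
    [Module k N'] (φ : N →ₗ[k] N') (l : List α) (f : α → N) :
    φ (l.map f).sum = (l.map fun a => φ (f a)).sum := by
  rw [map_list_sum, List.map_map]; rfl

theorem cut_Fo (w : Chain (M C.toGrQuiver B .tree) X Z) :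
    cut _ (Fo C B w) = (w.cuts.map fun c => injMM _ (Fo C B c.left) (Fo C B c.right)).sum := by
  induction w with
  | nil X => simp [Chain.cuts, Fo]
  | cons x q ih =>
    simp only [Chain.cuts, List.map_cons, List.map_map, List.sum_cons, Fo, map_add, cut_consL,
      cut_nilT, Function.comp_def, map_zero, LinearMap.zero_apply, zero_add, add_zero,
      LinearMap.add_apply]
    rw [sum_map_add', ih, map_list_sum', sum_cuts_left
      (fun W u v => injMM C.toGrQuiver (nilT C B x u) (Fo C B v)), add_comm]
    · simp only [consMM_inj]; rfl
    · intro V W y p q _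
      simp [nilT]

theorem Fo_sgn (w : Chain (M C.toGrQuiver B .tree) X Z) :
    Fo C B (w.map (sgn C.toGrQuiver)) = sgn _ (Fo C B w) := by
  induction w with
  | nil X => simp [Chain.map, Fo]
  | cons x q ih =>
    simp only [Chain.map, Fo, map_add, sgn_consL, ih]
    congr 1
    cases q
    · exact (sgn_oneL _ _).symm
    · exact (map_zero _).symm

theorem sum_head (w : Chain (M C.toGrQuiver B .tree) X Z) :
    (w.cuts.map fun c => Fo C B (.cons (bAll C (Fo C B c.left))
      (c.right.map (sgn C.toGrQuiver)))).sum = headC C (Fo C B w) := by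
  simp only [Fo, Fo_sgn]
  rw [sum_map_add', headC_apply, cut_Fo, map_list_sum',
    sum_cuts_right w (fun W u v => nilT C B (bAll C (Fo C B u)) (v.map (sgn C.toGrQuiver)))]
  · simp only [theta_inj]
    rfl
  · intro V W x p q _
    rfl

theorem d_Fo (w : Chain (M C.toGrQuiver B .tree) X Z) :
    d C (Fo C B w) = (w.cuts.map fun c => (c.right.cuts.map fun c' =>
      Fo C B (c.left.append (.cons (bAll C (Fo C B c'.left))
        (c'.right.map (sgn C.toGrQuiver))))).sum).sum := by
  induction w with
  | nil X => simp [Chain.cuts, Fo, Chain.append, Chain.map, nilT]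
  | cons x q ih =>
    have hn : d C (nilT C B x q) = headC C (nilT C B x q) := by
      cases q
      · exact d_oneL' C x
      · exact (map_zero _).trans (map_zero _).symm
    have h1 : d C (Fo C B (.cons x q)) = headC C (Fo C B (.cons x q)) + consL _ x (d C (Fo C B q)) := by
      rw [Fo, map_add, map_add, d_consL, hn]; abel
    rw [h1, ← sum_head, ih]
    simp only [Chain.cuts, List.map_cons, List.map_map, List.sum_cons, Function.comp_def]
    congr 1
    rw [map_list_sum']
    simp only [map_list_sum', Chain.append]
    simp only [Fo, nilT_append, add_zero]

theorem bAll_mem {n : ℤ} {z : M C.toGrQuiver B .forest X Z} (hz : z ∈ degM C.toGrQuiver B _ X Z n) :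
    bAll C z ∈ degM C.toGrQuiver B _ X Z (n + 1) := by
  exact degM_forest_le _ (S := (degM C.toGrQuiver B .tree X Z (n + 1)).comap (bAll C))
    (fun x hx => by rw [Submodule.mem_comap, bAll_oneL]; exact d_mem C hx)
    (fun Y p q h x hx y hy => by
      subst h; rw [Submodule.mem_comap, bAll_consL]; exact plainL_mem _ (nodeL_mem _ hx hy)) hz

/-- The graded quiver `sE`. -/
noncomputable def EQ : GrQuiver.{u, v, max v w} k Ob where
  Hom := M C.toGrQuiver B .tree
  deg := degM C.toGrQuiver B .tree
  isInternal _ _ := isInternal_degM _ _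

theorem EQ_parity : ((EQ C B).parity : (EQ C B).Hom X Y →ₗ[k] _) = (sgn C.toGrQuiver : M C.toGrQuiver B .tree X Y →ₗ[k] _) := by
  ext x : 1
  refine (EQ C B).hom_ext (fun n x hx => ?_) x
  rw [(EQ C B).parity_of_mem hx]
  exact (sgn_of_mem C.toGrQuiver hx).symm

theorem Fo_mem {n : ℤ} (w : Chain (M C.toGrQuiver B .tree) X Z) (h : (EQ C B).IsHomog w n) :
    Fo C B w ∈ degM C.toGrQuiver B _ X Z n := by
  induction w generalizing n with
  | nil X => exact zero_mem _
  | cons x q ih =>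
    obtain ⟨p, e, hp, he, rfl⟩ := h
    refine add_mem (consL_mem _ hp (ih he)) ?_
    cases q
    · obtain rfl : e = 0 := he
      rw [add_zero]
      exact oneL_mem _ hp
    · exact zero_mem _

theorem bAll_rel (p : Chain (M C.toGrQuiver B .tree) X Z) :
    (p.cuts.map fun c => (c.right.cuts.map fun c' =>
      bAll C (Fo C B (c.left.append (.cons (bAll C (Fo C B c'.left))
        (c'.right.map (sgn C.toGrQuiver)))))).sum).sum = 0 := by
  rw [← bAll_d C (Fo C B p), d_Fo, map_list_sum']
  simp only [map_list_sum']

/-- The `A∞`-category `E`. Its operations `b_k`, `k ≥ 2`, are given by grafting of trees, and `b₁` is given by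
`d`. -/
noncomputable def E : Cat.{u, v, max v w} k Ob where
  toGrQuiver := EQ C B
  b p := bAll C (Fo C B p)
  b_nil _ := map_zero _
  b_add p x y q := (congrArg _ (Fo_add C B p x y q)).trans (map_add _ _ _)
  b_smul p c x q := (congrArg _ (Fo_smul C B p c x q)).trans (map_smul _ _ _)
  b_deg p n h := bAll_mem C B (Fo_mem C B p h)
  b_rel p := by
    simp only [EQ_parity]
    exact bAll_rel C B p
end

namespace Chain
section
variable {H H' H'' : Ob → Ob → Type*}

theorem append_nil {X Y : Ob} (p : Chain H X Y) : p.append (.nil Y) = p := by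
  induction p with
  | nil => rfl
  | cons x p ih => exact congrArg (Chain.cons x) ih

theorem append_assoc {W X Y Z : Ob} (p : Chain H W X) (q : Chain H X Y) (r : Chain H Y Z) :
    (p.append q).append r = p.append (q.append r) := by
  induction p with
  | nil => rfl
  | cons x p ih => exact congrArg (Chain.cons x) (ih _)

theorem map_append (φ : ∀ {X Y : Ob}, H X Y → H' X Y) {X Y Z : Ob} (p : Chain H X Y)
    (q : Chain H Y Z) : (p.append q).map φ = (p.map φ).append (q.map φ) := by
  induction p with
  | nil => rfl
  | cons x p ih => exact congrArg (Chain.cons _) (ih _)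

theorem map_map (φ : ∀ {X Y : Ob}, H X Y → H' X Y) (ψ : ∀ {X Y : Ob}, H' X Y → H'' X Y)
    {X Y : Ob} (p : Chain H X Y) : (p.map φ).map ψ = p.map (fun x => ψ (φ x)) := by
  induction p with
  | nil => rfl
  | cons x p ih => exact congrArg (Chain.cons _) ih

theorem map_id' (φ : ∀ {X Y : Ob}, H X Y → H X Y) (h : ∀ {X Y : Ob} (x : H X Y), φ x = x)
    {X Y : Ob} (p : Chain H X Y) : p.map φ = p := by
  induction p with
  | nil => rfl
  | cons x p ih => simp only [Chain.map, h, ih]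

theorem length_append {X Y Z : Ob} (p : Chain H X Y) (q : Chain H Y Z) :
    (p.append q).length = p.length + q.length := by
  induction p with
  | nil => exact (Nat.zero_add _).symm
  | cons x p ih => simp only [append, length, ih]; lia

theorem length_map (φ : ∀ {X Y : Ob}, H X Y → H' X Y) {X Y : Ob} (p : Chain H X Y) :
    (p.map φ).length = p.length := by
  induction p with
  | nil => rfl
  | cons x p ih => simp only [map, length, ih]

theorem cuts_map {N : Type*} (φ : ∀ {X Y : Ob}, H X Y → H' X Y) {X Z : Ob} (w : Chain H X Z)
    (ψ : ∀ Y, Chain H' X Y → Chain H' Y Z → N) :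
    ((w.map φ).cuts.map fun c => ψ c.mid c.left c.right) =
      w.cuts.map fun c => ψ c.mid (c.left.map φ) (c.right.map φ) := by
  induction w with
  | nil => rfl
  | cons x p ih =>
    simp only [cuts, map, List.map_cons, List.map_map]
    congr 1
    exact ih (fun Y u v => ψ Y (.cons (φ x) u) v)
end
end Chain

namespace GrQuiver
variable (Q : GrQuiver.{u, v, w} k Ob) {X Y : Ob}

theorem isHomog_append {X Y Z : Ob} (p : Chain Q.Hom X Y) (q : Chain Q.Hom Y Z) (m n : ℤ)
    (hp : Q.IsHomog p m) (hq : Q.IsHomog q n) : Q.IsHomog (p.append q) (m + n) := by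
  induction p generalizing m with
  | nil =>
    obtain rfl : m = 0 := hp
    rwa [zero_add]
  | cons x p ih =>
    obtain ⟨a, b, ha, hb, rfl⟩ := hp
    exact ⟨a, b + n, ha, ih _ _ hb hq, by ring⟩

theorem sum_proj (x : Q.Hom X Y) : ∃ s : Finset ℤ, ∀ t, s ⊆ t → ∑ n ∈ t, Q.proj n x = x := by
  induction x using Q.homog_induction with
  | h0 => exact ⟨∅, fun t _ => by simp⟩
  | hadd x y hx hy =>
    obtain ⟨s, hs⟩ := hx
    obtain ⟨s', hs'⟩ := hy
    refine ⟨s ∪ s', fun t ht => ?_⟩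
    simp only [map_add, Finset.sum_add_distrib]
    rw [hs t (Finset.union_subset_left ht), hs' t (Finset.union_subset_right ht)]
  | h n x hx =>
    refine ⟨{n}, fun t ht => ?_⟩
    simp only [Q.proj_of_mem _ hx]
    rw [Finset.sum_ite_eq, if_pos (ht (Finset.mem_singleton_self n))]

theorem parity_proj (n : ℤ) (x : Q.Hom X Y) :
    Q.parity (Q.proj n x) = (n.negOnePow : ℤ) • Q.proj n x := Q.parity_of_mem (Q.proj_mem n x)

/-- A multiadditive property that holds for strings of homogeneous morphisms holds for all. -/
theorem chain_induction {P : ∀ {X Y : Ob}, Chain Q.Hom X Y → Prop}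
    (h0 : ∀ {W X Y Z : Ob} (p : Chain Q.Hom W X) (q : Chain Q.Hom Y Z),
      P (p.append (.cons (0 : Q.Hom X Y) q)))
    (hadd : ∀ {W X Y Z : Ob} (p : Chain Q.Hom W X) (x y : Q.Hom X Y) (q : Chain Q.Hom Y Z),
      P (p.append (.cons x q)) → P (p.append (.cons y q)) → P (p.append (.cons (x + y) q)))
    (h : ∀ {X Y : Ob} (p : Chain Q.Hom X Y) (n : ℤ), Q.IsHomog p n → P p)
    {X Y : Ob} (p : Chain Q.Hom X Y) : P p := by
  suffices H : ∀ {X Y Z : Ob} (q : Chain Q.Hom Y Z) (p : Chain Q.Hom X Y) (n : ℤ),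
      Q.IsHomog p n → P (p.append q) from H p (.nil X) 0 rfl
  intro X Y Z q
  induction q with
  | nil => intro p n hp; rw [Chain.append_nil]; exact h p n hp
  | cons x q ih =>
    intro p n hp
    induction x using Q.homog_induction with
    | h0 => exact h0 _ _
    | hadd x y hx hy => exact hadd _ _ _ _ hx hy
    | h m x hx =>
      have := ih (p.append (.single x)) (n + m)
        (Q.isHomog_append _ _ _ _ hp ⟨m, 0, hx, rfl, add_zero m⟩)
      rwa [Chain.append_assoc] at this

end GrQuiver

namespace Cat
variable (A : Cat.{u, v, w} k Ob)

/-- A system of graded submodules that is stable under all operations. -/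
structure IsIdeal (I : ∀ X Y, Submodule k (A.Hom X Y)) : Prop where
  proj_mem : ∀ {X Y : Ob} (n : ℤ) (z : A.Hom X Y), z ∈ I X Y → A.proj n z ∈ I X Y
  b_mem : ∀ {W X Y Z : Ob} (p : Chain A.Hom W X) (z : A.Hom X Y) (q : Chain A.Hom Y Z),
    z ∈ I X Y → A.b (p.append (.cons z q)) ∈ I W Z

theorem b_sub {W X Y Z : Ob} (p : Chain A.Hom W X) (x y : A.Hom X Y) (q : Chain A.Hom Y Z) :
    A.b (p.append (.cons (x - y) q)) =
      A.b (p.append (.cons x q)) - A.b (p.append (.cons y q)) := by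
  have := A.b_add p (x - y) y q
  rw [sub_add_cancel] at this
  rw [this, add_sub_cancel_right]

variable {A} {I : ∀ X Y, Submodule k (A.Hom X Y)}

theorem IsIdeal.b_congr (hI : A.IsIdeal I) (φ : ∀ {X Y : Ob}, A.Hom X Y → A.Hom X Y)
    (hφ : ∀ {X Y : Ob} (x : A.Hom X Y), x - φ x ∈ I X Y) {X Y Z : Ob} (q : Chain A.Hom Y Z)
    (p : Chain A.Hom X Y) : A.b (p.append q) - A.b (p.append (q.map φ)) ∈ I X Z := by
  induction q with
  | nil => simp [Chain.map]
  | cons x q ih =>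
    have h1 := hI.b_mem p _ q (hφ x)
    have h2 := ih (p.append (.single (φ x)))
    rw [b_sub] at h1
    rw [Chain.append_assoc, Chain.append_assoc] at h2
    have := add_mem h1 h2
    rwa [Chain.single, Chain.append, Chain.append, Chain.append, Chain.append,
      sub_add_sub_cancel] at this

theorem IsIdeal.parity_mem (hI : A.IsIdeal I) {X Y : Ob} (z : A.Hom X Y) (hz : z ∈ I X Y) :
    A.parity z ∈ I X Y := by
  obtain ⟨s, hs⟩ := A.sum_proj z
  rw [← hs s subset_rfl, map_sum]
  exact sum_mem fun n _ => by
    rw [A.parity_proj]; exact zsmul_mem (hI.proj_mem n z hz) _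

/-- The quotient of a graded quiver by an ideal. -/
def IsIdeal.quotQ (hI : A.IsIdeal I) : GrQuiver.{u, v, w} k Ob where
  Hom X Y := A.Hom X Y ⧸ I X Y
  deg X Y n := (A.deg X Y n).map (I X Y).mkQ
  isInternal X Y := by
    refine GrQuiver.isInternal_of_proj _
      (fun n => (I X Y).mapQ (I X Y) (A.proj n) (hI.proj_mem n)) ?_ ?_ ?_
    · rintro n _ ⟨x, hx, rfl⟩
      simp [A.proj_of_mem n hx]
    · rintro m n _ hmn ⟨x, hx, rfl⟩
      simp [A.proj_of_mem n hx, hmn]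
    · intro z
      obtain ⟨x, rfl⟩ := (I X Y).mkQ_surjective z
      rw [← Submodule.map_iSup]
      exact ⟨x, A.mem_iSup x, rfl⟩

/-- The projection to the quotient. -/
def IsIdeal.quotMk (hI : A.IsIdeal I) {X Y : Ob} : A.Hom X Y →ₗ[k] hI.quotQ.Hom X Y := (I X Y).mkQ

theorem quotQ_parity (hI : A.IsIdeal I) {X Y : Ob} (x : A.Hom X Y) :
    hI.quotQ.parity (hI.quotMk x) = hI.quotMk (A.parity x) := by
  have := A.hom_ext (f := hI.quotQ.parity ∘ₗ hI.quotMk)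
    (g := hI.quotMk ∘ₗ A.parity) (fun n x hx => by
      rw [LinearMap.comp_apply, LinearMap.comp_apply, A.parity_of_mem hx, map_zsmul]
      exact hI.quotQ.parity_of_mem ⟨x, hx, rfl⟩) x
  exact this

/-- The operations on the quotient by an ideal, computed on representatives (by `quotB_map` any
representatives give the same result). -/
noncomputable def quotB (I : ∀ X Y, Submodule k (A.Hom X Y)) {X Y : Ob}
    (w : Chain (fun X Y => A.Hom X Y ⧸ I X Y) X Y) : A.Hom X Y ⧸ I X Y :=
  (I X Y).mkQ (A.b (w.map fun x => Quotient.out x))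

theorem mkQ_out {X Y : Ob} (x : A.Hom X Y ⧸ I X Y) : (I X Y).mkQ (Quotient.out x) = x :=
  Quotient.out_eq x

theorem quotB_map (hI : A.IsIdeal I) {X Y : Ob} (w : Chain A.Hom X Y) :
    quotB I (w.map (H' := fun X Y => A.Hom X Y ⧸ I X Y) fun {X Y} x => (I X Y).mkQ x) =
      (I X Y).mkQ (A.b w) := by
  rw [quotB, Chain.map_map, eq_comm, ← sub_eq_zero, ← map_sub]
  refine (Submodule.Quotient.mk_eq_zero _).2 (hI.b_congr (fun {X Y} x =>
    Quotient.out ((I X Y).mkQ x)) ?_ w (.nil X))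
  intro X Y x
  refine (Submodule.Quotient.mk_eq_zero _).1 ?_
  rw [Submodule.Quotient.mk_sub, sub_eq_zero]
  exact (mkQ_out _).symm

theorem exists_map (I : ∀ X Y, Submodule k (A.Hom X Y)) {X Y : Ob}
    (w : Chain (fun X Y => A.Hom X Y ⧸ I X Y) X Y) : ∃ w' : Chain A.Hom X Y,
      w'.map (H' := fun X Y => A.Hom X Y ⧸ I X Y) (fun {X Y} x => (I X Y).mkQ x) = w :=
  ⟨w.map fun x => Quotient.out x, by
    rw [Chain.map_map]; exact Chain.map_id' _ (fun x => mkQ_out x) _⟩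

theorem exists_map_homog (hI : A.IsIdeal I) {X Y : Ob}
    (w : Chain (fun X Y => A.Hom X Y ⧸ I X Y) X Y) (n : ℤ) (hw : hI.quotQ.IsHomog w n) :
    ∃ w' : Chain A.Hom X Y, A.IsHomog w' n ∧
      w'.map (H' := fun X Y => A.Hom X Y ⧸ I X Y) (fun {X Y} x => (I X Y).mkQ x) = w := by
  induction w generalizing n with
  | nil => exact ⟨.nil _, hw, rfl⟩
  | cons x p ih =>
    obtain ⟨a, b, ⟨x, hx, rfl⟩, hb, rfl⟩ := hw
    obtain ⟨p, hp, rfl⟩ := ih b hb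
    exact ⟨.cons x p, ⟨a, b, hx, hp, rfl⟩, rfl⟩

theorem quotB_rel (hI : A.IsIdeal I)
    (φ : ∀ {X Y : Ob}, (A.Hom X Y ⧸ I X Y) → (A.Hom X Y ⧸ I X Y))
    (hφ : ∀ {X Y : Ob} (x : A.Hom X Y), φ ((I X Y).mkQ x) = (I X Y).mkQ (A.parity x))
    {X Y : Ob} (p : Chain A.Hom X Y) :
    ((p.map (H' := fun X Y => A.Hom X Y ⧸ I X Y) fun {X Y} x => (I X Y).mkQ x).cuts.map
      fun c => (c.right.cuts.map fun c' =>
        quotB I (c.left.append (.cons (quotB I c'.left) (c'.right.map φ)))).sum).sum = 0 := by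
  have h := congrArg (I X Y).mkQ (A.b_rel p)
  rw [map_zero, map_list_sum'] at h
  simp only [map_list_sum'] at h
  rw [← h, Chain.cuts_map (fun {X Y} x => (I X Y).mkQ x) p (fun Z u v => (v.cuts.map fun c' =>
        quotB I (u.append (.cons (quotB I c'.left) (c'.right.map φ)))).sum)]
  congr 2
  funext c
  rw [Chain.cuts_map (fun {X Y} x => (I X Y).mkQ x) c.right (fun Z u v =>
        quotB I ((c.left.map fun {X Y} x => (I X Y).mkQ x).append
          (.cons (quotB I u) (v.map φ))))]
  congr 2
  funext c'
  rw [← quotB_map hI, Chain.map_append, Chain.map, ← quotB_map hI, Chain.map_map, Chain.map_map]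
  simp only [hφ]

/-- The quotient `A∞`-category by an ideal. -/
noncomputable def IsIdeal.quot (hI : A.IsIdeal I) : Cat.{u, v, w} k Ob where
  toGrQuiver := hI.quotQ
  b w := quotB I w
  b_nil X := by
    refine (quotB_map hI (.nil X)).trans ?_
    rw [A.b_nil, map_zero]
    rfl
  b_add {W X Y Z} p x y q := by
    obtain ⟨p, rfl⟩ := exists_map I p
    obtain ⟨q, rfl⟩ := exists_map I q
    obtain ⟨x, rfl⟩ := (I X Y).mkQ_surjective x
    obtain ⟨y, rfl⟩ := (I X Y).mkQ_surjective y
    have h := congrArg (I W Z).mkQ (A.b_add p x y q)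
    rw [map_add] at h
    simp only [← quotB_map hI, Chain.map_append, Chain.map, map_add] at h
    exact h
  b_smul {W X Y Z} p c x q := by
    obtain ⟨p, rfl⟩ := exists_map I p
    obtain ⟨q, rfl⟩ := exists_map I q
    obtain ⟨x, rfl⟩ := (I X Y).mkQ_surjective x
    have h := congrArg (I W Z).mkQ (A.b_smul p c x q)
    rw [map_smul] at h
    simp only [← quotB_map hI, Chain.map_append, Chain.map, map_smul] at h
    exact h
  b_deg {X Y} p n h := by
    obtain ⟨p, hp, rfl⟩ := exists_map_homog hI p n h
    exact ⟨A.b p, A.b_deg p n hp, (quotB_map hI p).symm⟩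
  b_rel {X Y} p := by
    obtain ⟨p, rfl⟩ := exists_map I p
    exact quotB_rel hI (fun x => hI.quotQ.parity x) (quotQ_parity hI) p

end Cat

section
variable (C : Cat.{u, v, w} k Ob) (B : Set Ob)

/-- The inclusion in `sE` of the summand of trees whose lowest vertex is not unary. -/
noncomputable def plainE {X Y : Ob} : M C.toGrQuiver B .plain X Y →ₗ[k] (E C B).Hom X Y := plainL _

/-- The operator `H` of degree `-1`, defined on the summand of trees whose lowest vertex is not unary. -/
noncomputable def unaryE {X Y : Ob} (h : X ∈ B ∨ Y ∈ B) :
    M C.toGrQuiver B .plain X Y →ₗ[k] (E C B).Hom X Y := unaryL _ h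

/-- The inclusion of `sC` as the summand of the trivial trees. -/
noncomputable def leafL {X Y : Ob} : C.Hom X Y →ₗ[k] M C.toGrQuiver B .plain X Y :=
  DirectSum.toModule k ℤ (M C.toGrQuiver B .plain X Y) (iLeaf C.toGrQuiver X Y) ∘ₗ
    (C.decomp X Y).toLinearMap

/-- The embedding of `sC` in `sE` as the summand of the trivial trees. -/
noncomputable def embed {X Y : Ob} : C.Hom X Y →ₗ[k] (E C B).Hom X Y := plainE C B ∘ₗ leafL C B

/-- Membership in the ideal `(R_C)₊` of `E`, generated by the images of
`δ_n = (sC^{⊗n} → sE^{⊗n} → sE) - (sC^{⊗n} → sC → sE)`, `n ≥ 2`, under the operations `b_p` with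
`p ≥ 2`, where one argument is in the ideal, and under `H`. -/
inductive Rel : ∀ X Y : Ob, (E C B).Hom X Y → Prop
  | zero (X Y : Ob) : Rel X Y 0
  | add {X Y : Ob} (z z' : (E C B).Hom X Y) : Rel X Y z → Rel X Y z' → Rel X Y (z + z')
  | smul {X Y : Ob} (c : k) (z : (E C B).Hom X Y) : Rel X Y z → Rel X Y (c • z)
  | delta {X Y : Ob} (w : Chain C.Hom X Y) (hw : 2 ≤ w.length) :
      Rel X Y ((E C B).b (w.map (embed C B)) - embed C B (C.b w))
  | op {W X Y Z : Ob} (p : Chain (E C B).Hom W X) (z : (E C B).Hom X Y)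
      (q : Chain (E C B).Hom Y Z) (hpq : 2 ≤ (p.append (.cons z q)).length) :
      Rel X Y z → Rel W Z ((E C B).b (p.append (.cons z q)))
  | unary {X Y : Ob} (h : X ∈ B ∨ Y ∈ B) (z : M C.toGrQuiver B .plain X Y) :
      Rel X Y (plainE C B z) → Rel X Y (unaryE C B h z)

/-- The ideal `(R_C)₊` of `E`. -/
def ideal (X Y : Ob) : Submodule k ((E C B).Hom X Y) where
  carrier := {z | Rel C B X Y z}
  zero_mem' := .zero X Y
  add_mem' := .add _ _
  smul_mem' c z := .smul c z

variable {X Y : Ob}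

theorem embed_of_mem {n : ℤ} {x : C.Hom X Y} (hx : x ∈ C.deg X Y n) :
    embed C B x = plainE C B (iLeaf C.toGrQuiver X Y n ⟨x, hx⟩) := by
  have : leafL C B x = iLeaf C.toGrQuiver X Y n ⟨x, hx⟩ := by
    simp only [leafL, LinearMap.comp_apply, LinearEquiv.coe_coe, C.decomp_of_mem hx,
      DirectSum.toModule_lof]
  rw [embed, LinearMap.comp_apply, this]

theorem d_iLeaf (n : ℤ) (x : C.deg X Y n) : d C (iLeaf C.toGrQuiver (B := B) X Y n x) =
    iLeaf _ X Y (n + 1) (C.b₁deg X Y n x) :=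
  elim_iLeaf _ (dT C) n (dLeaf C X Y n) rfl x

theorem projM_of_mem {κ : Kind} {m : ℤ} (n : ℤ) {x : M C.toGrQuiver B κ X Y}
    (hx : x ∈ degM C.toGrQuiver B κ X Y m) : projM _ n x = if m = n then x else 0 := by
  have := degM_le C.toGrQuiver (S := LinearMap.eqLocus (projM C.toGrQuiver n)
    (if m = n then LinearMap.id else 0)) (fun t ht x => by
      subst ht
      rw [LinearMap.mem_eqLocus, projM, elim_inj]
      split_ifs <;> rfl) hx
  rw [LinearMap.mem_eqLocus] at this
  rw [this]
  split_ifs <;> rfl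

theorem embed_mem {n : ℤ} {x : C.Hom X Y} (hx : x ∈ C.deg X Y n) :
    embed C B x ∈ (E C B).deg X Y n := by
  rw [embed_of_mem C B hx]
  exact plainL_mem _ (iLeaf_mem _ _ _)

theorem E_b₁ (z : (E C B).Hom X Y) : (E C B).b₁ z = d C (κ := .tree) z := by
  have : bAll C (Fo C B (.single z)) = d C (κ := .tree) z := by
    exact (congrArg (bAll C) ((congrArg (· + _) (map_zero _)).trans (zero_add _))).trans
      (bAll_oneL C z)
  exact this

theorem b₁_plainE (z : M C.toGrQuiver B .plain X Y) :
    (E C B).b₁ (plainE C B z) = plainE C B (d C z) := (E_b₁ C B _).trans (d_plainL C z)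

theorem b₁_unaryE (h : X ∈ B ∨ Y ∈ B) (z : M C.toGrQuiver B .plain X Y) :
    (E C B).b₁ (unaryE C B h z) = plainE C B z - unaryE C B h (d C z) :=
  (E_b₁ C B _).trans (d_unaryL C h z)

theorem b₁_embed (x : C.Hom X Y) : (E C B).b₁ (embed C B x) = embed C B (C.b₁ x) := by
  have := C.hom_ext (f := (E C B).b₁ ∘ₗ embed C B) (g := embed C B ∘ₗ C.b₁) (fun n x hx => by
    have hx' : C.b₁ x ∈ C.deg X Y (n + 1) := C.b_deg (.single x) n ⟨n, 0, hx, rfl, add_zero n⟩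
    rw [LinearMap.comp_apply, LinearMap.comp_apply, embed_of_mem C B hx, embed_of_mem C B hx',
      b₁_plainE, d_iLeaf]
    rfl) x
  exact this

theorem parity_embed (x : C.Hom X Y) : (E C B).parity (embed C B x) = embed C B (C.parity x) := by
  have := C.hom_ext (f := (E C B).parity ∘ₗ embed C B) (g := embed C B ∘ₗ C.parity)
    (fun n x hx => by
      rw [LinearMap.comp_apply, LinearMap.comp_apply, C.parity_of_mem hx, map_zsmul]
      exact (E C B).parity_of_mem (embed_mem C B hx)) x
  exact this

theorem proj_E (n : ℤ) (z : (E C B).Hom X Y) :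
    (E C B).proj n z = projM C.toGrQuiver (κ := .tree) n z := by
  refine (E C B).hom_ext (f := (E C B).proj n) (g := (projM C.toGrQuiver (κ := .tree) n :
    M C.toGrQuiver B .tree X Y →ₗ[k] M C.toGrQuiver B .tree X Y)) (fun m x hx => ?_) z
  exact ((E C B).proj_of_mem n hx).trans (projM_of_mem C B n hx).symm

theorem proj_plainE (n : ℤ) (z : M C.toGrQuiver B .plain X Y) :
    (E C B).proj n (plainE C B z) = plainE C B (projM _ n z) := by
  rw [proj_E]
  refine degM_hom_ext C (f := projM C.toGrQuiver n ∘ₗ plainL C.toGrQuiver)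
    (g := plainL C.toGrQuiver ∘ₗ projM C.toGrQuiver n) (fun m x hx => ?_) z
  rw [LinearMap.comp_apply, LinearMap.comp_apply, projM_of_mem C B n hx,
    projM_of_mem C B n (plainL_mem _ hx)]
  split_ifs
  · rfl
  · exact (map_zero _).symm

theorem proj_unaryE (n : ℤ) (h : X ∈ B ∨ Y ∈ B) (z : M C.toGrQuiver B .plain X Y) :
    (E C B).proj n (unaryE C B h z) = unaryE C B h (projM _ (n + 1) z) := by
  rw [proj_E]
  refine degM_hom_ext C (f := projM C.toGrQuiver n ∘ₗ unaryL C.toGrQuiver h)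
    (g := unaryL C.toGrQuiver h ∘ₗ projM C.toGrQuiver (n + 1)) (fun m x hx => ?_) z
  rw [LinearMap.comp_apply, LinearMap.comp_apply, projM_of_mem C B (n + 1) hx,
    projM_of_mem C B n (unaryL_mem _ h hx)]
  by_cases hm : m = n + 1
  · rw [if_pos hm, if_pos (by lia)]
  · rw [if_neg hm, if_neg (by lia), map_zero]

end

section
variable (C : Cat.{u, v, w} k Ob) (B : Set Ob) {W X Y Z : Ob}

theorem b_sum (A : Cat.{u, v, w} k Ob) (p : Chain A.Hom W X) (q : Chain A.Hom Y Z) (s : Finset ℤ)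
    (f : ℤ → A.Hom X Y) :
    A.b (p.append (.cons (∑ n ∈ s, f n) q)) = ∑ n ∈ s, A.b (p.append (.cons (f n) q)) := by
  classical
  induction s using Finset.induction_on with
  | empty => simpa using b_zero A p q
  | insert a s ha ih => rw [Finset.sum_insert ha, Finset.sum_insert ha, A.b_add, ih]

/-- The defect of the embedding. -/
noncomputable def delta (w : Chain C.Hom X Y) : (E C B).Hom X Y :=
  (E C B).b (w.map (embed C B)) - embed C B (C.b w)

theorem delta_zero (p : Chain C.Hom W X) (q : Chain C.Hom Y Z) :
    delta C B (p.append (.cons (0 : C.Hom X Y) q)) = 0 := by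
  rw [delta, b_zero, Chain.map_append, Chain.map, map_zero, b_zero, map_zero, sub_zero]

theorem delta_add (p : Chain C.Hom W X) (x y : C.Hom X Y) (q : Chain C.Hom Y Z) :
    delta C B (p.append (.cons (x + y) q)) =
      delta C B (p.append (.cons x q)) + delta C B (p.append (.cons y q)) := by
  simp only [delta, Chain.map_append, Chain.map, map_add, C.b_add, (E C B).b_add]
  abel

theorem isHomog_embed (w : Chain C.Hom X Y) (n : ℤ) (h : C.IsHomog w n) :
    (E C B).IsHomog (w.map (embed C B)) n := by
  induction w generalizing n with
  | nil => exact h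
  | cons x p ih =>
    obtain ⟨a, b, ha, hb, rfl⟩ := h
    exact ⟨a, b, embed_mem C B ha, ih _ hb, rfl⟩

theorem delta_deg (w : Chain C.Hom X Y) (n : ℤ) (h : C.IsHomog w n) :
    delta C B w ∈ (E C B).deg X Y (n + 1) :=
  sub_mem ((E C B).b_deg _ n (isHomog_embed C B w n h)) (embed_mem C B (C.b_deg w n h))

theorem delta_mem (w : Chain C.Hom X Y) (hw : 2 ≤ w.length) : delta C B w ∈ ideal C B X Y :=
  .delta w hw

theorem op_mem (p : Chain (E C B).Hom W X) (z : (E C B).Hom X Y) (q : Chain (E C B).Hom Y Z)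
    (hpq : 1 ≤ p.length + q.length) (hz : z ∈ ideal C B X Y) :
    (E C B).b (p.append (.cons z q)) ∈ ideal C B W Z :=
  .op p z q (by rw [Chain.length_append, Chain.length]; lia) hz

theorem proj_of_deg {A : GrQuiver.{u, v, w} k Ob} {I : Submodule k (A.Hom X Y)} {z : A.Hom X Y} (hz : z ∈ I) {m : ℤ}
    (hm : z ∈ A.deg X Y m) (n : ℤ) : A.proj n z ∈ I := by
  rw [A.proj_of_mem n hm]
  split_ifs
  · exact hz
  · exact zero_mem _

theorem proj_delta (w : Chain C.Hom X Y) : 2 ≤ w.length →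
    ∀ n, (E C B).proj n (delta C B w) ∈ ideal C B X Y := by
  refine C.chain_induction (P := fun {X Y} w => 2 ≤ w.length →
    ∀ n, (E C B).proj n (delta C B w) ∈ ideal C B X Y) ?_ ?_ ?_ w
  · intro W X Y Z p q _ n
    rw [delta_zero, map_zero]
    exact zero_mem _
  · intro W X Y Z p x y q hx hy h n
    rw [Chain.length_append, Chain.length] at hx hy h
    rw [delta_add, map_add]
    exact add_mem (hx h n) (hy h n)
  · intro X Y w m hm hw n
    exact proj_of_deg (delta_mem C B w hw) (delta_deg C B w m hm) n

theorem proj_op₁ (q : Chain (E C B).Hom Y Z) : ∀ {W X : Ob} (p : Chain (E C B).Hom W X) (r : ℤ)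
    (z : (E C B).Hom X Y) (m : ℤ), (E C B).IsHomog p r → z ∈ ideal C B X Y →
      z ∈ (E C B).deg X Y m → 1 ≤ p.length + q.length → ∀ n,
      (E C B).proj n ((E C B).b (p.append (.cons z q))) ∈ ideal C B W Z := by
  refine (E C B).chain_induction (P := fun {Y Z} q => ∀ {W X : Ob} (p : Chain (E C B).Hom W X)
    (r : ℤ) (z : (E C B).Hom X Y) (m : ℤ), (E C B).IsHomog p r → z ∈ ideal C B X Y →
      z ∈ (E C B).deg X Y m → 1 ≤ p.length + q.length → ∀ n,
      (E C B).proj n ((E C B).b (p.append (.cons z q))) ∈ ideal C B W Z) ?_ ?_ ?_ q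
  · intro W X Y Z p q W' X' p' r z m _ _ _ _ n
    have := b_zero (E C B) (X := X) (Y := Y) (p'.append (.cons z p)) q
    rw [Chain.append_assoc, Chain.append] at this
    rw [this, map_zero]
    exact zero_mem _
  · intro W X Y Z p x y q hx hy W' X' p' r z m hr hz hm hl n
    have := (E C B).b_add (p'.append (.cons z p)) x y q
    simp only [Chain.append_assoc, Chain.append] at this
    rw [this, map_add]
    simp only [Chain.length_append, Chain.length] at hx hy hl
    exact add_mem (hx p' r z m hr hz hm hl n) (hy p' r z m hr hz hm hl n)
  · intro Y Z q s hs W X p r z m hr hz hm hl n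
    exact proj_of_deg (op_mem C B p z q hl hz) ((E C B).b_deg _ _
      ((E C B).isHomog_append _ _ _ _ hr ⟨m, s, hm, hs, rfl⟩)) n

theorem proj_op₂ (p : Chain (E C B).Hom W X) : ∀ {Y Z : Ob} (z : (E C B).Hom X Y) (m : ℤ)
    (q : Chain (E C B).Hom Y Z), z ∈ ideal C B X Y → z ∈ (E C B).deg X Y m →
      1 ≤ p.length + q.length → ∀ n,
      (E C B).proj n ((E C B).b (p.append (.cons z q))) ∈ ideal C B W Z := by
  refine (E C B).chain_induction (P := fun {W X} p => ∀ {Y Z : Ob} (z : (E C B).Hom X Y) (m : ℤ)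
    (q : Chain (E C B).Hom Y Z), z ∈ ideal C B X Y → z ∈ (E C B).deg X Y m →
      1 ≤ p.length + q.length → ∀ n,
      (E C B).proj n ((E C B).b (p.append (.cons z q))) ∈ ideal C B W Z) ?_ ?_ ?_ p
  · intro W X Y Z p q Y' Z' z m q' _ _ _ n
    have := b_zero (E C B) (X := X) (Y := Y) p (q.append (.cons z q'))
    rw [Chain.append_assoc, Chain.append, this, map_zero]
    exact zero_mem _
  · intro W X Y Z p x y q hx hy Y' Z' z m q' hz hm hl n
    have := (E C B).b_add p x y (q.append (.cons z q'))
    have hx := hx z m q' hz hm (by simpa only [Chain.length_append, Chain.length] using hl) n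
    have hy := hy z m q' hz hm (by simpa only [Chain.length_append, Chain.length] using hl) n
    simp only [Chain.append_assoc, Chain.append] at this hx hy ⊢
    rw [this, map_add]
    exact add_mem hx hy
  · intro W X p r hr Y Z z m q hz hm hl n
    exact proj_op₁ C B q p r z m hr hz hm hl n

theorem proj_ideal (z : (E C B).Hom X Y) (hz : Rel C B X Y z) :
    ∀ n, (E C B).proj n z ∈ ideal C B X Y := by
  induction hz with
  | zero => intro n; rw [map_zero]; exact zero_mem _
  | add z z' _ _ h h' => intro n; rw [map_add]; exact add_mem (h n) (h' n)
  | smul c z _ h => intro n; rw [map_smul]; exact Submodule.smul_mem _ _ (h n)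
  | delta w hw => exact proj_delta C B w hw
  | op p z q hpq _ h =>
    intro n
    obtain ⟨s, hs⟩ := (E C B).sum_proj z
    rw [← hs s subset_rfl, b_sum, map_sum]
    refine sum_mem fun m _ => ?_
    refine proj_op₂ C B p _ m q (h m) ((E C B).proj_mem m z) ?_ n
    rw [Chain.length_append, Chain.length] at hpq
    lia
  | unary h z _ ih =>
    intro n
    have := ih (n + 1)
    rw [proj_plainE] at this
    rw [proj_unaryE]
    exact .unary h _ this

theorem parity_ideal (z : (E C B).Hom X Y) (hz : z ∈ ideal C B X Y) :
    (E C B).parity z ∈ ideal C B X Y := by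
  obtain ⟨s, hs⟩ := (E C B).sum_proj z
  rw [← hs s subset_rfl, map_sum]
  exact sum_mem fun n _ => by
    rw [(E C B).parity_proj]; exact zsmul_mem (proj_ideal C B z hz n) _

/-- If a sum over all two-step factorizations lies in a subgroup, and so do all its summands but the one with empty
outer parts, then so does the latter. -/
theorem mem_of_sum {N : Type*} [AddCommGroup N] [Module k N] (S : Submodule k N)
    {H : Ob → Ob → Type*} (w : Chain H X Z)
    (φ : ∀ U V : Ob, Chain H X U → Chain H U V → Chain H V Z → N)
    (hS : (w.cuts.map fun c => (c.right.cuts.map fun c' =>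
      φ c.mid c'.mid c.left c'.left c'.right).sum).sum ∈ S)
    (h : ∀ (U V : Ob) (p : Chain H X U) (q : Chain H U V) (r : Chain H V Z),
      p.append (q.append r) = w → 1 ≤ p.length + r.length → φ U V p q r ∈ S) :
    φ X Z (.nil X) w (.nil Z) ∈ S := by
  have h' : ∀ (U V : Ob) (p : Chain H X U) (q : Chain H U V) (r : Chain H V Z),
      p.append (q.append r) = w → 1 ≤ p.length + r.length → S.mkQ (φ U V p q r) = 0 :=
    fun U V p q r e hl => (Submodule.Quotient.mk_eq_zero S).2 (h U V p q r e hl)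
  have hS' := (Submodule.Quotient.mk_eq_zero S).2 hS
  refine (Submodule.Quotient.mk_eq_zero S).1 ?_
  rw [← hS']
  change S.mkQ _ = S.mkQ _
  rw [map_list_sum', sum_cuts_left (fun U p q => S.mkQ (q.cuts.map fun c' =>
    φ U c'.mid p c'.left c'.right).sum) w, map_list_sum',
    sum_cuts_right w (fun V q r => S.mkQ (φ X V (.nil X) q r))]
  · intro V W x p q e
    exact h' _ _ _ _ _ e (by simp [Chain.length])
  · intro V W x p q e
    rw [map_list_sum']
    refine List.sum_eq_zero fun n hn => ?_
    obtain ⟨c, hc, rfl⟩ := List.mem_map.1 hn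
    refine h' _ _ _ _ _ ?_ (by simp only [Chain.length]; lia)
    rw [append_of_mem_cuts _ c hc]
    exact e

/-- Some morphism of the string has the property `K`. -/
def Chain.Has {H : Ob → Ob → Type*} (K : ∀ {X Y : Ob}, H X Y → Prop) :
    ∀ {X Y : Ob}, Chain H X Y → Prop
  | _, _, .nil _ => False
  | _, _, .cons x p => K x ∨ Chain.Has K p

theorem Chain.has_append {H : Ob → Ob → Type*} (K : ∀ {X Y : Ob}, H X Y → Prop)
    (p : Chain H X Y) (q : Chain H Y Z) : (p.append q).Has K ↔ p.Has K ∨ q.Has K := by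
  induction p with
  | nil => simp [Chain.append, Chain.Has]
  | cons x p ih => simp [Chain.append, Chain.Has, ih, or_assoc]

theorem Chain.has_iff {H : Ob → Ob → Type*} (K : ∀ {X Y : Ob}, H X Y → Prop)
    (w : Chain H X Y) : w.Has K → ∃ (U V : Ob) (p : Chain H X U) (x : H U V) (q : Chain H V Y),
      w = p.append (.cons x q) ∧ K x := by
  induction w with
  | nil => exact False.elim
  | cons x p ih =>
    rintro (h | h)
    · exact ⟨_, _, .nil _, x, p, rfl, h⟩
    · obtain ⟨U, V, p', y, q, rfl, hy⟩ := ih h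
      exact ⟨U, V, .cons x p', y, q, rfl, hy⟩

theorem b_has {K : ∀ {X Y : Ob}, (E C B).Hom X Y → Prop}
    (hK : ∀ {X Y : Ob} (z : (E C B).Hom X Y), K z → z ∈ ideal C B X Y)
    (w : Chain (E C B).Hom X Y) (hw : 2 ≤ w.length) (h : w.Has K) :
    (E C B).b w ∈ ideal C B X Y := by
  obtain ⟨U, V, p, x, q, rfl, hx⟩ := Chain.has_iff _ _ h
  rw [Chain.length_append, Chain.length] at hw
  exact op_mem C B p x q (by lia) (hK x hx)

theorem has_parity (w : Chain (E C B).Hom X Y) (h : w.Has (fun {X Y} z => z ∈ ideal C B X Y)) :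
    (w.map (E C B).parity).Has (fun {X Y} z => z ∈ ideal C B X Y) := by
  induction w with
  | nil => exact h
  | cons x p ih =>
    rcases h with h | h
    · exact .inl (parity_ideal C B x h)
    · exact .inr (ih h)

theorem has_mono {H : Ob → Ob → Type*} {K K' : ∀ {X Y : Ob}, H X Y → Prop}
    (hK : ∀ {X Y : Ob} (z : H X Y), K z → K' z) (w : Chain H X Y) (h : w.Has K) : w.Has K' := by
  induction w with
  | nil => exact h
  | cons x p ih => exact h.imp (hK x) ih

theorem b₁_op (p : Chain (E C B).Hom W X) (z : (E C B).Hom X Y) (q : Chain (E C B).Hom Y Z)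
    (hz : z ∈ ideal C B X Y)
    (hz' : (E C B).b₁ z ∈ ideal C B X Y) :
    (E C B).b₁ ((E C B).b (p.append (.cons z q))) ∈ ideal C B W Z := by
  set w := p.append (.cons z q) with hw
  let K : ∀ {X Y : Ob}, (E C B).Hom X Y → Prop := fun {X Y} z =>
    z ∈ ideal C B X Y ∧ (E C B).b₁ z ∈ ideal C B X Y
  have hwK : w.Has K := (Chain.has_append _ _ _).2 (.inr (.inl ⟨hz, hz'⟩))
  refine mem_of_sum (ideal C B W Z) w (fun U V p q r => (E C B).b (p.append
    (.cons ((E C B).b q) (r.map (E C B).parity)))) ?_ ?_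
  · have := (E C B).b_rel w
    rw [this]
    exact zero_mem _
  · intro U V p' q' r' e hl
    rw [← e, Chain.has_append, Chain.has_append] at hwK
    have hl' : 2 ≤ (p'.append (.cons ((E C B).b q') (r'.map (E C B).parity))).length := by
      rw [Chain.length_append, Chain.length, Chain.length_map]; lia
    have hKI : ∀ {X Y : Ob} (z : (E C B).Hom X Y), K z → z ∈ ideal C B X Y := fun z hz => hz.1
    refine b_has C B (K := fun {X Y} z => z ∈ ideal C B X Y) (fun z hz => hz) _ hl' ?_
    rw [Chain.has_append]
    rcases hwK with h | h | h
    · exact .inl (has_mono hKI _ h)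
    · refine .inr (.inl ?_)
      by_cases hq : 2 ≤ q'.length
      · exact b_has C B hKI _ hq h
      · match q', h, hq with
        | .cons x (.nil _), h, _ => exact (h.resolve_right id).2
        | .cons x (.cons y q), _, hq => exact absurd (by simp only [Chain.length]; lia) hq
    · exact .inr (.inr (has_parity C B _ (has_mono hKI _ h)))

theorem sum_map_sub' {N α : Type*} [AddCommGroup N] (l : List α) (f g : α → N) :
    (l.map fun a => f a - g a).sum = (l.map f).sum - (l.map g).sum := by
  induction l with
  | nil => simp
  | cons a l ih => simp only [List.map_cons, List.sum_cons, ih]; abel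

theorem sum_map_sub₂ {N α : Type*} {β : α → Type*} [AddCommGroup N] (l : List α)
    (m : ∀ a, List (β a)) (f g : ∀ a, β a → N) :
    (l.map fun a => ((m a).map fun b => f a b - g a b).sum).sum =
      (l.map fun a => ((m a).map fun b => f a b).sum).sum -
        (l.map fun a => ((m a).map fun b => g a b).sum).sum := by
  simp only [sum_map_sub']

theorem b₁_delta (w : Chain C.Hom X Y) : (E C B).b₁ (delta C B w) ∈ ideal C B X Y := by
  have h₁ := (E C B).b_rel (w.map (embed C B))
  rw [Chain.cuts_map (embed C B) w (fun Z u v => (v.cuts.map fun c' => (E C B).b (u.append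
    (.cons ((E C B).b c'.left) (c'.right.map (E C B).parity)))).sum)] at h₁
  have h₃ := fun c : Chain.Cut C.Hom X Y =>
    Chain.cuts_map (embed C B) c.right (fun Z u v => (E C B).b ((c.left.map (embed C B)).append
      (.cons ((E C B).b u) (v.map (E C B).parity))))
  beta_reduce at h₁ h₃
  simp only [h₃] at h₁
  have h₂ := congrArg (embed C B) (C.b_rel w)
  rw [map_zero, map_list_sum'] at h₂
  simp only [map_list_sum'] at h₂
  have key := mem_of_sum (ideal C B X Y) w (fun U V p q r =>
    (E C B).b ((p.map (embed C B)).append (.cons ((E C B).b (q.map (embed C B)))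
      ((r.map (embed C B)).map (E C B).parity))) -
    embed C B (C.b (p.append (.cons (C.b q) (r.map C.parity))))) ?_ ?_
  · rw [delta, map_sub, b₁_embed]
    exact key
  · rw [sum_map_sub₂, h₁, h₂, sub_zero]
    exact zero_mem _
  · intro U V p q r _ hl
    have h1 : ∀ r : Chain C.Hom V Y, (r.map (embed C B)).map (E C B).parity =
        (r.map C.parity).map (embed C B) := fun r => by
      rw [Chain.map_map, Chain.map_map]; simp only [parity_embed]
    have h2 : delta C B q ∈ ideal C B U V := by
      by_cases hq : 2 ≤ q.length
      · exact delta_mem C B q hq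
      · match q, hq with
        | .nil _, _ =>
          rw [delta, C.b_nil, map_zero, Chain.map, (E C B).b_nil, sub_zero]
          exact zero_mem _
        | .cons x (.nil _), _ =>
          have : delta C B (.single x) = 0 := by
            rw [delta, sub_eq_zero]
            exact b₁_embed C B x
          exact this ▸ zero_mem _
        | .cons x (.cons y q), hq => exact absurd (by simp only [Chain.length]; lia) hq
    have h3 := op_mem C B (p.map (embed C B)) _ ((r.map C.parity).map (embed C B))
      (by simp only [Chain.length_map]; lia) h2
    have h4 := delta_mem C B (p.append (.cons (C.b q) (r.map C.parity)))
      (by rw [Chain.length_append, Chain.length, Chain.length_map]; lia)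
    rw [delta, Cat.b_sub] at h3
    rw [delta, Chain.map_append, Chain.map] at h4
    have := add_mem h3 h4
    rw [sub_add_sub_cancel] at this
    rw [h1]
    exact this

theorem b₁_ideal (z : (E C B).Hom X Y) (hz : Rel C B X Y z) :
    (E C B).b₁ z ∈ ideal C B X Y := by
  induction hz with
  | zero => rw [map_zero]; exact zero_mem _
  | add z z' _ _ h h' => rw [map_add]; exact add_mem h h'
  | smul c z _ h => rw [map_smul]; exact Submodule.smul_mem _ _ h
  | delta w hw => exact b₁_delta C B w
  | op p z q hpq hz h => exact b₁_op C B p z q hz h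
  | unary h z hz ih =>
    rw [b₁_unaryE]
    rw [b₁_plainE] at ih
    exact sub_mem hz (.unary h _ ih)

theorem isIdeal : (E C B).IsIdeal (ideal C B) where
  proj_mem n z hz := proj_ideal C B z hz n
  b_mem p z q hz := by
    by_cases h : 1 ≤ p.length + q.length
    · exact op_mem C B p z q h hz
    · match p, q, z, hz, h with
      | .nil _, .nil _, z, hz, _ => exact b₁_ideal C B z hz
      | .cons _ _, _, _, _, h => exact absurd (by simp only [Chain.length]; lia) h
      | .nil _, .cons _ _, _, _, h => exact absurd (by simp only [Chain.length]; lia) h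

end

section
variable (C : Cat.{u, v, w} k Ob) (B : Set Ob)

/-- The quotient `A∞`-category `D = Q(C|B)` of `E` by the ideal `(R_C)₊`. -/
noncomputable def Q : Cat.{u, v, max v w} k Ob := (isIdeal C B).quot

/-- The first component of the canonical strict `A∞`-functor `C → Q(C|B)`: the embedding of `C` in
`E` followed by the projection to the quotient. -/
noncomputable def toQ {X Y : Ob} : C.Hom X Y →ₗ[k] (Q C B).Hom X Y :=
  (isIdeal C B).quotMk ∘ₗ embed C B

end

/-- The elements `i X ∈ sA(X,X)` are unit elements of the `A∞`-category `A`: they are cycles of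
degree `-1`, and the maps `(1 ⊗ i)b₂` and `-(i ⊗ 1)b₂` from `sA(X,Y)` to itself are homotopic to the
identity map. As `i` is odd, `x(i ⊗ 1) = (-1)^{|x|} i ⊗ x`, and so `x(i ⊗ 1)b₂` is
`b₂(i, parity x)`. -/
structure Cat.IsUnits (A : Cat.{u, v, w} k Ob) (i : ∀ X, A.Hom X X) : Prop where
  mem : ∀ X, i X ∈ A.deg X X (-1)
  cycle : ∀ X, A.b₁ (i X) = 0
  right : ∀ X Y, ∃ h : A.Hom X Y →ₗ[k] A.Hom X Y,
    (∀ n, ∀ x ∈ A.deg X Y n, h x ∈ A.deg X Y (n - 1)) ∧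
    ∀ x, x - A.b (.cons x (.single (i Y))) = h (A.b₁ x) + A.b₁ (h x)
  left : ∀ X Y, ∃ h : A.Hom X Y →ₗ[k] A.Hom X Y,
    (∀ n, ∀ x ∈ A.deg X Y n, h x ∈ A.deg X Y (n - 1)) ∧
    ∀ x, x + A.b (.cons (i X) (.single (A.parity x))) = h (A.b₁ x) + A.b₁ (h x)

end AInf

/-!
The unit elements of `C` satisfy the conditions of `Cat.IsUnits` in `D = E / (R_C)₊` as soon as the maps
`(1 ⊗ i)b₂` and `-(i ⊗ 1)b₂` of `E` are homotopic to the identity modulo the ideal `(R_C)₊`, by a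
homotopy `h` that preserves the ideal. Such an `h` is built by recursion on trees; here is the case of
`(1 ⊗ i)b₂`.

An operator `h` on `sE` of degree `-1` is extended to sequences of trees by
`h(x₁, …, x_n) = (x₁, …, h x_n)`, with the additional term `(x₁, …, x_n, i)`. Put `h = 0` on `sC`. Since
`E` is free over `sC` with respect to the operations `b_n`, `n ≥ 2`, and `H`, the requirement
`h(b T) = -b(h T)` for sequences `T` of length at least two, together with a value for `h(H p)`,
determines `h`. On such `T` the operator `1 - dh - hd`, with `d` the differential of sequences, acts as
`1 ⊗ e` (`defF_hopR_consL`), where `e = 1 - (1 ⊗ i)b₂ - b₁h - hb₁` on `sE`; the reason is that `d` and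
`h` anticommute except on the last tree. Hence `e(b T) = b((1 ⊗ e)T)` (`defP_nodeL`). Put
`h(H p) = -H((H p ⊗ i)b₂ + h p)`; as `Hb₁ + b₁H = 1`, this gives `e(H p) = H(e p)` (`defT_unaryL`). On
`sC` the values of `e` are, up to sign, generators of the ideal, because `(x ⊗ i)b₂ = x` in `C`. So `e` takes values in the ideal
(`defT_mem_idealT`).

The operator `h` preserves the ideal (`hop_mem_idealT`): it is compatible with the operations, and it sends
the generator belonging to `x₁ ⊗ ⋯ ⊗ x_n`, `n ≥ 2`, to the negative of `(x₁ ⊗ ⋯ ⊗ x_n ⊗ i)b_{n+1}`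
computed in `E`, which lies in the ideal because the same expression vanishes in `C`.

For `-(i ⊗ 1)b₂` the operator acts on the first tree and adds `i` in front, with the signs of right operators.
Both cases are instances of the operator `hop`.
-/

namespace AInf
variable {k : Type u} [CommRing k] {Ob : Type v}

/-! ### The homotopy operators -/

section
variable (C : GrQuiver.{u, v, w} k Ob) {B : Set Ob} (α β : k)
  (G : ∀ X Z : Ob, M C B .forest X Z →ₗ[k] M C B .forest X Z)

/-- The operator `hop` on a summand of sequences of length at least two, for given values on the first
tree `t` and on the sequence `f` of the other ones. -/
noncomputable def hopCons {X Y Z : Ob} (t : Tree B .tree X Y) (f : Tree B .forest Y Z)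
    (ht : t.mod C →ₗ[k] M C B .tree X Y) (hf : f.mod C →ₗ[k] M C B .forest Y Z) :
    t.mod C ⊗[k] f.mod C →ₗ[k] M C B .forest X Z :=
  TensorProduct.lift (α • (consL C).compl₁₂ (inj C t) hf +
    β • (consL C).compl₁₂ ht (sgn C ∘ₗ inj C f) +
      ((consL C).compl₁₂ (inj C t) (inj C f)).compr₂ (G X Z))

/-- The operator `hop` on a summand. -/
noncomputable def hopT : ∀ {κ : Kind} {X Z : Ob} (t : Tree B κ X Z), t.mod C →ₗ[k] M C B κ X Z
  | _, _, _, .leaf _ _ _ => 0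
  | _, _, _, .node t f => -(bGe C ∘ₗ hopCons C α β G t f (hopT t) (hopT f))
  | _, _, _, .ofPlain p => plainL C ∘ₗ hopT p
  | _, _, _, .unary h p => -(unaryL C h ∘ₗ (bGe C ∘ₗ G _ _ ∘ₗ oneL C ∘ₗ iUnary C h p + hopT p))
  | _, _, _, .one t => oneL C ∘ₗ hopT t + G _ _ ∘ₗ iOne C t
  | _, _, _, .cons t f => hopCons C α β G t f (hopT t) (hopT f)

/-- An operator `h` on trees, together with an extension to sequences of trees. On sequences it acts
through `h` on the last tree (for `α = 1`, `β = 0`) or on the first one (for `α = 0`, `β = 1`), and adds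
the value of `G`, which inserts a unit element. On trees it is determined by `h = 0` on `sC`, by
`h(b T) = -b(h T)` for sequences `T` of length at least two, and by `h(H p) = -H(b(h(H p)) + h p)`. In the
last formula the inner `h(H p)` is the value on the sequence of one tree, and `b` is the sum of the
operations of arity at least two, so only `G` contributes to it. -/
noncomputable def hop {κ : Kind} {X Z : Ob} : M C B κ X Z →ₗ[k] M C B κ X Z :=
  elim C (hopT C α β G)

variable {X Y Z : Ob}

theorem hop_inj {κ : Kind} (t : Tree B κ X Y) (x : t.mod C) :
    hop C α β G (inj C t x) = hopT C α β G t x := elim_inj ..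

theorem hop_iLeaf (n : ℤ) (x : C.deg X Y n) : hop C α β G (iLeaf C (B := B) X Y n x) = 0 :=
  elim_iLeaf C (hopT C α β G) n 0 rfl x

theorem hop_plainL (x : M C B .plain X Y) :
    hop C α β G (plainL C x) = plainL C (hop C α β G x) := by
  induction x using M_induction with
  | h0 => simp
  | hadd x x' hx hx' => simp [hx, hx']
  | h t x =>
    rw [plainL_inj, hop_inj]
    exact elim_iPlain _ _ t (plainL C ∘ₗ hopT C α β G t) rfl x

theorem hop_oneL (x : M C B .tree X Y) :
    hop C α β G (oneL C x) = oneL C (hop C α β G x) + G X Y (oneL C x) := by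
  induction x using M_induction with
  | h0 => simp
  | hadd x x' hx hx' => simp only [map_add, hx, hx']; abel
  | h t x =>
    rw [oneL_inj, hop_inj]
    exact elim_iOne _ _ t (oneL C ∘ₗ hopT C α β G t + G _ _ ∘ₗ iOne C t) rfl x

theorem hop_unaryL (h : X ∈ B ∨ Y ∈ B) (x : M C B .plain X Y) :
    hop C α β G (unaryL C h x) =
      -unaryL C h (bGe C (hop C α β G (oneL C (unaryL C h x))) + hop C α β G x) := by
  rw [hop_oneL, map_add (bGe C), bGe_oneL, zero_add]
  induction x using M_induction with
  | h0 => simp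
  | hadd x x' hx hx' => simp only [map_add, hx, hx']; abel
  | h t x =>
    rw [unaryL_inj, hop_inj]
    exact elim_iUnary _ _ h t
      (-(unaryL C h ∘ₗ (bGe C ∘ₗ G _ _ ∘ₗ oneL C ∘ₗ iUnary C h t + hopT C α β G t))) rfl x

theorem hop_consL (x : M C B .tree X Y) (y : M C B .forest Y Z) :
    hop C α β G (consL C x y) = α • consL C x (hop C α β G y) +
      β • consL C (hop C α β G x) (sgn C y) + G X Z (consL C x y) := by
  induction x, y using consL_add_ind with
  | h0 => simp
  | h0' => simp
  | ha x x' y h h' => simp only [map_add, LinearMap.add_apply, h, h', smul_add]; abel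
  | ha' x y y' h h' => simp only [map_add, h, h', smul_add]; abel
  | h t f x y =>
    rw [hop_inj, hop_inj, consL_inj, hop,
      elim_iCons _ _ t f (hopCons C α β G t f (hopT C α β G t) (hopT C α β G f)) rfl, ← consL_inj]
    rfl

theorem hop_nodeL (x : M C B .tree X Y) (y : M C B .forest Y Z) :
    hop C α β G (nodeL C x y) = -bGe C (hop C α β G (consL C x y)) := by
  induction x, y using consL_add_ind with
  | h0 => simp
  | h0' => simp
  | ha x x' y h h' => simp only [map_add, LinearMap.add_apply, h, h']; abel
  | ha' x y y' h h' => simp only [map_add, h, h']; abel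
  | h t f x y =>
    rw [nodeL_inj, consL_inj, hop, hop,
      elim_iCons _ _ t f (hopCons C α β G t f (hopT C α β G t) (hopT C α β G f)) rfl,
      elim_iNode _ _ t f
        (-(bGe C ∘ₗ hopCons C α β G t f (hopT C α β G t) (hopT C α β G f))) rfl]
    rfl

variable {G}

theorem hop_consL_mem (hG : ∀ X Z n, ∀ z ∈ degM C B .forest X Z n, G X Z z ∈ degM C B _ X Z (n - 1))
    {m n : ℤ} (x : M C B .tree X Y) (y : M C B .forest Y Z)
    (hx : x ∈ degM C B _ X Y m) (hy : y ∈ degM C B _ Y Z n)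
    (hx' : hop C α β G x ∈ degM C B _ X Y (m - 1)) (hy' : hop C α β G y ∈ degM C B _ Y Z (n - 1)) :
    hop C α β G (consL C x y) ∈ degM C B _ X Z (m + n - 1) := by
  rw [hop_consL]
  refine add_mem (add_mem ?_ ?_) (hG _ _ _ _ (consL_mem C hx hy))
  · rw [show m + n - 1 = m + (n - 1) by lia]
    exact Submodule.smul_mem _ _ (consL_mem C hx hy')
  · rw [show m + n - 1 = m - 1 + n by lia]
    exact Submodule.smul_mem _ _ (consL_mem C hx' (sgn_mem C hy))

theorem hop_key (hG : ∀ X Z n, ∀ z ∈ degM C B .forest X Z n, G X Z z ∈ degM C B _ X Z (n - 1)) :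
    ∀ {κ : Kind} {X Z : Ob} (t : Tree B κ X Z) (x : t.mod C),
      hop C α β G (inj C t x) ∈ degM C B κ X Z (t.degree - 1)
  | _, _, _, .leaf X Y n => fun x => by
    rw [show hop C α β G (inj C (.leaf X Y n) x) = 0 from hop_iLeaf C α β G n x]
    exact zero_mem _
  | _, _, _, .node t f => by
    have ht := hop_key hG t
    have hf := hop_key hG f
    have : ∀ z, hop C α β G (iNode C t f z) ∈ degM C B _ _ _ (t.degree + f.degree + 1 - 1) := by
      intro z
      induction z using TensorProduct.induction_on with
      | zero => rw [map_zero, map_zero]; exact zero_mem _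
      | tmul x y =>
        rw [← nodeL_inj, hop_nodeL]
        have := bGe_mem C (hop_consL_mem C α β hG _ _ (inj_mem C _ _) (inj_mem C _ _) (ht x) (hf y))
        rw [show t.degree + f.degree + 1 - 1 = t.degree + f.degree - 1 + 1 by lia]
        exact neg_mem this
      | add x y hx hy => rw [map_add, map_add]; exact add_mem hx hy
    exact this
  | _, _, _, .ofPlain p => by
    have hp := hop_key hG p
    have : ∀ x, hop C α β G (iPlain C p x) ∈ degM C B _ _ _ (p.degree - 1) := by
      intro x
      rw [← plainL_inj, hop_plainL]
      exact plainL_mem _ (hp x)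
    exact this
  | _, _, _, .unary h p => by
    have hp := hop_key hG p
    have : ∀ x, hop C α β G (iUnary C h p x) ∈ degM C B _ _ _ (p.degree - 1 - 1) := by
      intro x
      rw [← unaryL_inj, hop_unaryL, hop_oneL, map_add (bGe C), bGe_oneL, zero_add]
      refine neg_mem (unaryL_mem C h (add_mem ?_ (hp x)))
      have := bGe_mem C (hG _ _ _ _ (oneL_mem C (unaryL_mem C h (inj_mem C p x))))
      rwa [sub_add_cancel] at this
    exact this
  | _, _, _, .one t => by
    have ht := hop_key hG t
    have : ∀ x, hop C α β G (iOne C t x) ∈ degM C B _ _ _ (t.degree - 1) := by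
      intro x
      rw [← oneL_inj, hop_oneL]
      exact add_mem (oneL_mem _ (ht x)) (hG _ _ _ _ (oneL_mem C (inj_mem C t x)))
    exact this
  | _, _, _, .cons t f => by
    have ht := hop_key hG t
    have hf := hop_key hG f
    have : ∀ z, hop C α β G (iCons C t f z) ∈ degM C B _ _ _ (t.degree + f.degree - 1) := by
      intro z
      induction z using TensorProduct.induction_on with
      | zero => rw [map_zero, map_zero]; exact zero_mem _
      | tmul x y =>
        rw [← consL_inj]
        exact hop_consL_mem C α β hG _ _ (inj_mem C _ _) (inj_mem C _ _) (ht x) (hf y)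
      | add x y hx hy => rw [map_add, map_add]; exact add_mem hx hy
    exact this

theorem hop_mem (hG : ∀ X Z n, ∀ z ∈ degM C B .forest X Z n, G X Z z ∈ degM C B _ X Z (n - 1))
    {κ : Kind} {n : ℤ} {z : M C B κ X Z} (hz : z ∈ degM C B _ X Z n) :
    hop C α β G z ∈ degM C B _ X Z (n - 1) :=
  degM_le C (S := (degM C B _ X Z (n - 1)).comap (hop C α β G)) (fun t ht x => by
    subst ht; exact hop_key C α β hG t x) hz

theorem sgn_hop (hG : ∀ X Z n, ∀ z ∈ degM C B .forest X Z n, G X Z z ∈ degM C B _ X Z (n - 1))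
    {κ : Kind} (z : M C B κ X Z) : sgn C (hop C α β G z) = -hop C α β G (sgn C z) := by
  induction z using M_induction with
  | h0 => simp
  | hadd x x' hx hx' => simp only [map_add, hx, hx', neg_add]
  | h t x =>
    rw [sgn_inj, sgn_of_mem C (hop_mem C α β hG (inj_mem C t x)), Int.negOnePow_sub, map_zsmul]
    simp

end

/-! ### The defect of a homotopy operator -/

section
variable (C : Cat.{u, v, w} k Ob) {B : Set Ob} (α β : k)
  (G : ∀ X Z : Ob, M C.toGrQuiver B .forest X Z →ₗ[k] M C.toGrQuiver B .forest X Z) {X Y Z : Ob}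

/-- The defect `1 - dh - hd` of the operator on sequences of trees. -/
noncomputable def defF : M C.toGrQuiver B .forest X Z →ₗ[k] M C.toGrQuiver B .forest X Z :=
  LinearMap.id - d C ∘ₗ hop _ α β G - hop _ α β G ∘ₗ d C

/-- The defect `1 - r - b₁h - hb₁` on trees with non-unary lowest vertex, where `r x` is the product of `x`
with the unit: the sum of the operations of arity at least two, applied to `h` of the sequence `x`. -/
noncomputable def defP : M C.toGrQuiver B .plain X Z →ₗ[k] M C.toGrQuiver B .plain X Z :=
  LinearMap.id - bGe _ ∘ₗ hop _ α β G ∘ₗ oneL _ ∘ₗ plainL _ - d C ∘ₗ hop _ α β G -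
    hop _ α β G ∘ₗ d C

/-- The defect `1 - r - b₁h - hb₁` on all trees. -/
noncomputable def defT : M C.toGrQuiver B .tree X Z →ₗ[k] M C.toGrQuiver B .tree X Z :=
  LinearMap.id - plainL _ ∘ₗ bGe _ ∘ₗ hop _ α β G ∘ₗ oneL _ - d C ∘ₗ hop _ α β G -
    hop _ α β G ∘ₗ d C

theorem defF_apply (z : M C.toGrQuiver B .forest X Z) :
    defF C α β G z = z - d C (hop _ α β G z) - hop _ α β G (d C z) := rfl

theorem defP_apply (z : M C.toGrQuiver B .plain X Z) :
    defP C α β G z = z - bGe _ (hop _ α β G (oneL _ (plainL _ z))) - d C (hop _ α β G z) -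
      hop _ α β G (d C z) := rfl

theorem defT_apply (z : M C.toGrQuiver B .tree X Z) :
    defT C α β G z = z - plainL _ (bGe _ (hop _ α β G (oneL _ z))) - d C (hop _ α β G z) -
      hop _ α β G (d C z) := rfl

theorem defT_plainL (z : M C.toGrQuiver B .plain X Z) :
    defT C α β G (plainL _ z) = plainL _ (defP C α β G z) := by
  simp only [defT_apply, defP_apply, map_sub, hop_plainL, d_plainL]

variable {G}

/-- The value of `h` on `H p` is chosen so that the defect commutes with `H`. The hypothesis is used for
`bGe`, which annihilates sequences of one tree: it gives the value of `b₁` on the product of `H p` with the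
unit. -/
theorem defT_unaryL
    (h1 : ∀ x : M C.toGrQuiver B .tree X Z, defF C α β G (oneL _ x) = oneL _ (defT C α β G x))
    (h : X ∈ B ∨ Z ∈ B) (z : M C.toGrQuiver B .plain X Z) :
    defT C α β G (unaryL _ h z) = unaryL _ h (defP C α β G z) := by
  have h2 := congrArg (bGe _) (h1 (unaryL _ h z))
  rw [bGe_oneL, defF_apply, map_sub, map_sub, bGe_oneL, zero_sub, sub_eq_zero, ← d_bGe, d_oneL,
    d_unaryL] at h2
  rw [defT_apply, defP_apply, d_unaryL, hop_unaryL, map_neg, d_unaryL, map_sub, hop_plainL,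
    hop_unaryL, map_add (d C), h2]
  simp only [map_sub, map_add]
  abel

/-- The relation `h(b T) = -b(h T)` is imposed for sequences of length at least two only; the differential
of a sequence has in addition a component of length one, which accounts for the last term. -/
theorem hop_bGe_d (x : M C.toGrQuiver B .tree X Y) (y : M C.toGrQuiver B .forest Y Z) :
    hop _ α β G (bGe _ (d C (consL _ x y))) = -bGe _ (hop _ α β G (d C (consL _ x y))) +
      bGe _ (hop _ α β G (oneL _ (plainL _ (nodeL _ x y)))) := by
  have h1 : ∀ m : MM C.toGrQuiver B X Z,
      hop _ α β G (bGe _ (theta _ (fun _ => plainL _ ∘ₗ bGe _) m)) =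
        -bGe _ (hop _ α β G (theta _ (fun _ => plainL _ ∘ₗ bGe _) m)) := by
    intro m
    induction m using MM_induction with
    | h0 => simp
    | hadd x x' hx hx' => simp only [map_add, hx, hx', neg_add]
    | h W u v => rw [theta_inj, bGe_consL, hop_nodeL]
  simp only [d_consL₀, map_add, bGe_consL, hop_nodeL, bGe_oneL, map_zero, h1]
  abel

/-- The defect of a tree is obtained by grafting from the defect of the sequence of the trees above its
lowest vertex. -/
theorem defP_nodeL (x : M C.toGrQuiver B .tree X Y) (y : M C.toGrQuiver B .forest Y Z) :
    defP C α β G (nodeL _ x y) = bGe _ (defF C α β G (consL _ x y)) := by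
  rw [defP_apply, defF_apply, hop_nodeL, map_neg, d_bGe, neg_neg, d_nodeL, map_neg, hop_bGe_d,
    map_sub, map_sub, bGe_consL]
  abel

variable (G) in
/-- The operator `bh + hb` from sequences of trees to trees, with `b` the sum of all operations. -/
noncomputable def bHop : M C.toGrQuiver B .forest X Z →ₗ[k] M C.toGrQuiver B .tree X Z :=
  bAll C ∘ₗ hop _ α β G + hop _ α β G ∘ₗ bAll C

theorem bHop_apply (z : M C.toGrQuiver B .forest X Z) :
    bHop C α β G z = bAll C (hop _ α β G z) + hop _ α β G (bAll C z) := rfl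

theorem bHop_oneL (x : M C.toGrQuiver B .tree X Z) (hx : dOnly C (G X Z (oneL _ x)) = 0) :
    bHop C α β G (oneL _ x) = x - defT C α β G x := by
  rw [bHop_apply, defT_apply, bAll_apply C (hop _ α β G (oneL _ x)), bAll_oneL]
  nth_rewrite 2 [hop_oneL]
  rw [map_add, dOnly_oneL, hx]
  abel

theorem bHop_consL (x : M C.toGrQuiver B .tree X Y) (y : M C.toGrQuiver B .forest Y Z)
    (h : dOnly C (hop _ α β G (consL _ x y)) = 0) : bHop C α β G (consL _ x y) = 0 := by
  rw [bHop_apply, bAll_apply C (hop _ α β G (consL _ x y)), h, bAll_consL, hop_plainL, hop_nodeL,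
    map_neg, add_zero, add_neg_cancel]

end

/-! ### Induction on trees and sequences -/

section
variable (C : GrQuiver.{u, v, w} k Ob) {B : Set Ob}

theorem M_rec_key {P : ∀ (κ : Kind) (X Z : Ob), M C B κ X Z → Prop}
    (zero : ∀ κ X Z, P κ X Z 0) (add : ∀ κ X Z x y, P κ X Z x → P κ X Z y → P κ X Z (x + y))
    (leaf : ∀ X Z n x, P .plain X Z (iLeaf C X Z n x))
    (node : ∀ X Y Z x y, P .tree X Y x → P .forest Y Z y → P .plain X Z (nodeL C x y))
    (plain : ∀ X Z x, P .plain X Z x → P .tree X Z (plainL C x))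
    (unary : ∀ X Z h x, P .plain X Z x → P .tree X Z (unaryL C h x))
    (one : ∀ X Z x, P .tree X Z x → P .forest X Z (oneL C x))
    (cons : ∀ X Y Z x y, P .tree X Y x → P .forest Y Z y → P .forest X Z (consL C x y)) :
    ∀ {κ : Kind} {X Z : Ob} (t : Tree B κ X Z) (x : t.mod C), P κ X Z (inj C t x)
  | _, _, _, .leaf X Z n => leaf X Z n
  | _, _, _, .node t f => by
    have ht := M_rec_key zero add leaf node plain unary one cons t
    have hf := M_rec_key zero add leaf node plain unary one cons f
    have : ∀ z, P _ _ _ (iNode C t f z) := by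
      intro z
      induction z using TensorProduct.induction_on with
      | zero => rw [map_zero]; exact zero _ _ _
      | tmul x y => rw [← nodeL_inj]; exact node _ _ _ _ _ (ht x) (hf y)
      | add x y hx hy => rw [map_add]; exact add _ _ _ _ _ hx hy
    exact this
  | _, _, _, .ofPlain p => fun x =>
    plainL_inj C p x ▸ plain _ _ _ (M_rec_key zero add leaf node plain unary one cons p x)
  | _, _, _, .unary h p => fun x =>
    unaryL_inj C h p x ▸ unary _ _ h _ (M_rec_key zero add leaf node plain unary one cons p x)
  | _, _, _, .one t => fun x =>
    oneL_inj C t x ▸ one _ _ _ (M_rec_key zero add leaf node plain unary one cons t x)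
  | _, _, _, .cons t f => by
    have ht := M_rec_key zero add leaf node plain unary one cons t
    have hf := M_rec_key zero add leaf node plain unary one cons f
    have : ∀ z, P _ _ _ (iCons C t f z) := by
      intro z
      induction z using TensorProduct.induction_on with
      | zero => rw [map_zero]; exact zero _ _ _
      | tmul x y => rw [← consL_inj]; exact cons _ _ _ _ _ (ht x) (hf y)
      | add x y hx hy => rw [map_add]; exact add _ _ _ _ _ hx hy
    exact this

/-- Additive properties of trees and sequences of trees can be proved by simultaneous induction: the
modules `M C B κ X Z` are spanned by what grafting produces from `sC`. -/
theorem M_rec {P : ∀ (κ : Kind) (X Z : Ob), M C B κ X Z → Prop}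
    (zero : ∀ κ X Z, P κ X Z 0) (add : ∀ κ X Z x y, P κ X Z x → P κ X Z y → P κ X Z (x + y))
    (leaf : ∀ X Z n x, P .plain X Z (iLeaf C X Z n x))
    (node : ∀ X Y Z x y, P .tree X Y x → P .forest Y Z y → P .plain X Z (nodeL C x y))
    (plain : ∀ X Z x, P .plain X Z x → P .tree X Z (plainL C x))
    (unary : ∀ X Z h x, P .plain X Z x → P .tree X Z (unaryL C h x))
    (one : ∀ X Z x, P .tree X Z x → P .forest X Z (oneL C x))
    (cons : ∀ X Y Z x y, P .tree X Y x → P .forest Y Z y → P .forest X Z (consL C x y))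
    {κ : Kind} {X Z : Ob} (x : M C B κ X Z) : P κ X Z x :=
  M_induction C (zero _ _ _) (add _ _ _) (M_rec_key C zero add leaf node plain unary one cons) x

end

/-! ### Sequences of trees with a member in the ideal -/

section
variable (C : Cat.{u, v, w} k Ob) (B : Set Ob) {X Y Z : Ob}

theorem consL_Fo_cons (x : M C.toGrQuiver B .tree X Y) {W : Ob} (y : M C.toGrQuiver B .tree Y W)
    (q : Chain (M C.toGrQuiver B .tree) W Z) :
    consL _ x (Fo C B (.cons y q)) = Fo C B (.cons x (.cons y q)) :=
  (add_zero _).symm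

theorem Fo_single (x : M C.toGrQuiver B .tree X Y) : Fo C B (.single x) = oneL _ x := by
  simp [Chain.single, Fo, nilT]

theorem bAll_Fo (w : Chain (M C.toGrQuiver B .tree) X Z) (hw : 2 ≤ w.length) :
    bAll C (Fo C B w) = plainL _ (bGe _ (Fo C B w)) := by
  match w, hw with
  | .cons x (.cons y q), _ => rw [← consL_Fo_cons, bAll_consL, bGe_consL]
  | .cons x (.nil _), h => exact absurd h (by simp [Chain.length])
  | .nil _, h => exact absurd h (by simp [Chain.length])

theorem forest_mem_span_Fo (y : M C.toGrQuiver B .forest X Z) :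
    y ∈ Submodule.span k (Set.range (Fo C B (X := X) (Y := Z))) := by
  induction y using forest_induction with
  | h0 => exact zero_mem _
  | hadd x x' hx hx' => exact add_mem hx hx'
  | h1 x => exact Submodule.subset_span ⟨.single x, Fo_single C B x⟩
  | @hc X Y Z x y hy =>
    refine Submodule.span_le (p := (Submodule.span k (Set.range (Fo C B (X := X) (Y := Z)))).comap
      (consL _ x)) |>.2 ?_ hy
    rintro _ ⟨w, rfl⟩
    rw [SetLike.mem_coe, Submodule.mem_comap]
    cases w with
    | nil => rw [Fo, map_zero]; exact zero_mem _
    | cons y q => exact Submodule.subset_span ⟨_, (consL_Fo_cons C B x y q).symm⟩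

/-- The ideal `(R_C)₊` as a submodule of the direct sum over all trees. -/
noncomputable def idealT (X Z : Ob) : Submodule k (M C.toGrQuiver B .tree X Z) := ideal C B X Z

/-- The sums of sequences of elements of `sE` at least one of which lies in the ideal `(R_C)₊`. -/
noncomputable def idealF (X Z : Ob) : Submodule k (M C.toGrQuiver B .forest X Z) :=
  Submodule.span k {y | ∃ w : Chain (M C.toGrQuiver B .tree) X Z,
    w.Has (fun {X Y} z => z ∈ idealT C B X Y) ∧ Fo C B w = y}

variable {C B}

theorem Fo_mem_idealF {w : Chain (M C.toGrQuiver B .tree) X Z}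
    (h : w.Has (fun {X Y} z => z ∈ idealT C B X Y)) : Fo C B w ∈ idealF C B X Z :=
  Submodule.subset_span ⟨w, h, rfl⟩

theorem idealF_le {S : Submodule k (M C.toGrQuiver B .forest X Z)}
    (h : ∀ w : Chain (M C.toGrQuiver B .tree) X Z,
      w.Has (fun {X Y} z => z ∈ idealT C B X Y) → Fo C B w ∈ S) : idealF C B X Z ≤ S :=
  Submodule.span_le.2 fun _ ⟨w, hw, e⟩ => e ▸ h w hw

theorem oneL_mem_idealF {z : M C.toGrQuiver B .tree X Z} (hz : z ∈ idealT C B X Z) :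
    oneL _ z ∈ idealF C B X Z :=
  Fo_single C B z ▸ Fo_mem_idealF (w := .single z) (.inl hz)

theorem consL_mem_idealF_left {z : M C.toGrQuiver B .tree X Y} (hz : z ∈ idealT C B X Y)
    (y : M C.toGrQuiver B .forest Y Z) : consL _ z y ∈ idealF C B X Z := by
  refine Submodule.span_le (p := (idealF C B X Z).comap (consL _ z)) |>.2 ?_
    (forest_mem_span_Fo C B y)
  rintro _ ⟨w, rfl⟩
  rw [SetLike.mem_coe, Submodule.mem_comap]
  cases w with
  | nil => rw [Fo, map_zero]; exact zero_mem _
  | cons y q => rw [consL_Fo_cons]; exact Fo_mem_idealF (.inl hz)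

theorem consL_mem_idealF_right (x : M C.toGrQuiver B .tree X Y)
    {y : M C.toGrQuiver B .forest Y Z} (hy : y ∈ idealF C B Y Z) :
    consL _ x y ∈ idealF C B X Z := by
  refine idealF_le (S := (idealF C B X Z).comap (consL _ x)) (fun w hw => ?_) hy
  rw [Submodule.mem_comap]
  cases w with
  | nil => exact hw.elim
  | cons y q => rw [consL_Fo_cons]; exact Fo_mem_idealF (.inr hw)

theorem sgn_mem_idealF {y : M C.toGrQuiver B .forest X Z} (hy : y ∈ idealF C B X Z) :
    sgn _ y ∈ idealF C B X Z := by
  refine idealF_le (S := (idealF C B X Z).comap (sgn _)) (fun w hw => ?_) hy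
  rw [Submodule.mem_comap, ← Fo_sgn]
  have := has_parity C B w hw
  simp only [E, EQ_parity] at this
  exact Fo_mem_idealF this

theorem bGe_mem_idealT {y : M C.toGrQuiver B .forest X Z} (hy : y ∈ idealF C B X Z) :
    plainL _ (bGe _ y) ∈ idealT C B X Z := by
  refine idealF_le (S := (idealT C B X Z).comap (plainL _ ∘ₗ bGe _)) (fun w hw => ?_) hy
  rw [Submodule.mem_comap, LinearMap.comp_apply]
  by_cases h : 2 ≤ w.length
  · rw [← bAll_Fo C B w h]
    exact b_has C B (fun _ hz => hz) w h hw
  · match w, h with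
    | .nil _, _ => exact hw.elim
    | .cons x (.nil _), _ =>
      rw [show Fo C B (.cons x (.nil _)) = _ from Fo_single C B x, bGe_oneL, map_zero]
      exact zero_mem _
    | .cons _ (.cons _ _), h => exact absurd (by simp only [Chain.length]; lia) h

theorem unaryL_mem_idealT (h : X ∈ B ∨ Z ∈ B) {z : M C.toGrQuiver B .plain X Z}
    (hz : plainL _ z ∈ idealT C B X Z) : unaryL _ h z ∈ idealT C B X Z := .unary h z hz

end

/-! ### The homotopy operators modulo the ideal -/

section
variable (C : Cat.{u, v, w} k Ob) {B : Set Ob} (α β : k)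
  {G : ∀ X Z : Ob, M C.toGrQuiver B .forest X Z →ₗ[k] M C.toGrQuiver B .forest X Z} {X Y Z : Ob}

/-- The defect lies in the ideal as soon as it does on `sC` and is compatible with concatenation. -/
theorem defT_mem_idealT
    (h0 : ∀ X Z n (x : C.deg X Z n), plainL _ (defP C α β G (iLeaf C.toGrQuiver X Z n x)) ∈
      idealT C B X Z)
    (h1 : ∀ X Z (x : M C.toGrQuiver B .tree X Z),
      defF C α β G (oneL _ x) = oneL _ (defT C α β G x))
    (hc : ∀ X Y Z (x : M C.toGrQuiver B .tree X Y) (y : M C.toGrQuiver B .forest Y Z),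
      defT C α β G x ∈ idealT C B X Y → defF C α β G y ∈ idealF C B Y Z →
        defF C α β G (consL _ x y) ∈ idealF C B X Z)
    (x : M C.toGrQuiver B .tree X Z) : defT C α β G x ∈ idealT C B X Z := by
  refine M_rec C.toGrQuiver (B := B) (P := fun κ X Z => match κ with
    | .plain => fun z => plainL _ (defP C α β G z) ∈ idealT C B X Z
    | .tree => fun z => defT C α β G z ∈ idealT C B X Z
    | .forest => fun z => defF C α β G z ∈ idealF C B X Z) ?_ ?_ h0 ?_ ?_ ?_ ?_ hc (κ := .tree) x
  · rintro (_ | _ | _) X Z <;> simp only [map_zero] <;> exact zero_mem _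
  · rintro (_ | _ | _) X Z x y hx hy <;> simp only [map_add] <;> exact add_mem hx hy
  · intro X Y Z x y hx hy
    simp only [defP_nodeL]
    exact bGe_mem_idealT (hc _ _ _ _ _ hx hy)
  · intro X Z x hx
    simp only [defT_plainL]
    exact hx
  · intro X Z h x hx
    simp only [defT_unaryL C α β (h1 _ _)]
    exact unaryL_mem_idealT h hx
  · intro X Z x hx
    simp only [h1]
    exact oneL_mem_idealF hx

theorem hop_leafL (x : C.Hom X Y) :
    hop _ α β G (leafL C B x) = 0 := by
  refine C.hom_ext (f := hop _ α β G ∘ₗ leafL C B) (g := 0) (fun n x hx => ?_) x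
  rw [LinearMap.comp_apply, leafL, LinearMap.comp_apply, LinearEquiv.coe_coe, C.decomp_of_mem hx,
    DirectSum.toModule_lof, hop_iLeaf, LinearMap.zero_apply]

theorem hop_bAll (w : Chain (M C.toGrQuiver B .tree) X Z) (hw : 2 ≤ w.length) :
    hop _ α β G (bAll C (Fo C B w)) = -plainL _ (bGe _ (hop _ α β G (Fo C B w))) := by
  rw [bAll_Fo C B w hw, hop_plainL]
  match w, hw with
  | .cons x (.cons y q), _ => rw [← consL_Fo_cons, bGe_consL, hop_nodeL, map_neg]
  | .cons x (.nil _), h => exact absurd h (by simp [Chain.length])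
  | .nil _, h => exact absurd h (by simp [Chain.length])

/-- The embedding of `sC` as the summand of trivial trees. -/
noncomputable def embT {X Y : Ob} : C.Hom X Y →ₗ[k] M C.toGrQuiver B .tree X Y :=
  plainL _ ∘ₗ leafL C B

theorem hop_embT (x : C.Hom X Y) : hop _ α β G (embT C (B := B) x) = 0 := by
  rw [embT, LinearMap.comp_apply, hop_plainL, hop_leafL, map_zero]

/-- The homotopy operator preserves the ideal. -/
theorem hop_mem_idealT
    (hG : ∀ X Z, ∀ y ∈ idealF C B X Z, G X Z y ∈ idealF C B X Z)
    (hF : ∀ X Z (w : Chain (M C.toGrQuiver B .tree) X Z),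
      w.Has (fun {X Y} z => z ∈ idealT C B X Y ∧ hop _ α β G z ∈ idealT C B X Y) →
        hop _ α β G (Fo C B w) ∈ idealF C B X Z)
    (hδ : ∀ X Z (w : Chain C.Hom X Z), 2 ≤ w.length →
      plainL _ (bGe _ (hop _ α β G (Fo C B (w.map (embT C))))) ∈ idealT C B X Z)
    {z : M C.toGrQuiver B .tree X Z} (hz : z ∈ idealT C B X Z) :
    hop _ α β G z ∈ idealT C B X Z := by
  replace hz : Rel C B X Z z := hz
  induction hz with
  | zero => exact (hop _ α β G).map_zero ▸ zero_mem _
  | add z z' _ _ h h' => exact (hop C.toGrQuiver α β G).map_add z z' ▸ add_mem h h'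
  | smul c z _ h => exact (hop C.toGrQuiver α β G).map_smul c z ▸ Submodule.smul_mem _ _ h
  | delta w hw =>
    have h1 : hop _ α β G (bAll C (Fo C B (w.map (embT C))) - embT C (C.b w)) ∈ idealT C B _ _ := by
      rw [map_sub, hop_bAll C α β _ (by rwa [Chain.length_map]), hop_embT, sub_zero]
      exact neg_mem (hδ _ _ w hw)
    exact h1
  | op p z q hpq hz h =>
    have h1 := bGe_mem_idealT (hF _ _ (p.append (.cons z q))
      ((Chain.has_append _ _ _).2 (.inr (.inl ⟨hz, h⟩))))
    have h2 := hop_bAll C α β (G := G) (p.append (.cons z q)) hpq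
    exact h2 ▸ neg_mem h1
  | unary h z hz ih =>
    have h1 : hop _ α β G (plainL _ z) ∈ idealT C B _ _ := ih
    have h2 := bGe_mem_idealT (hG _ _ _ (oneL_mem_idealF (unaryL_mem_idealT h hz)))
    have h3 : hop _ α β G (unaryL _ h z) ∈ idealT C B _ _ := by
      rw [hop_unaryL, hop_oneL, map_add (bGe _), bGe_oneL, zero_add]
      refine neg_mem (unaryL_mem_idealT h ?_)
      rw [hop_plainL] at h1
      rw [map_add]
      exact add_mem h2 h1
    exact h3

end

/-! ### Multiplication by a unit on the right -/

section
variable (C : Cat.{u, v, w} k Ob) {B : Set Ob} (I : ∀ X : Ob, M C.toGrQuiver B .tree X X)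
  {X Y Z : Ob}

/-- The map that appends the element `I` to sequences of one tree, and is zero on longer sequences. -/
noncomputable def appendI (X Z : Ob) :
    M C.toGrQuiver B .forest X Z →ₗ[k] M C.toGrQuiver B .forest X Z :=
  elim _ fun
    | .one t => (consL _).flip (oneL _ (I Z)) ∘ₗ inj _ t
    | .cons _ _ => 0

theorem appendI_oneL (x : M C.toGrQuiver B .tree X Z) :
    appendI C I X Z (oneL _ x) = consL _ x (oneL _ (I Z)) := by
  induction x using M_induction with
  | h0 => simp
  | hadd x x' hx hx' => simp only [map_add, LinearMap.add_apply, hx, hx']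
  | h t x =>
    rw [oneL_inj]
    exact elim_iOne _ _ t ((consL _).flip (oneL _ (I Z)) ∘ₗ inj _ t) rfl x

theorem appendI_consL (x : M C.toGrQuiver B .tree X Y) (y : M C.toGrQuiver B .forest Y Z) :
    appendI C I X Z (consL _ x y) = 0 := by
  induction x, y using consL_add_ind with
  | h0 => simp
  | h0' => simp
  | ha x x' y h h' => simp only [map_add, LinearMap.add_apply, h, h', add_zero]
  | ha' x y y' h h' => simp only [map_add, h, h', add_zero]
  | h t f x y => rw [consL_inj]; exact elim_iCons _ _ t f 0 rfl _

/-- The homotopy operator for the multiplication by `I` on the right. -/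
noncomputable abbrev hopR {κ : Kind} {X Z : Ob} :
    M C.toGrQuiver B κ X Z →ₗ[k] M C.toGrQuiver B κ X Z := hop _ 1 0 (appendI C I)

theorem hopR_oneL (x : M C.toGrQuiver B .tree X Z) :
    hopR C I (oneL _ x) = oneL _ (hopR C I x) + consL _ x (oneL _ (I Z)) := by
  rw [hopR, hop_oneL, appendI_oneL]

theorem hopR_consL (x : M C.toGrQuiver B .tree X Y) (y : M C.toGrQuiver B .forest Y Z) :
    hopR C I (consL _ x y) = consL _ x (hopR C I y) := by
  rw [hopR, hop_consL, appendI_consL, one_smul, zero_smul, add_zero, add_zero]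

variable {I}

theorem appendI_mem (hI : ∀ X, I X ∈ degM C.toGrQuiver B .tree X X (-1)) (X Z : Ob) (n : ℤ) :
    ∀ z ∈ degM C.toGrQuiver B .forest X Z n, appendI C I X Z z ∈ degM _ B _ X Z (n - 1) :=
  fun _ hz => degM_forest_le _ (S := (degM _ B _ X Z (n - 1)).comap (appendI C I X Z))
    (fun x hx => by
      rw [Submodule.mem_comap, appendI_oneL]
      exact consL_mem _ hx (oneL_mem _ (hI Z)))
    (fun Y p q _ x _ y _ => by
      rw [Submodule.mem_comap, appendI_consL]
      exact zero_mem _) hz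

theorem cut_hopR (z : M C.toGrQuiver B .forest X Z) :
    cut _ (hopR C I z) = mapMM C (fun _ => LinearMap.id) (fun _ => hopR C I) (cut _ z) +
      injMM _ z (oneL _ (I Z)) := by
  induction z using forest_induction with
  | h0 => simp
  | hadd x x' hx hx' => simp only [map_add, LinearMap.add_apply, hx, hx']; abel
  | h1 x => simp [hopR_oneL, cut_oneL, cut_consL]
  | @hc X Y Z x y hy =>
    have : ∀ m : MM C.toGrQuiver B Y Z,
        mapMM C (fun _ => LinearMap.id) (fun _ => hopR C I) (consMM _ x m) =
          consMM _ x (mapMM C (fun _ => LinearMap.id) (fun _ => hopR C I) m) := by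
      intro m
      induction m using MM_induction with
      | h0 => simp
      | hadd x x' hx hx' => simp only [map_add, hx, hx']
      | h W u v => simp only [consMM_inj, mapMM_inj, LinearMap.id_apply]
    rw [hopR_consL, cut_consL, cut_consL, hy, map_add, map_add, this, mapMM_inj, consMM_inj,
      LinearMap.id_apply, add_assoc]

/-- Moving the operator past the terms `b_p ⊗ 1^β` of the differential produces only the terms of
`b h + h b` on the whole sequence, as `h` acts on the last tree. -/
theorem headC_hopR (hI : ∀ X, I X ∈ degM C.toGrQuiver B .tree X X (-1))
    (z : M C.toGrQuiver B .forest X Z) :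
    headC C (hopR C I z) + hopR C I (headC C z) =
      oneL _ (bAll C (hopR C I z) + hopR C I (bAll C z)) := by
  have h1 : ∀ m : MM C.toGrQuiver B X Z, theta _ (fun _ => bAll C)
      (mapMM C (fun _ => LinearMap.id) (fun _ => hopR C I) m) =
        -hopR C I (theta _ (fun _ => bAll C) m) := by
    intro m
    induction m using MM_induction with
    | h0 => simp
    | hadd x x' hx hx' => simp only [map_add, hx, hx', neg_add]
    | h W u v =>
      rw [mapMM_inj, theta_inj, theta_inj, hopR_consL, sgn_hop _ _ _ (appendI_mem C hI), map_neg,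
        LinearMap.id_apply]
  have h2 : sgn _ (oneL _ (I Z)) = -oneL _ (I Z) := by
    rw [sgn_of_mem _ (oneL_mem _ (hI Z))]; simp
  rw [headC_apply, headC_apply, cut_hopR, map_add, map_add, h1, theta_inj, h2, hopR_oneL, map_add,
    map_neg]
  abel

theorem bHop_hopR_oneL (x : M C.toGrQuiver B .tree X Z) :
    bHop C 1 0 (appendI C I) (oneL _ x) = x - defT C 1 0 (appendI C I) x :=
  bHop_oneL C 1 0 x (by rw [appendI_oneL, dOnly_consL])

theorem defF_hopR_oneL (hI : ∀ X, I X ∈ degM C.toGrQuiver B .tree X X (-1))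
    (hd : ∀ X, d C (I X) = 0) (x : M C.toGrQuiver B .tree X Z) :
    defF C 1 0 (appendI C I) (oneL _ x) = oneL _ (defT C 1 0 (appendI C I) x) := by
  have h1 : d C (hopR C I (oneL _ x)) = headC C (hopR C I (oneL _ x)) := by
    rw [hopR_oneL, map_add, map_add, d_oneL', d_consL, d_oneL, hd, map_zero, map_zero, zero_add]
  rw [defF_apply, h1, d_oneL', sub_sub, headC_hopR C hI, ← bHop_apply, bHop_hopR_oneL, map_sub,
    sub_sub_cancel]

/-- The defect of a sequence comes from its last tree. -/
theorem defF_hopR_consL (hI : ∀ X, I X ∈ degM C.toGrQuiver B .tree X X (-1))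
    (x : M C.toGrQuiver B .tree X Y) (y : M C.toGrQuiver B .forest Y Z) :
    defF C 1 0 (appendI C I) (consL _ x y) = consL _ x (defF C 1 0 (appendI C I) y) := by
  have h1 := headC_hopR C hI (consL _ x y)
  rw [← bHop_apply, bHop_consL C 1 0 x y (by rw [← hopR, hopR_consL, dOnly_consL]), map_zero,
    hopR_consL] at h1
  rw [defF_apply, defF_apply, d_consL, map_add, ← hopR, hopR_consL, hopR_consL, d_consL, map_sub,
    map_sub, eq_neg_of_add_eq_zero_left h1]
  abel

/-- The value of the operator on a string is the sum of two strings: in one it acts on the last morphism, in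
the other it appends `I`. -/
theorem hopR_Fo (p : Chain (M C.toGrQuiver B .tree) X Y) (z : M C.toGrQuiver B .tree Y Z) :
    hopR C I (Fo C B (p.append (.single z))) = Fo C B (p.append (.single (hopR C I z))) +
      Fo C B (p.append (.cons z (.single (I Z)))) := by
  induction p with
  | nil =>
    change hopR C I (Fo C B (.single z)) = Fo C B (.single _) + Fo C B (.cons z (.cons (I Z) (.nil Z)))
    rw [← consL_Fo_cons, Fo_single, Fo_single, hopR_oneL]
    congr 2
    exact (Fo_single C B (I Z)).symm
  | cons x p ih =>
    simp only [Chain.append, Fo, Chain.single, nilT_append, add_zero, hopR_consL] at ih ⊢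
    rw [ih, map_add]

theorem hopR_Fo_mem (p : Chain (M C.toGrQuiver B .tree) X Z)
    (hp : p.Has (fun {X Y} z => z ∈ idealT C B X Y ∧ hopR C I z ∈ idealT C B X Y)) :
    hopR C I (Fo C B p) ∈ idealF C B X Z := by
  induction p with
  | nil => exact hp.elim
  | cons x q ih =>
    cases q with
    | nil =>
      have hx := hp.resolve_right id
      rw [show Fo C B (.cons x (.nil _)) = _ from Fo_single C B x, hopR_oneL]
      exact add_mem (oneL_mem_idealF hx.2) (consL_mem_idealF_left hx.1 _)
    | cons y q =>
      rw [← consL_Fo_cons, hopR_consL]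
      rcases hp with hx | hq
      · exact consL_mem_idealF_left hx.1 _
      · exact consL_mem_idealF_right _ (ih hq)

theorem appendI_mem_idealF {y : M C.toGrQuiver B .forest X Z} (hy : y ∈ idealF C B X Z) :
    appendI C I X Z y ∈ idealF C B X Z := by
  refine idealF_le (S := (idealF C B X Z).comap (appendI C I X Z)) (fun p hp => ?_) hy
  rw [Submodule.mem_comap]
  match p, hp with
  | .cons x (.nil _), hp =>
    rw [show Fo C B (.cons x (.nil _)) = _ from Fo_single C B x, appendI_oneL]
    exact consL_mem_idealF_left (hp.resolve_right id) _
  | .cons x (.cons y q), _ =>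
    rw [← consL_Fo_cons, appendI_consL]
    exact zero_mem _

end

/-! ### Multiplication by a unit on the left -/

section
variable (C : Cat.{u, v, w} k Ob) {B : Set Ob} (I : ∀ X : Ob, M C.toGrQuiver B .tree X X)
  {X Y Z : Ob}

/-- The negative of the right operator `i ⊗ 1`: the map that puts the odd element `I` in front of a sequence
of trees, with the resulting signs. -/
noncomputable def prependI (X Z : Ob) :
    M C.toGrQuiver B .forest X Z →ₗ[k] M C.toGrQuiver B .forest X Z :=
  -(consL _ (I X) ∘ₗ sgn _)

theorem prependI_apply (z : M C.toGrQuiver B .forest X Z) :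
    prependI C I X Z z = -consL _ (I X) (sgn _ z) := rfl

/-- The homotopy operator for the multiplication by `I` on the left. -/
noncomputable abbrev hopL {κ : Kind} {X Z : Ob} :
    M C.toGrQuiver B κ X Z →ₗ[k] M C.toGrQuiver B κ X Z := hop _ 0 1 (prependI C I)

/-- The part of the operator `hopL` on sequences of trees that acts on the first tree. -/
noncomputable def hopFirst : M C.toGrQuiver B .forest X Z →ₗ[k] M C.toGrQuiver B .forest X Z :=
  hopL C I - prependI C I X Z

theorem hopFirst_oneL (x : M C.toGrQuiver B .tree X Z) :
    hopFirst C I (oneL _ x) = oneL _ (hopL C I x) := by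
  rw [hopFirst, LinearMap.sub_apply, hopL, hop_oneL, add_sub_cancel_right]

theorem hopFirst_consL (x : M C.toGrQuiver B .tree X Y) (y : M C.toGrQuiver B .forest Y Z) :
    hopFirst C I (consL _ x y) = consL _ (hopL C I x) (sgn _ y) := by
  rw [hopFirst, LinearMap.sub_apply, hopL, hop_consL, add_sub_cancel_right, one_smul, zero_smul,
    zero_add]

theorem hopL_apply (z : M C.toGrQuiver B .forest X Z) :
    hopL C I z = hopFirst C I z - consL _ (I X) (sgn _ z) := by
  rw [hopFirst, LinearMap.sub_apply, prependI_apply]; abel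

variable {I}

theorem prependI_mem (hI : ∀ X, I X ∈ degM C.toGrQuiver B .tree X X (-1)) (X Z : Ob) (n : ℤ) :
    ∀ z ∈ degM C.toGrQuiver B .forest X Z n, prependI C I X Z z ∈ degM _ B _ X Z (n - 1) :=
  fun z hz => by
    rw [prependI_apply, show n - 1 = -1 + n by lia]
    exact neg_mem (consL_mem _ (hI X) (sgn_mem _ hz))

theorem injMM_sub_left (u u' : M C.toGrQuiver B .forest X Y) (v : M C.toGrQuiver B .forest Y Z) :
    injMM _ (u - u') v = injMM _ u v - injMM _ u' v := by
  rw [eq_sub_iff_add_eq, ← LinearMap.add_apply, ← map_add, sub_add_cancel]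

theorem cut_hopL (z : M C.toGrQuiver B .forest X Z) :
    cut _ (hopL C I z) = mapMM C (fun _ => hopL C I) (fun _ => sgn _) (cut _ z) -
      injMM _ (oneL _ (I X)) (sgn _ z) := by
  induction z using forest_induction with
  | h0 => simp
  | hadd x x' hx hx' => simp only [map_add, hx, hx']; abel
  | h1 x =>
    rw [hopL_apply, hopFirst_oneL, map_sub, cut_oneL, cut_consL, sgn_oneL, cut_oneL, cut_oneL]
    simp
  | @hc X Y Z x y _ =>
    have : ∀ m : MM C.toGrQuiver B Y Z,
        mapMM C (fun _ => hopL C I) (fun _ => sgn _) (consMM _ x m) =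
          consMM _ (hopL C I x) (sgnMM _ m) - consMM _ (I X) (sgnMM _ (consMM _ x m)) := by
      intro m
      induction m using MM_induction with
      | h0 => simp
      | hadd x x' hx hx' => simp only [map_add, hx, hx']; abel
      | h W u v =>
        simp only [consMM_inj, mapMM_inj, sgnMM_inj, hopL_apply, hopFirst_consL,
          injMM_sub_left]
    rw [hopL_apply, hopFirst_consL, map_sub, cut_consL, cut_consL, cut_consL, cut_sgn, cut_sgn,
      cut_consL, map_add, map_add, map_add, this, mapMM_inj, hopL_apply C I (oneL _ x), hopFirst_oneL,
      injMM_sub_left, sgnMM_inj, consMM_inj, sgn_oneL]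
    abel

/-- `u ⊗ v ↦ (u)g ⊗ v`. -/
noncomputable def thetaOne (g : ∀ Y, M C.toGrQuiver B .forest X Y →ₗ[k] M C.toGrQuiver B .tree X Y) :
    MM C.toGrQuiver B X Z →ₗ[k] M C.toGrQuiver B .forest X Z :=
  elimMM _ fun Y => (consL _).comp (g Y)

theorem thetaOne_inj (g : ∀ Y, M C.toGrQuiver B .forest X Y →ₗ[k] M C.toGrQuiver B .tree X Y)
    (u : M C.toGrQuiver B .forest X Y) (v : M C.toGrQuiver B .forest Y Z) :
    thetaOne C g (injMM _ u v) = consL _ (g Y u) v := by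
  rw [thetaOne, elimMM_inj]; rfl

/-- Moving the operator past the terms `b_p ⊗ 1^β` of the differential. By `bHop_hopL_consL` only those of
the summands `bHop u ⊗ v` in which `u` is a single tree are nonzero. -/
theorem headC_hopL (hd : ∀ X, d C (I X) = 0) (z : M C.toGrQuiver B .forest X Z) :
    headC C (hopL C I z) + hopFirst C I (headC C z) =
      thetaOne C (fun _ => bHop C 0 1 (prependI C I)) (cut _ z) +
        oneL _ (bHop C 0 1 (prependI C I) z) := by
  have h1 : ∀ m : MM C.toGrQuiver B X Z, theta _ (fun _ => bAll C)
      (mapMM C (fun _ => hopL C I) (fun _ => sgn _) m) =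
        thetaOne C (fun _ => bHop C 0 1 (prependI C I)) m -
          hopFirst C I (theta _ (fun _ => bAll C) m) := by
    intro m
    induction m using MM_induction with
    | h0 => simp
    | hadd x x' hx hx' => simp only [map_add, hx, hx']; abel
    | h W u v =>
      rw [mapMM_inj, theta_inj, theta_inj, thetaOne_inj, hopFirst_consL, sgn_sgn, bHop_apply, map_add,
        LinearMap.add_apply, add_sub_cancel_right]
  rw [headC_apply, headC_apply, cut_hopL, map_sub, h1, theta_inj, bAll_oneL, hd, map_zero,
    LinearMap.zero_apply, map_add, hopFirst_oneL, bHop_apply, map_add]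
  abel

/-- The terms of the differential that do not involve the first tree anticommute with the operator, so only
those of the form `b_p ⊗ 1^β` are left. -/
theorem d_hopL_consL (x : M C.toGrQuiver B .tree X Y) (y : M C.toGrQuiver B .forest Y Z) :
    d C (hopL C I (consL _ x y)) + hopL C I (d C (consL _ x y)) =
      headC C (hopL C I (consL _ x y)) + hopFirst C I (headC C (consL _ x y)) := by
  rw [hopL_apply, hopL_apply, hopFirst_consL, map_sub, map_sub, d_consL C (hopL C I x),
    d_consL C (I X), sgn_d, d_consL C x, map_add (hopFirst C I), hopFirst_consL, sgn_d, map_neg, map_neg]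
  abel

theorem d_hopL_oneL (x : M C.toGrQuiver B .tree X Z) :
    d C (hopL C I (oneL _ x)) + hopL C I (d C (oneL _ x)) =
      headC C (hopL C I (oneL _ x)) + hopFirst C I (headC C (oneL _ x)) := by
  rw [hopL_apply, hopL_apply, hopFirst_oneL, map_sub, map_sub, d_oneL', d_consL C (I X), sgn_d,
    map_neg, d_oneL' C x]
  abel

theorem bHop_hopL_consL (x : M C.toGrQuiver B .tree X Y) (y : M C.toGrQuiver B .forest Y Z) :
    bHop C 0 1 (prependI C I) (consL _ x y) = 0 :=
  bHop_consL C 0 1 x y (by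
    rw [← hopL, hopL_apply, hopFirst_consL, map_sub, dOnly_consL, dOnly_consL, sub_zero])

theorem bHop_hopL_oneL (x : M C.toGrQuiver B .tree X Z) :
    bHop C 0 1 (prependI C I) (oneL _ x) = x - defT C 0 1 (prependI C I) x :=
  bHop_oneL C 0 1 x (by rw [prependI_apply, map_neg, dOnly_consL, neg_zero])

theorem defF_hopL_oneL (hd : ∀ X, d C (I X) = 0) (x : M C.toGrQuiver B .tree X Z) :
    defF C 0 1 (prependI C I) (oneL _ x) = oneL _ (defT C 0 1 (prependI C I) x) := by
  rw [defF_apply, sub_sub, d_hopL_oneL, headC_hopL C hd, cut_oneL, bHop_hopL_oneL, map_zero,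
    zero_add, map_sub, sub_sub_cancel]

/-- The defect of a sequence comes from its first tree. -/
theorem defF_hopL_consL (hd : ∀ X, d C (I X) = 0) (x : M C.toGrQuiver B .tree X Y)
    (y : M C.toGrQuiver B .forest Y Z) :
    defF C 0 1 (prependI C I) (consL _ x y) = consL _ (defT C 0 1 (prependI C I) x) y := by
  have h1 : ∀ m : MM C.toGrQuiver B Y Z,
      thetaOne C (fun _ => bHop C 0 1 (prependI C I)) (consMM _ x m) = 0 := by
    intro m
    induction m using MM_induction with
    | h0 => simp
    | hadd x x' hx hx' => rw [map_add, map_add, hx, hx', add_zero]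
    | h W u v => rw [consMM_inj, thetaOne_inj, bHop_hopL_consL, map_zero, LinearMap.zero_apply]
  rw [defF_apply, sub_sub, d_hopL_consL, headC_hopL C hd, cut_consL, map_add, h1, thetaOne_inj,
    bHop_hopL_consL, bHop_hopL_oneL, map_zero, add_zero, add_zero, map_sub, LinearMap.sub_apply,
    sub_sub_cancel]

theorem prependI_mem_idealF {y : M C.toGrQuiver B .forest X Z} (hy : y ∈ idealF C B X Z) :
    prependI C I X Z y ∈ idealF C B X Z :=
  neg_mem (consL_mem_idealF_right _ (sgn_mem_idealF hy))

theorem hopL_Fo_mem (p : Chain (M C.toGrQuiver B .tree) X Z)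
    (hp : p.Has (fun {X Y} z => z ∈ idealT C B X Y ∧ hopL C I z ∈ idealT C B X Y)) :
    hopL C I (Fo C B p) ∈ idealF C B X Z := by
  have hp' : Fo C B p ∈ idealF C B X Z := Fo_mem_idealF (has_mono (fun _ hz => hz.1) _ hp)
  rw [hopL_apply]
  refine sub_mem ?_ (consL_mem_idealF_right _ (sgn_mem_idealF hp'))
  match p, hp with
  | .cons x (.nil _), hp =>
    rw [show Fo C B (.cons x (.nil _)) = _ from Fo_single C B x, hopFirst_oneL]
    exact oneL_mem_idealF (hp.resolve_right id).2
  | .cons x (.cons y q), hp =>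
    rw [← consL_Fo_cons, hopFirst_consL]
    rcases hp with hx | hq
    · exact consL_mem_idealF_left hx.2 _
    · exact consL_mem_idealF_right _
        (sgn_mem_idealF (Fo_mem_idealF (has_mono (fun _ hz => hz.1) _ hq)))

end

/-! ### Strings of elements of `sC` and strict units -/

theorem Chain.exists_append_single {H : Ob → Ob → Type*} {X Z : Ob} (p : Chain H X Z)
    (hp : 1 ≤ p.length) :
    ∃ (Y : Ob) (q : Chain H X Y) (y : H Y Z), p = q.append (.single y) := by
  induction p with
  | nil => exact absurd hp (by simp [Chain.length])
  | @cons X Y Z x p ih =>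
    cases p with
    | nil => exact ⟨_, .nil _, x, rfl⟩
    | cons x' p =>
      obtain ⟨W, q, y, e⟩ := ih (by simp [Chain.length])
      exact ⟨W, .cons x q, y, congrArg (Chain.cons x) e⟩

section
variable (C : Cat.{u, v, w} k Ob) {B : Set Ob} {X Y Z : Ob}

theorem EQ_parity_apply (z : (E C B).Hom X Y) :
    (E C B).parity z = sgn C.toGrQuiver (κ := .tree) z :=
  congrArg (fun φ => φ z) (EQ_parity C B)

theorem sgn_embT (x : C.Hom X Y) : sgn _ (embT C (B := B) x) = embT C (C.parity x) := by
  exact (EQ_parity_apply C _).symm.trans (parity_embed C B x)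

theorem d_embT (x : C.Hom X Y) : d C (embT C (B := B) x) = embT C (C.b₁ x) :=
  (E_b₁ C B _).symm.trans (b₁_embed C B x)

/-- The generators of the ideal. -/
theorem bGe_Fo_sub_mem (p : Chain C.Hom X Y) (hp : 2 ≤ p.length) :
    plainL _ (bGe _ (Fo C B (p.map (embT C)))) - embT C (C.b p) ∈ idealT C B X Y := by
  rw [← bAll_Fo C B _ (by rwa [Chain.length_map])]
  exact delta_mem C B p hp

theorem Fo_append_zero {W : Ob} (p : Chain (M C.toGrQuiver B .tree) W X)
    (q : Chain (M C.toGrQuiver B .tree) Y Z) : Fo C B (p.append (.cons 0 q)) = 0 := by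
  simpa using Fo_smul C B p 0 0 q

variable {α β : k}
  {G : ∀ X Z : Ob, M C.toGrQuiver B .forest X Z →ₗ[k] M C.toGrQuiver B .forest X Z}

theorem defT_embT (x : C.Hom X Y) : defT C α β G (embT C x) =
    embT C x - plainL _ (bGe _ (hop _ α β G (oneL _ (embT C x)))) := by
  rw [defT_apply, d_embT, hop_embT, hop_embT, map_zero, sub_zero, sub_zero]

theorem plainL_defP_iLeaf (n : ℤ) (x : C.deg X Y n) :
    plainL _ (defP C α β G (iLeaf C.toGrQuiver (B := B) X Y n x)) =
      defT C α β G (embT C (x : C.Hom X Y)) := by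
  rw [← defT_plainL]
  exact congrArg _ (embed_of_mem C B x.2).symm

variable (B) in
/-- The elements of `sE` that are the images of given elements of `sC`. -/
noncomputable def unitT (i : ∀ X, C.Hom X X) (X : Ob) : M C.toGrQuiver B .tree X X := embT C (i X)

variable {i : ∀ X, C.Hom X X}

theorem unitT_mem (hi : C.IsUnits i) (X : Ob) :
    unitT C B i X ∈ degM C.toGrQuiver B .tree X X (-1) := embed_mem C B (hi.mem X)

theorem d_unitT (hi : C.IsUnits i) (X : Ob) : d C (unitT C B i X) = 0 := by
  rw [unitT, d_embT, hi.cycle, map_zero]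

theorem bAll_hopR (z : M C.toGrQuiver B .tree X Y) :
    plainL _ (bGe _ (hopR C (unitT C B i) (oneL _ z))) =
      bAll C (Fo C B (.cons z (.single (unitT C B i Y)))) := by
  rw [hopR_oneL, map_add, bGe_oneL, zero_add, bAll_Fo _ _ _ le_rfl, Chain.single, ← consL_Fo_cons,
    ← Fo_single]
  rfl

theorem bAll_hopL (z : M C.toGrQuiver B .tree X Y) :
    plainL _ (bGe _ (hopL C (unitT C B i) (oneL _ z))) =
      -bAll C (Fo C B (.cons (unitT C B i X) (.single (sgn _ z)))) := by
  rw [hopL_apply, hopFirst_oneL, map_sub, bGe_oneL, zero_sub, map_neg, bAll_Fo _ _ _ le_rfl,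
    Chain.single, ← consL_Fo_cons, sgn_oneL, ← Fo_single]
  rfl

/-- The map `(1 ⊗ i)b₂` is homotopic to the identity modulo the ideal. -/
theorem hopR_homotopy_mem (hi : C.IsUnits i)
    (h : ∀ (X Y : Ob) (x : C.Hom X Y), C.b (.cons x (.single (i Y))) = x)
    (z : M C.toGrQuiver B .tree X Y) :
    z - bAll C (Fo C B (.cons z (.single (unitT C B i Y)))) - d C (hopR C (unitT C B i) z) -
      hopR C (unitT C B i) (d C z) ∈ idealT C B X Y := by
  rw [← bAll_hopR]
  refine defT_mem_idealT C 1 0 ?_ (fun _ _ => defF_hopR_oneL C (unitT_mem C hi) (d_unitT C hi)) ?_ z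
  · intro X Y n x
    have h1 := bGe_Fo_sub_mem C (B := B) (.cons (x : C.Hom X Y) (.single (i Y))) (le_refl 2)
    rw [h, ← bAll_Fo _ _ _ le_rfl] at h1
    rw [plainL_defP_iLeaf, defT_embT, ← hopR, bAll_hopR, ← neg_mem_iff, neg_sub]
    exact h1
  · intro X Y Z x y _ hy
    rw [defF_hopR_consL C (unitT_mem C hi)]
    exact consL_mem_idealF_right x hy

/-- The map `-(i ⊗ 1)b₂` is homotopic to the identity modulo the ideal. -/
theorem hopL_homotopy_mem (hi : C.IsUnits i)
    (h : ∀ (X Y : Ob) (x : C.Hom X Y), C.b (.cons (i X) (.single (C.parity x))) = -x)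
    (z : M C.toGrQuiver B .tree X Y) :
    z - -bAll C (Fo C B (.cons (unitT C B i X) (.single (sgn _ z)))) -
      d C (hopL C (unitT C B i) z) - hopL C (unitT C B i) (d C z) ∈ idealT C B X Y := by
  rw [← bAll_hopL]
  refine defT_mem_idealT C 0 1 ?_ (fun _ _ => defF_hopL_oneL C (d_unitT C hi)) ?_ z
  · intro X Y n x
    have h1 := bGe_Fo_sub_mem C (B := B) (.cons (i X) (.single (C.parity (x : C.Hom X Y))))
      (le_refl 2)
    rw [h, ← bAll_Fo _ _ _ le_rfl, map_neg, sub_neg_eq_add, add_comm] at h1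
    rw [plainL_defP_iLeaf, defT_embT, ← hopL, bAll_hopL, sub_neg_eq_add, sgn_embT]
    exact h1
  · intro X Y Z x y hx _
    rw [defF_hopL_consL C (d_unitT C hi)]
    exact consL_mem_idealF_left hx y

theorem hopR_mem_idealT
    (h : ∀ (X Y : Ob) (p : Chain C.Hom X Y), 2 ≤ p.length → C.b (p.append (.single (i Y))) = 0)
    {z : M C.toGrQuiver B .tree X Y} (hz : z ∈ idealT C B X Y) :
    hopR C (unitT C B i) z ∈ idealT C B X Y := by
  refine hop_mem_idealT C 1 0 (fun _ _ _ => appendI_mem_idealF C)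
    (fun _ _ => hopR_Fo_mem C) ?_ hz
  intro X Z p hp
  have h1 := bGe_Fo_sub_mem C (B := B) (p.append (.single (i Z)))
    (by rw [Chain.length_append]; lia)
  rw [h _ _ p hp, map_zero, sub_zero] at h1
  obtain ⟨Y, q, y, rfl⟩ := p.exists_append_single (by lia)
  rw [Chain.map_append, Chain.single, Chain.map, Chain.map, ← Chain.single, ← hopR, hopR_Fo, hopR,
    hop_embT, Chain.single, Fo_append_zero, zero_add]
  simpa only [unitT, Chain.map_append, Chain.append_assoc, Chain.single, Chain.append, Chain.map] using h1

theorem hopL_mem_idealT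
    (h : ∀ (X Y : Ob) (p : Chain C.Hom X Y), 2 ≤ p.length → C.b (.cons (i X) p) = 0)
    {z : M C.toGrQuiver B .tree X Y} (hz : z ∈ idealT C B X Y) :
    hopL C (unitT C B i) z ∈ idealT C B X Y := by
  refine hop_mem_idealT C 0 1 (fun _ _ _ => prependI_mem_idealF C)
    (fun _ _ => hopL_Fo_mem C) ?_ hz
  intro X Z p hp
  have h1 := bGe_Fo_sub_mem C (B := B) (.cons (i X) (p.map C.parity))
    (by rw [Chain.length, Chain.length_map]; lia)
  rw [h _ _ _ (by rwa [Chain.length_map]), map_zero, sub_zero, Chain.map, Chain.map_map] at h1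
  have h2 : (p.map (embT C (B := B))).map (sgn C.toGrQuiver) =
      p.map fun {X Y} x => embT C (C.parity x) := by
    rw [Chain.map_map]; simp only [sgn_embT]
  rw [← h2] at h1
  match p, hp with
  | .cons x (.cons y q), _ =>
    have h3 : hopFirst C (unitT C B i)
        (Fo C B ((Chain.cons x (.cons y q)).map (embT C (B := B)))) = 0 := by
      rw [Chain.map, Chain.map, ← consL_Fo_cons, hopFirst_consL, hopL, hop_embT, map_zero,
        LinearMap.zero_apply]
    have h4 := consL_Fo_cons C B (unitT C B i X) (sgn _ (embT C x))
      (((Chain.cons y q).map (embT C (B := B))).map (sgn C.toGrQuiver))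
    rw [← hopL, hopL_apply, h3, zero_sub, map_neg, map_neg, neg_mem_iff, ← Fo_sgn]
    exact (congrArg (fun f => plainL _ (bGe _ f) ∈ idealT C B X Z) h4).mpr h1
  | .cons x (.nil _), h => exact absurd h (by simp [Chain.length])
  | .nil _, h => exact absurd h (by simp [Chain.length])

end

/-! ### Passage to the quotient -/

section
variable (C : Cat.{u, v, w} k Ob) {B : Set Ob} {X Y Z : Ob}

variable (B) in
/-- The projection of `sE` to the quotient. -/
noncomputable def projQ : (E C B).Hom X Y →ₗ[k] (Q C B).Hom X Y := (isIdeal C B).quotMk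

theorem projQ_surjective : Function.Surjective (projQ C B (X := X) (Y := Y)) :=
  (ideal C B X Y).mkQ_surjective

theorem projQ_eq_zero {z : (E C B).Hom X Y} (hz : z ∈ ideal C B X Y) : projQ C B z = 0 :=
  (Submodule.Quotient.mk_eq_zero _).2 hz

theorem Q_b_map (p : Chain (E C B).Hom X Y) :
    (Q C B).b (p.map (projQ C B)) = projQ C B ((E C B).b p) := Cat.quotB_map (isIdeal C B) p

theorem Q_parity (z : (E C B).Hom X Y) :
    (Q C B).parity (projQ C B z) = projQ C B ((E C B).parity z) :=
  Cat.quotQ_parity (isIdeal C B) z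

/-- An operator on `sE` of degree `-1` that preserves the ideal and is a homotopy between the identity map
and a map `ρ` modulo the ideal induces a homotopy on the quotient. -/
theorem exists_quot_homotopy (g ρ : (E C B).Hom X Y → (E C B).Hom X Y)
    (f : (Q C B).Hom X Y →ₗ[k] (Q C B).Hom X Y) (hf : ∀ z, f (projQ C B z) = projQ C B (g z))
    (hg : ∀ n, ∀ z ∈ (E C B).deg X Y n, g z ∈ (E C B).deg X Y (n - 1))
    (r : (Q C B).Hom X Y → (Q C B).Hom X Y) (hr : ∀ z, r (projQ C B z) = projQ C B (ρ z))
    (h : ∀ z, z - ρ z - (E C B).b₁ (g z) - g ((E C B).b₁ z) ∈ ideal C B X Y) :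
    (∀ n, ∀ x ∈ (Q C B).deg X Y n, f x ∈ (Q C B).deg X Y (n - 1)) ∧
      ∀ x, x - r x = f ((Q C B).b₁ x) + (Q C B).b₁ (f x) := by
  have hb : ∀ z : (E C B).Hom X Y, (Q C B).b₁ (projQ C B z) = projQ C B ((E C B).b₁ z) :=
    fun z => Q_b_map C (.single z)
  refine ⟨?_, fun x => ?_⟩
  · rintro n _ ⟨z, hz, rfl⟩
    exact ⟨g z, hg n z hz, (hf z).symm⟩
  · obtain ⟨z, rfl⟩ := projQ_surjective C x
    have h1 := projQ_eq_zero C (h z)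
    rw [map_sub, map_sub, map_sub, sub_sub, sub_eq_zero] at h1
    rw [hr, hb, hf, hf, hb, h1, add_comm]

variable {i : ∀ X, C.Hom X X}

theorem exists_homotopy_right (hi : C.IsUnits i)
    (h1 : ∀ (X Y : Ob) (x : C.Hom X Y), C.b (.cons x (.single (i Y))) = x)
    (h2 : ∀ (X Y : Ob) (p : Chain C.Hom X Y), 2 ≤ p.length → C.b (p.append (.single (i Y))) = 0)
    (X Y : Ob) : ∃ f : (Q C B).Hom X Y →ₗ[k] (Q C B).Hom X Y,
      (∀ n, ∀ x ∈ (Q C B).deg X Y n, f x ∈ (Q C B).deg X Y (n - 1)) ∧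
      ∀ x, x - (Q C B).b (.cons x (.single (toQ C B (i Y)))) =
        f ((Q C B).b₁ x) + (Q C B).b₁ (f x) := by
  let g : (E C B).Hom X Y →ₗ[k] (E C B).Hom X Y := hopR C (unitT C B i)
  refine ⟨(ideal C B X Y).mapQ (ideal C B X Y) g fun z hz => hopR_mem_idealT C h2 hz,
    exists_quot_homotopy C g (fun z => (E C B).b (.cons z (.single (embed C B (i Y))))) _
      (fun z => rfl) (fun n z hz => hop_mem _ 1 0 (appendI_mem C (unitT_mem C hi)) hz) _
      (fun z => Q_b_map C (.cons z (.single (embed C B (i Y))))) fun z => ?_⟩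
  rw [E_b₁, E_b₁]
  exact hopR_homotopy_mem C hi h1 z

theorem exists_homotopy_left (hi : C.IsUnits i)
    (h1 : ∀ (X Y : Ob) (x : C.Hom X Y), C.b (.cons (i X) (.single (C.parity x))) = -x)
    (h2 : ∀ (X Y : Ob) (p : Chain C.Hom X Y), 2 ≤ p.length → C.b (.cons (i X) p) = 0)
    (X Y : Ob) : ∃ f : (Q C B).Hom X Y →ₗ[k] (Q C B).Hom X Y,
      (∀ n, ∀ x ∈ (Q C B).deg X Y n, f x ∈ (Q C B).deg X Y (n - 1)) ∧
      ∀ x, x + (Q C B).b (.cons (toQ C B (i X)) (.single ((Q C B).parity x))) =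
        f ((Q C B).b₁ x) + (Q C B).b₁ (f x) := by
  let g : (E C B).Hom X Y →ₗ[k] (E C B).Hom X Y := hopL C (unitT C B i)
  have key := exists_quot_homotopy C g
    (fun z => -(E C B).b (.cons (embed C B (i X)) (.single ((E C B).parity z))))
    ((ideal C B X Y).mapQ (ideal C B X Y) g fun z hz => hopL_mem_idealT C h2 hz)
    (fun z => rfl) (fun n z hz => hop_mem _ 0 1 (prependI_mem C (unitT_mem C hi)) hz)
    (fun x => -(Q C B).b (.cons (toQ C B (i X)) (.single ((Q C B).parity x))))
    (fun z => by
      rw [Q_parity, map_neg]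
      exact congrArg Neg.neg
        (Q_b_map C (.cons (embed C B (i X)) (.single ((E C B).parity z))))) fun z => by
      rw [E_b₁, E_b₁, EQ_parity_apply]
      exact hopL_homotopy_mem C hi h1 z
  refine ⟨_, key.1, fun x => ?_⟩
  rw [← key.2, sub_neg_eq_add]

end

theorem isUnits_toQ (C : Cat.{u, v, w} k Ob) (B : Set Ob) (i : ∀ X, C.Hom X X) (hi : C.IsUnits i)
    (h_right : ∀ (X Y : Ob) (x : C.Hom X Y), C.b (.cons x (.single (i Y))) = x)
    (h_left : ∀ (X Y : Ob) (x : C.Hom X Y), C.b (.cons (i X) (.single (C.parity x))) = -x)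
    (h_right_higher : ∀ (X Y : Ob) (w : Chain C.Hom X Y), 2 ≤ w.length →
      C.b (w.append (.single (i Y))) = 0)
    (h_left_higher : ∀ (X Y : Ob) (w : Chain C.Hom X Y), 2 ≤ w.length →
      C.b (.cons (i X) w) = 0) :
    (Q C B).IsUnits fun X => toQ C B (i X) where
  mem X := ⟨_, unitT_mem C hi X, rfl⟩
  cycle X := by
    have h1 : (E C B).b₁ (embed C B (i X)) = 0 := by rw [b₁_embed, hi.cycle, map_zero]
    have h2 := Q_b_map C (.single (embed C B (i X)))
    rw [show (E C B).b (.single (embed C B (i X))) = 0 from h1, map_zero] at h2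
    exact h2
  right X Y := exists_homotopy_right C hi h_right h_right_higher X Y
  left X Y := exists_homotopy_left C hi h_left h_left_higher X Y

end AInf

theorem mainTheorem4 {k : Type u} [CommRing k] {Ob : Type v} (C : AInf.Cat.{u, v, w} k Ob)
    (B : Set Ob) (i : ∀ X, C.Hom X X) (hi : C.IsUnits i)
    (h_right : ∀ (X Y : Ob) (x : C.Hom X Y), C.b (.cons x (.single (i Y))) = x)
    (h_left : ∀ (X Y : Ob) (x : C.Hom X Y), C.b (.cons (i X) (.single (C.parity x))) = -x)
    (h_right_higher : ∀ (X Y : Ob) (w : AInf.Chain C.Hom X Y), 2 ≤ w.length →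
      C.b (w.append (.single (i Y))) = 0)
    (h_left_higher : ∀ (X Y : Ob) (w : AInf.Chain C.Hom X Y), 2 ≤ w.length →
      C.b (.cons (i X) w) = 0) :
    (AInf.Q C B).IsUnits fun X => AInf.toQ C B (i X) :=
  AInf.isUnits_toQ C B i hi h_right h_left h_right_higher h_left_higher
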